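/- **Setting.** Let $d\ge 1$, let $\mathcal X\subset\mathbb R^d$ be a closed convex set of finite diameter $D$ with $r\mathcal B\subseteq\mathcal X$ for some $r>0$ ($\mathcal B$ is the Euclidean unit ball), and let $L\ge 0$, $\beta>0$. In each round $t=1,2,\dots$ an environment chooses a loss $f_t$ that is convex, $L$-Lipschitz, differentiable and $\beta$-smooth on $\mathcal X$ ($\|\nabla f_t(x)-\nabla f_t(y)\|\le\beta\|x-y\|$ for $x,y\in\mathcal X$), and the learner has a prediction $m_t$ with $\|m_t\|\le L$; both may depend on the past, but not on the direction $v_t$ of round $t$ or on later ones. The learner chooses $y_t$ and $\delta_t$, draws $v_t\sim\mathrm{Unif}(\mathbb S^{d-1})$ independently of everything before, plays $x_t=y_t+\delta_tv_t$, and observes $f_t(y_t\pm\delta_tv_t)$. **Algorithm TP-VR-Opt++.** It uses $\mathcal X,r,D,L,\beta$ and $S_{\min}=\max\{1,L^2\}$. Time is cut into phases with time budgets $H=1,2,4,\dots$ (a phase ends after $H$ rounds). Each phase is cut into epochs: the first has budget $S=S_{\min}$, and an epoch ends as soon as its residual $\sum\|\hat g_t-m_t\|^2$ exceeds $V_{\max}=8dS$;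 the next epoch of the phase has budget $2S$. In an epoch with budgets $H,S$ put $$\delta=\min\Big\{\tfrac{\sqrt S}{d\beta H},\tfrac1{\beta\sqrt H},\tfrac r2\Big\},\quad \alpha=\tfrac{\delta}{r},\quad \mathcal X_\alpha=(1-\alpha)\mathcal X,\quad \eta_0=\sqrt{\tfrac{D^2}{2V_{\max}}},\quad N=\Big\lceil\log_2\tfrac{DH}{\eta_0}\Big\rceil+1,\quad \eta_i=\eta_02^{i-1}\ (1\le i\le N),\quad \varepsilon=\tfrac{\sqrt{\ln N}}{D\sqrt{V_{\max}}}.$$ At the start of the epoch the weights are reset to the prior $w_i\propto\frac1{i(i+1)}$, and the expert iterates $y'_i\in\mathcal X_\alpha$ are set to the projections onto $\mathcal X_\alpha$ of arbitrary points determined by the past. In each round of the epoch, with $\Pi$ the Euclidean projection onto $\mathcal X_\alpha$: * $y_{t,i}=\Pi(y'_i-\eta_im_t)$, $\;p_{t,i}\propto w_ie^{-\varepsilon\langle m_t,y_{t,i}\rangle}$, $\;y_t=\sum_{i=1}^Np_{t,i}y_{t,i}$, $\;x_t=y_t+\delta v_t$; * $\hat g_t=m_t+\frac d{2\delta}\big(f_t(y_t+\delta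 v_t)-f_t(y_t-\delta v_t)-2\delta\langle m_t,v_t\rangle\big)v_t$; * $w_i\leftarrow w_ie^{-\varepsilon\langle\hat g_t,y_{t,i}\rangle}/\sum_{j}w_je^{-\varepsilon\langle\hat g_t,y_{t,j}\rangle}$, $\;y'_i\leftarrow\Pi(y'_i-\eta_i\hat g_t)$. **Theorem.** There are universal constants $C>0$ and $k\in\mathbb N$ such that, for every problem as above, every horizon $T\ge1$ and every comparator sequence $u_1,\dots,u_T\in\mathcal X$, with $P_T=\sum_{t=2}^T\|u_t-u_{t-1}\|$ and $\bar S_T=\mathbb E\sum_{t=1}^T\|\nabla f_t(x_t)-m_t\|^2$, the algorithm TP-VR-Opt++, which is run without knowledge of $\bar S_T$, $P_T$ or $T$, satisfies (all expectations being of integrable random variables) $$\mathbb E\Big[\sum_{t=1}^T\big(f_t(x_t)-f_t(u_t)\big)\Big]\le C\,\big(1+\ln(T\max\{1,L\})\big)^k\left(\sqrt{d\,(\bar S_T+S_{\min})\,(D^2+DP_T)}+\frac{L+LD/r}{d\beta}\sqrt{\bar S_T+S_{\min}}\right).$$ In particular, for fixed $L,\beta,r$, the expected dynamic regret is $\widetilde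 O\big(\sqrt{d\,(\bar S_T+1)\,(D^2+DP_T)}\big)$. -/

import Mathlib

open MeasureTheory ProbabilityTheory
open scoped Pointwise

noncomputable section

namespace TPVR

/-- The ambient space `ℝ^d` with the Euclidean norm. -/
abbrev E (d : ℕ) : Type := EuclideanSpace ℝ (Fin d)

/-- The uniform distribution on the unit sphere of `ℝ^d` (normalized surface measure). -/
def uniformSphere (d : ℕ) : Measure (Metric.sphere (0 : E d) 1) :=
  ((volume : Measure (E d)).toSphere Set.univ)⁻¹ • (volume : Measure (E d)).toSphere

open Classical in
/-- Euclidean projection onto `K`: a point of `K` nearest to `x`. It exists and is unique when `K`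
is nonempty, closed and convex, which is the only case in which it is used. -/
def proj {d : ℕ} (K : Set (E d)) (x : E d) : E d :=
  if h : ∃ p ∈ K, ∀ q ∈ K, ‖x - p‖ ≤ ‖x - q‖ then h.choose else x

/-- Decision sets: closed bounded convex sets containing the ball of radius `r > 0` around `0`. -/
structure IsDecisionSet {d : ℕ} (X : Set (E d)) (r : ℝ) : Prop where
  isClosed : IsClosed X
  isBounded : Bornology.IsBounded X
  convex : Convex ℝ X
  r_pos : 0 < r
  ball_subset : Metric.closedBall (0 : E d) r ⊆ X

/-- Convex, `L`-Lipschitz, differentiable and `β`-smooth losses on `X`. Only the values of `f` on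
`X` matter; at boundary points the gradient is the gradient relative to `X`. -/
structure IsLoss {d : ℕ} (X : Set (E d)) (L β : ℝ) (f : E d → ℝ) : Prop where
  convexOn : ConvexOn ℝ X f
  lipschitz : ∀ x ∈ X, ∀ y ∈ X, |f x - f y| ≤ L * ‖x - y‖
  differentiableOn : DifferentiableOn ℝ f X
  smooth : ∀ x ∈ X, ∀ y ∈ X, ‖gradientWithin f X x - gradientWithin f X y‖ ≤ β * ‖x - y‖

/-- The inputs of the algorithm: the decision set, its in-radius, the Lipschitz constant and the
smoothness constant. There is no horizon, no path-length and no prediction error among them. -/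
structure Config (d : ℕ) where
  X : Set (E d)
  r : ℝ
  L : ℝ
  β : ℝ

/-- The state of the algorithm at the beginning of a round. -/
structure State (d : ℕ) where
  /-- time budget of the current phase -/
  H : ℕ
  /-- number of rounds already played in the current phase -/
  c : ℕ
  /-- prediction-sensitivity budget of the current epoch -/
  S : ℝ
  /-- observed residual accumulated in the current epoch -/
  R : ℝ
  /-- Hedge weights of the experts -/
  w : ℕ → ℝ
  /-- secondary iterates of the experts -/
  y' : ℕ → E d

namespace Config

variable {d : ℕ} (A : Config d)

/-- The diameter of the decision set. -/
def D : ℝ := Metric.diam A.X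

/-- The initial prediction-sensitivity budget of every phase. -/
def Smin : ℝ := max 1 (A.L ^ 2)

/-- The perturbation radius. -/
def δ (H : ℕ) (S : ℝ) : ℝ :=
  min (min (√S / (d * A.β * H)) (1 / (A.β * √H))) (A.r / 2)

/-- The shrunken decision set `(1 - α) X` with `α = δ / r`. -/
def shrunk (H : ℕ) (S : ℝ) : Set (E d) := (1 - A.δ H S / A.r) • A.X

/-- The residual threshold of an epoch. -/
def Vmax (_A : Config d) (S : ℝ) : ℝ := 8 * d * S

/-- The smallest step size of the grid. -/
def η₀ (S : ℝ) : ℝ := √(A.D ^ 2 / (2 * A.Vmax S))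

/-- The number of experts. -/
def numExperts (H : ℕ) (S : ℝ) : ℕ := ⌈Real.logb 2 (A.D * H / A.η₀ S)⌉₊ + 1

/-- The geometric grid of step sizes; experts are numbered from `0`. -/
def η (S : ℝ) (i : ℕ) : ℝ := A.η₀ S * 2 ^ i

/-- The step size of the meta algorithm. -/
def ε (H : ℕ) (S : ℝ) : ℝ := √(Real.log (A.numExperts H S)) / (A.D * √(A.Vmax S))

/-- The prior on the experts, proportional to `1 / (i (i + 1))` for `i = 1, …, N`. -/
def prior (H : ℕ) (S : ℝ) (i : ℕ) : ℝ :=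
  (1 / (((i : ℝ) + 1) * (i + 2))) /
    ∑ j ∈ Finset.range (A.numExperts H S), 1 / (((j : ℝ) + 1) * (j + 2))

/-- Start of an epoch: the residual is reset, the weights are reset to the prior, and expert `i` is
started at the projection of `z i`. -/
def newEpoch (H c : ℕ) (S : ℝ) (z : ℕ → E d) : State d where
  H := H
  c := c
  S := S
  R := 0
  w := A.prior H S
  y' := fun i => proj (A.shrunk H S) (z i)

/-- The center point of expert `i` for the prediction `m`. -/
def expertPoint (s : State d) (m : E d) (i : ℕ) : E d :=
  proj (A.shrunk s.H s.S) (s.y' i - A.η s.S i • m)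

/-- The multiplicative-weights update of the weights `w` on `N` experts with losses `ℓ`. -/
def hedge (N : ℕ) (ε : ℝ) (w ℓ : ℕ → ℝ) (i : ℕ) : ℝ :=
  w i * Real.exp (-ε * ℓ i) / ∑ j ∈ Finset.range N, w j * Real.exp (-ε * ℓ j)

/-- The optimistic Hedge distribution, with predicted losses `⟨m, y_i⟩`. -/
def prob (s : State d) (m : E d) : ℕ → ℝ :=
  hedge (A.numExperts s.H s.S) (A.ε s.H s.S) s.w (fun i => inner ℝ m (A.expertPoint s m i))

/-- The center point of the learner. -/
def center (s : State d) (m : E d) : E d :=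
  ∑ i ∈ Finset.range (A.numExperts s.H s.S), A.prob s m i • A.expertPoint s m i

/-- The query point `y + δ v`; the second query point is `query s m (-v)`. -/
def query (s : State d) (m v : E d) : E d := A.center s m + A.δ s.H s.S • v

/-- The variance-reduced estimator, from the feedback `a = f (y + δ v)`, `b = f (y - δ v)`. -/
def estimator (s : State d) (m v : E d) (a b : ℝ) : E d :=
  m + ((d / (2 * A.δ s.H s.S)) * (a - b - 2 * A.δ s.H s.S * inner ℝ m v)) • v

/-- One round of the algorithm with prediction `m`, direction `v` and feedback `a`, `b`; `z` are the
points from which the experts restart if a new epoch begins. If the phase has used up its time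
budget, a new phase with twice the time budget begins; otherwise, if the residual exceeds its
threshold, a new epoch with twice the sensitivity budget begins; otherwise the meta algorithm
and the experts are updated. -/
def update (s : State d) (m v : E d) (a b : ℝ) (z : ℕ → E d) : State d :=
  let g := A.estimator s m v a b
  let R' := s.R + ‖g - m‖ ^ 2
  if s.H ≤ s.c + 1 then A.newEpoch (2 * s.H) 0 A.Smin z
  else if A.Vmax s.S < R' then A.newEpoch s.H (s.c + 1) (2 * s.S) z
  else
    { H := s.H
      c := s.c + 1
      S := s.S
      R := R'
      w := hedge (A.numExperts s.H s.S) (A.ε s.H s.S) s.w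
        (fun i => inner ℝ g (A.expertPoint s m i))
      y' := fun i => proj (A.shrunk s.H s.S) (s.y' i - A.η s.S i • g) }

/-- The states of the algorithm (rounds are numbered from `0`), for losses `f`, predictions `m`,
directions `v` and restart points `z`. The losses enter only through the two-point feedback. -/
def state (f : ℕ → E d → ℝ) (m v : ℕ → E d) (z : ℕ → ℕ → E d) : ℕ → State d
  | 0 => A.newEpoch 1 0 A.Smin (z 0)
  | t + 1 =>
    let s := state f m v z t
    A.update s (m t) (v t) (f t (A.query s (m t) (v t))) (f t (A.query s (m t) (-v t))) (z (t + 1))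

/-- The point played in round `t`. -/
def play (f : ℕ → E d → ℝ) (m v : ℕ → E d) (z : ℕ → ℕ → E d) (t : ℕ) : E d :=
  A.query (A.state f m v z t) (m t) (v t)

/-- The dynamic regret of the first `T` rounds against the comparators `u`. -/
def dynRegret (f : ℕ → E d → ℝ) (m v : ℕ → E d) (z : ℕ → ℕ → E d) (u : ℕ → E d) (T : ℕ) : ℝ :=
  ∑ t ∈ Finset.range T, (f t (A.play f m v z t) - f t (u t))

/-- The cumulative prediction error of the first `T` rounds. -/
def predError (f : ℕ → E d → ℝ) (m v : ℕ → E d) (z : ℕ → ℕ → E d) (T : ℕ) : ℝ :=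
  ∑ t ∈ Finset.range T, ‖gradientWithin (f t) A.X (A.play f m v z t) - m t‖ ^ 2

end Config

/-- The path-length of the first `T` comparators. -/
def pathLength {d : ℕ} (u : ℕ → E d) (T : ℕ) : ℝ :=
  ∑ t ∈ Finset.range (T - 1), ‖u (t + 1) - u t‖

end TPVR

end

/-! The argument is deterministic along each trajectory until the very end; probability enters
through two moments of the direction and one use of Jensen.

Pathwise, `round_le` bounds the loss difference of one round by a linear term `⟨ĝ, y - u'⟩`, with
`u'` the comparator scaled into the shrunken set, plus a deterministic error of order `δ`, plus a
`noise` term. The noise collects whatever cancels on average: up to a bias of order `δ`, the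
estimate is `m + d⟨∇f(y) - m, v⟩v`, and a uniform direction satisfies `E v = 0` and `d E[⟨a,v⟩⟨b,v⟩]
= ⟨a,b⟩`.

The linear terms of one epoch are handled by optimistic Hedge over optimistic gradient descents
(`hedge_step`, `optimistic_step`, `round_regret_le`). The potentials telescope, the residual of all
rounds but the last is at most `Vmax`, and the last round, which may overshoot, is charged linearly
in `‖ĝ - m‖`. A geometric grid of step sizes contains one within a factor two of the tuned step size
for any path length (`exists_expert`).

The budget `S` doubles only after a residual above `8dS` was observed, so at all times `S ≤ Smin +
V/(4d)`, where `V` is the total residual (`R_le_S_le`). Hence every epoch obeys the same bound, in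
terms of the total path length and `V`. As a residual is at most `4d²L²` per round, a phase has only
logarithmically many epochs, and doubling `H` gives logarithmically many phases; multiplying by
their number costs only logarithms.

In expectation the noise vanishes, and Jensen moves the expectation inside `√(Smin + V/(4d))`. By
isotropy the squared coefficient `d²⟨∇f(y) - m, v⟩²` has mean `d‖∇f(y) - m‖²`, so `E V` is at most
`4d` times the expected prediction error plus a harmonic sum (`integral_residual_term_le`): one
factor `d`, not two.

The logarithms so obtained contain `d`. If `d ≤ T²` it is absorbed by `log T`; otherwise `√d ≥ T`
and the trivial regret bound `TLD` suffices. -/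

namespace TPVR

/-! ### Euclidean projections and the optimistic gradient step. -/

section Projection

variable {d : ℕ} {K : Set (E d)}

lemma exists_nearest (hK : IsClosed K) (hne : K.Nonempty) (x : E d) :
    ∃ p ∈ K, ∀ q ∈ K, ‖x - p‖ ≤ ‖x - q‖ := by
  obtain ⟨p, hp, h⟩ := hK.exists_infDist_eq_dist hne x
  refine ⟨p, hp, fun q hq => ?_⟩
  rw [← dist_eq_norm, ← dist_eq_norm, ← h]
  exact Metric.infDist_le_dist_of_mem hq

lemma proj_mem (hK : IsClosed K) (hne : K.Nonempty) (x : E d) : proj K x ∈ K := by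
  have h := exists_nearest hK hne x
  rw [proj, dif_pos h]
  exact h.choose_spec.1

lemma norm_sub_proj_le (hK : IsClosed K) (hne : K.Nonempty) (x : E d) {q : E d} (hq : q ∈ K) :
    ‖x - proj K x‖ ≤ ‖x - q‖ := by
  have h := exists_nearest hK hne x
  rw [proj, dif_pos h]
  exact h.choose_spec.2 q hq

lemma inner_sub_proj_le (hK : IsClosed K) (hc : Convex ℝ K) (hne : K.Nonempty) (x : E d)
    {q : E d} (hq : q ∈ K) : inner ℝ (x - proj K x) (q - proj K x) ≤ 0 := by
  have hp := proj_mem hK hne x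
  refine (norm_eq_iInf_iff_real_inner_le_zero hc hp).1 ?_ q hq
  have : Nonempty K := ⟨⟨_, hp⟩⟩
  apply le_antisymm
  · exact le_ciInf fun w => norm_sub_proj_le hK hne x w.2
  · exact ciInf_le ⟨0, by rintro _ ⟨w, rfl⟩; positivity⟩ (⟨_, hp⟩ : K)

/-- Adding the variational inequalities of `p` and of `proj K x`, each tested at the other point,
gives `‖proj K x - p‖² ≤ 0`. This is the uniqueness that the definition of `proj` by choice does not
provide. -/
lemma proj_eq_of_inner_le (hK : IsClosed K) (hc : Convex ℝ K) (x : E d) {p : E d} (hp : p ∈ K)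
    (h : ∀ q ∈ K, inner ℝ (x - p) (q - p) ≤ 0) : proj K x = p := by
  have h1 := h _ (proj_mem hK ⟨p, hp⟩ x)
  have h2 := inner_sub_proj_le hK hc ⟨p, hp⟩ x hp
  have h3 : inner ℝ (proj K x - p) (proj K x - p) ≤ 0 := by
    have : inner ℝ (proj K x - p) (proj K x - p)
        = inner ℝ (x - p) (proj K x - p) + inner ℝ (x - proj K x) (p - proj K x) := by
      rw [← neg_sub p (proj K x)]
      simp only [inner_neg_left, inner_neg_right, inner_sub_left, inner_sub_right]
      ring
    linarith
  rw [real_inner_self_eq_norm_sq] at h3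
  have h4 : ‖proj K x - p‖ = 0 := by
    have := norm_nonneg (proj K x - p)
    nlinarith
  exact sub_eq_zero.1 (norm_eq_zero.1 h4)

lemma proj_eq_self (hK : IsClosed K) (hc : Convex ℝ K) {x : E d} (hx : x ∈ K) :
    proj K x = x :=
  proj_eq_of_inner_le hK hc x hx fun q _ => by simp

lemma norm_proj_sub_proj_le (hK : IsClosed K) (hc : Convex ℝ K) (hne : K.Nonempty) (x y : E d) :
    ‖proj K x - proj K y‖ ≤ ‖x - y‖ := by
  have h1 := inner_sub_proj_le hK hc hne x (proj_mem hK hne y)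
  have h2 := inner_sub_proj_le hK hc hne y (proj_mem hK hne x)
  have h3 : ‖proj K x - proj K y‖ ^ 2 ≤ inner ℝ (x - y) (proj K x - proj K y) := by
    rw [← real_inner_self_eq_norm_sq]
    simp only [inner_sub_left, inner_sub_right] at h1 h2 ⊢
    linarith
  have h4 := real_inner_le_norm (x - y) (proj K x - proj K y)
  have h5 := norm_nonneg (proj K x - proj K y)
  have h6 := norm_nonneg (x - y)
  by_contra! h
  nlinarith

lemma continuous_proj (hK : IsClosed K) (hc : Convex ℝ K) (hne : K.Nonempty) :
    Continuous (proj K) :=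
  (LipschitzWith.of_dist_le_mul (K := 1) fun x y => by
    simpa [dist_eq_norm] using norm_proj_sub_proj_le hK hc hne x y).continuous

/-- The shrunken set is random, since its factor depends on the state. Rescaling reduces it to the
single continuous map `proj K`, which is what makes the iterates measurable. -/
lemma proj_smul (hK : IsClosed K) (hc : Convex ℝ K) (hne : K.Nonempty) {ρ : ℝ} (hρ : 0 < ρ)
    (x : E d) : proj (ρ • K) x = ρ • proj K (ρ⁻¹ • x) := by
  refine proj_eq_of_inner_le (hK.smul₀ ρ) (hc.smul ρ) x
    (Set.smul_mem_smul_set (proj_mem hK hne _)) ?_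
  rintro _ ⟨q, hq, rfl⟩
  have h := inner_sub_proj_le hK hc hne (ρ⁻¹ • x) hq
  have h1 : x - ρ • proj K (ρ⁻¹ • x) = ρ • (ρ⁻¹ • x - proj K (ρ⁻¹ • x)) := by
    rw [smul_sub, smul_inv_smul₀ hρ.ne']
  have h2 : ρ • q - ρ • proj K (ρ⁻¹ • x) = ρ • (q - proj K (ρ⁻¹ • x)) := by rw [smul_sub]
  change inner ℝ (x - ρ • proj K (ρ⁻¹ • x)) (ρ • q - ρ • proj K (ρ⁻¹ • x)) ≤ 0
  rw [h1, h2, inner_smul_left, inner_smul_right]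
  have : 0 ≤ ρ * ρ := by positivity
  simp only [conj_trivial]
  nlinarith

/-- One step of optimistic projected gradient descent. -/
lemma optimistic_step (hK : IsClosed K) (hc : Convex ℝ K) (hne : K.Nonempty) {η D : ℝ}
    (hη : 0 < η) (hD : ∀ p ∈ K, ∀ q ∈ K, ‖p - q‖ ≤ D) (y' m g : E d) {u : E d} (hu : u ∈ K) :
    inner ℝ g (proj K (y' - η • m) - u) ≤
      (‖y' - u‖ ^ 2 - ‖proj K (y' - η • g) - u‖ ^ 2) / (2 * η) +
        min (η * ‖g - m‖ ^ 2 / 2) (D * ‖g - m‖) := by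
  set y := proj K (y' - η • m) with hy
  set y₁ := proj K (y' - η • g) with hy₁
  have hym : y ∈ K := proj_mem hK hne _
  have hy₁m : y₁ ∈ K := proj_mem hK hne _
  have h1 := inner_sub_proj_le hK hc hne (y' - η • m) hy₁m
  have h2 := inner_sub_proj_le hK hc hne (y' - η • g) hu
  rw [← hy] at h1
  rw [← hy₁] at h2
  -- Polarization rewrites the two variational inequalities with squared distances; in their sum the
  -- terms `‖y' - y₁‖²` cancel.
  have e1 : inner ℝ (y' - η • m - y) (y₁ - y)
      = η * inner ℝ m (y - y₁) + (‖y' - y‖ ^ 2 + ‖y - y₁‖ ^ 2 - ‖y' - y₁‖ ^ 2) / 2 := by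
    simp only [← real_inner_self_eq_norm_sq, inner_sub_left, inner_sub_right, inner_smul_left,
      conj_trivial, real_inner_comm y' y, real_inner_comm y' y₁, real_inner_comm y y₁]
    ring
  have e2 : inner ℝ (y' - η • g - y₁) (u - y₁)
      = η * inner ℝ g (y₁ - u) + (‖y' - y₁‖ ^ 2 + ‖y₁ - u‖ ^ 2 - ‖y' - u‖ ^ 2) / 2 := by
    simp only [← real_inner_self_eq_norm_sq, inner_sub_left, inner_sub_right, inner_smul_left,
      conj_trivial, real_inner_comm y' u, real_inner_comm y' y₁, real_inner_comm u y₁]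
    ring
  have e3 : inner ℝ g (y - u)
      = inner ℝ (g - m) (y - y₁) + inner ℝ m (y - y₁) + inner ℝ g (y₁ - u) := by
    simp only [inner_sub_left, inner_sub_right]
    ring
  have h3 := real_inner_le_norm (g - m) (y - y₁)
  have h4 : η * inner ℝ g (y - u) ≤
      η * (‖g - m‖ * ‖y - y₁‖) - ‖y - y₁‖ ^ 2 / 2 + (‖y' - u‖ ^ 2 - ‖y₁ - u‖ ^ 2) / 2 := by
    rw [e3]
    have := mul_le_mul_of_nonneg_left h3 hη.le
    nlinarith [sq_nonneg ‖y' - y‖]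
  have h5 : (‖y' - u‖ ^ 2 - ‖y₁ - u‖ ^ 2) / (2 * η) = η⁻¹ * ((‖y' - u‖ ^ 2 - ‖y₁ - u‖ ^ 2) / 2) := by
    field_simp
  have key : ∀ B, η * (‖g - m‖ * ‖y - y₁‖) - ‖y - y₁‖ ^ 2 / 2 ≤ η * B →
      inner ℝ g (y - u) ≤ (‖y' - u‖ ^ 2 - ‖y₁ - u‖ ^ 2) / (2 * η) + B := by
    intro B hB
    have : η * inner ℝ g (y - u) ≤ η * ((‖y' - u‖ ^ 2 - ‖y₁ - u‖ ^ 2) / (2 * η) + B) := by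
      rw [h5, mul_add, mul_inv_cancel_left₀ hη.ne']
      linarith
    exact le_of_mul_le_mul_left this hη
  -- The first bound completes a square in `‖y - y₁‖`; the second drops the negative square and uses
  -- the diameter. The second serves the round in which the residual overshoots its threshold.
  rcases min_choice (η * ‖g - m‖ ^ 2 / 2) (D * ‖g - m‖) with h | h <;> rw [h] <;> apply key
  · nlinarith [sq_nonneg (η * ‖g - m‖ - ‖y - y₁‖)]
  · have := mul_le_mul_of_nonneg_left (hD y hym y₁ hy₁m) (norm_nonneg (g - m))
    have := mul_le_mul_of_nonneg_left this hη.le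
    nlinarith [sq_nonneg ‖y - y₁‖]

end Projection

/-! ### Optimistic Hedge. -/

section Hedge

/-- Hoeffding's lemma for a finite distribution. -/
lemma sum_mul_exp_le {ι : Type*} (s : Finset ι) {p x : ι → ℝ} {b : ℝ} (hp : ∀ i ∈ s, 0 ≤ p i)
    (hp1 : ∑ i ∈ s, p i = 1) (hx0 : ∑ i ∈ s, p i * x i = 0) (hx : ∀ i ∈ s, |x i| ≤ b) :
    ∑ i ∈ s, p i * Real.exp (x i) ≤ Real.exp (min (b ^ 2 / 2) b) := by
  rcases min_choice (b ^ 2 / 2) b with h | h <;> rw [h]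
  · rcases le_or_gt b 0 with hb | hb
    · have hx' : ∀ i ∈ s, x i = 0 := fun i hi => abs_eq_zero.1
        (le_antisymm ((hx i hi).trans hb) (abs_nonneg _))
      rw [Finset.sum_congr rfl fun i hi => by rw [hx' i hi, Real.exp_zero, mul_one], hp1]
      exact Real.one_le_exp (by positivity)
    -- On `[-b, b]` the exponential lies below its chord; the mean-zero condition removes the slope
    -- of the chord and leaves `cosh b`.
    · have hconv : ∀ i ∈ s, Real.exp (x i) ≤ Real.cosh b + x i / b * Real.sinh b := by
        intro i hi
        obtain ⟨h1, h2⟩ := abs_le.1 (hx i hi)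
        have := convexOn_exp.2 (Set.mem_univ b) (Set.mem_univ (-b))
          (div_nonneg (by linarith) (by linarith) : 0 ≤ (b + x i) / (2 * b))
          (div_nonneg (by linarith) (by linarith) : 0 ≤ (b - x i) / (2 * b))
          (by field_simp; ring)
        have e : ((b + x i) / (2 * b)) • b + ((b - x i) / (2 * b)) • (-b) = x i := by
          simp only [smul_eq_mul]
          field_simp
          ring
        rw [e] at this
        refine this.trans_eq ?_
        rw [Real.cosh_eq, Real.sinh_eq]
        simp only [smul_eq_mul]
        field_simp
        ring
      calc ∑ i ∈ s, p i * Real.exp (x i)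
          ≤ ∑ i ∈ s, p i * (Real.cosh b + x i / b * Real.sinh b) :=
            Finset.sum_le_sum fun i hi => mul_le_mul_of_nonneg_left (hconv i hi) (hp i hi)
        _ = (∑ i ∈ s, p i) * Real.cosh b + (∑ i ∈ s, p i * x i) * (Real.sinh b / b) := by
            rw [Finset.sum_mul, Finset.sum_mul, ← Finset.sum_add_distrib]
            refine Finset.sum_congr rfl fun i _ => ?_
            ring
        _ = Real.cosh b := by rw [hp1, hx0]; ring
        _ ≤ Real.exp (b ^ 2 / 2) := Real.cosh_le_exp_half_sq b
  · calc ∑ i ∈ s, p i * Real.exp (x i) ≤ ∑ i ∈ s, p i * Real.exp b :=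
          Finset.sum_le_sum fun i hi => mul_le_mul_of_nonneg_left
            (Real.exp_le_exp.2 ((le_abs_self _).trans (hx i hi))) (hp i hi)
      _ = Real.exp b := by rw [← Finset.sum_mul, hp1, one_mul]

open Config

variable {N : ℕ} {ε : ℝ} {w : ℕ → ℝ}

lemma hedge_denom_pos (hN : 0 < N) (hw : ∀ i < N, 0 < w i) (ℓ : ℕ → ℝ) :
    0 < ∑ j ∈ Finset.range N, w j * Real.exp (-ε * ℓ j) :=
  Finset.sum_pos (fun j hj => mul_pos (hw j (Finset.mem_range.1 hj)) (Real.exp_pos _))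
    ⟨0, Finset.mem_range.2 hN⟩

lemma hedge_pos (hw : ∀ i < N, 0 < w i) (ℓ : ℕ → ℝ) {i : ℕ} (hi : i < N) :
    0 < hedge N ε w ℓ i :=
  div_pos (mul_pos (hw i hi) (Real.exp_pos _)) (hedge_denom_pos (by omega) hw ℓ)

lemma sum_hedge (hN : 0 < N) (hw : ∀ i < N, 0 < w i) (ℓ : ℕ → ℝ) :
    ∑ i ∈ Finset.range N, hedge N ε w ℓ i = 1 := by
  simp only [hedge]
  rw [← Finset.sum_div, div_self (hedge_denom_pos hN hw ℓ).ne']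

/-- One step of optimistic Hedge. -/
lemma hedge_step (hε : 0 < ε) (hw : ∀ i < N, 0 < w i)
    (hw1 : ∑ i ∈ Finset.range N, w i = 1) (ℓ h : ℕ → ℝ) {M : ℝ}
    (hM : ∀ j < N, |ℓ j - h j - ∑ i ∈ Finset.range N, hedge N ε w h i * (ℓ i - h i)| ≤ M)
    {i : ℕ} (hi : i < N) :
    ∑ j ∈ Finset.range N, hedge N ε w h j * ℓ j - ℓ i ≤
      (Real.log (hedge N ε w ℓ i) - Real.log (w i)) / ε + min (ε * M ^ 2 / 2) M := by
  have hN : 0 < N := by omega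
  set p := hedge N ε w h with hp
  set Zh := ∑ j ∈ Finset.range N, w j * Real.exp (-ε * h j) with hZh
  set Zl := ∑ j ∈ Finset.range N, w j * Real.exp (-ε * ℓ j) with hZl
  have hZh0 : 0 < Zh := hedge_denom_pos hN hw h
  have hZl0 : 0 < Zl := hedge_denom_pos hN hw ℓ
  have hp0 : ∀ j ∈ Finset.range N, 0 ≤ p j := fun j hj =>
    (hedge_pos hw h (Finset.mem_range.1 hj)).le
  have hp1 : ∑ j ∈ Finset.range N, p j = 1 := sum_hedge hN hw h
  set Δ := ∑ i ∈ Finset.range N, p i * (ℓ i - h i) with hΔ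
  have hpz : ∀ j, p j = w j * Real.exp (-ε * h j) / Zh := fun j => rfl
  have hlog : Real.log (hedge N ε w ℓ i) = Real.log (w i) + -ε * ℓ i - Real.log Zl := by
    rw [hedge, Real.log_div (mul_pos (hw i hi) (Real.exp_pos _)).ne' hZl0.ne',
      Real.log_mul (hw i hi).ne' (Real.exp_pos _).ne', Real.log_exp]
  -- Jensen for `exp`: since `p j` is `w j * exp (-ε h j) / Zh`, the averaged exponentials sum to
  -- `(∑ w j) / Zh = 1 / Zh`.
  have hJ : Real.exp (ε * ∑ j ∈ Finset.range N, p j * h j) ≤ Zh⁻¹ := by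
    have := convexOn_exp.map_sum_le (t := Finset.range N) (w := p) (p := fun j => ε * h j) hp0 hp1
      (fun _ _ => Set.mem_univ _)
    simp only [smul_eq_mul] at this
    calc Real.exp (ε * ∑ j ∈ Finset.range N, p j * h j)
        = Real.exp (∑ j ∈ Finset.range N, p j * (ε * h j)) := by
          rw [Finset.mul_sum]
          congr 1
          exact Finset.sum_congr rfl fun j _ => by ring
      _ ≤ _ := this
      _ = ∑ j ∈ Finset.range N, w j / Zh := by
          refine Finset.sum_congr rfl fun j _ => ?_
          rw [hpz, div_mul_eq_mul_div, mul_assoc, ← Real.exp_add]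
          simp
      _ = Zh⁻¹ := by rw [← Finset.sum_div, hw1, one_div]
  have hH := sum_mul_exp_le (Finset.range N) (p := p) (x := fun j => -ε * (ℓ j - h j - Δ))
    (b := ε * M) hp0 hp1 (by
      calc _ = -ε * (∑ j ∈ Finset.range N, p j * (ℓ j - h j)
              - (∑ j ∈ Finset.range N, p j) * Δ) := by
            rw [Finset.sum_mul, ← Finset.sum_sub_distrib, Finset.mul_sum]
            exact Finset.sum_congr rfl fun j _ => by ring
        _ = 0 := by rw [hp1, ← hΔ]; ring)
    (fun j hj => by
      rw [abs_mul, abs_neg, abs_of_pos hε]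
      exact mul_le_mul_of_nonneg_left (hM j (Finset.mem_range.1 hj)) hε.le)
  -- Splitting `ℓ = h + Δ + (ℓ - h - Δ)` isolates the prediction error centred under `p`, to which
  -- Hoeffding's lemma applies.
  have hZ : Zl = Zh * Real.exp (-ε * Δ) *
      ∑ j ∈ Finset.range N, p j * Real.exp (-ε * (ℓ j - h j - Δ)) := by
    rw [Finset.mul_sum]
    refine Finset.sum_congr rfl fun j _ => ?_
    rw [hpz, show -ε * ℓ j = -ε * h j + (-ε * Δ + -ε * (ℓ j - h j - Δ)) by ring,
      Real.exp_add, Real.exp_add]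
    field_simp
  have hmin : min ((ε * M) ^ 2 / 2) (ε * M) = ε * min (ε * M ^ 2 / 2) M := by
    rw [mul_min_of_nonneg _ _ hε.le]
    congr 1
    ring
  have hlZ : Real.log Zl ≤ -ε * (∑ j ∈ Finset.range N, p j * ℓ j) + ε * min (ε * M ^ 2 / 2) M := by
    rw [Real.log_le_iff_le_exp hZl0, hZ]
    have h1 : Zh ≤ Real.exp (-ε * ∑ j ∈ Finset.range N, p j * h j) := by
      rw [neg_mul, Real.exp_neg]
      exact (le_inv_comm₀ (Real.exp_pos _) hZh0).1 hJ
    rw [hmin] at hH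
    calc _ ≤ Real.exp (-ε * ∑ j ∈ Finset.range N, p j * h j) * Real.exp (-ε * Δ) *
          Real.exp (ε * min (ε * M ^ 2 / 2) M) :=
          mul_le_mul (mul_le_mul_of_nonneg_right h1 (Real.exp_pos _).le) hH
            (Finset.sum_nonneg fun j hj => mul_nonneg (hp0 j hj) (Real.exp_pos _).le)
            (by positivity)
      _ = _ := by
          rw [← Real.exp_add, ← Real.exp_add]
          congr 2
          rw [hΔ, ← mul_add, ← Finset.sum_add_distrib]
          congr 1
          exact Finset.sum_congr rfl fun j _ => by ring
  rw [hlog]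
  have : (Real.log (w i) + -ε * ℓ i - Real.log Zl - Real.log (w i)) / ε
      = -ℓ i - Real.log Zl / ε := by field_simp; ring
  rw [this]
  have h2 : Real.log Zl / ε ≤ -(∑ j ∈ Finset.range N, p j * ℓ j) + min (ε * M ^ 2 / 2) M := by
    rw [div_le_iff₀ hε]
    linarith
  linarith

end Hedge

end TPVR

namespace TPVR

/-! ### Geometry of the decision set. -/

section DecisionSet

variable {d : ℕ} {X : Set (E d)} {r : ℝ}

namespace IsDecisionSet

lemma zero_mem (h : IsDecisionSet X r) : (0 : E d) ∈ X :=
  h.ball_subset (Metric.mem_closedBall_self h.r_pos.le)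

lemma nonempty (h : IsDecisionSet X r) : X.Nonempty := ⟨0, h.zero_mem⟩

lemma norm_sub_le (h : IsDecisionSet X r) {x y : E d} (hx : x ∈ X) (hy : y ∈ X) :
    ‖x - y‖ ≤ Metric.diam X := by
  rw [← dist_eq_norm]
  exact Metric.dist_le_diam_of_mem h.isBounded hx hy

lemma norm_le (h : IsDecisionSet X r) {x : E d} (hx : x ∈ X) : ‖x‖ ≤ Metric.diam X := by
  simpa using h.norm_sub_le hx h.zero_mem

lemma two_mul_r_le (h : IsDecisionSet X r) (hd : 1 ≤ d) : 2 * r ≤ Metric.diam X := by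
  have hr := h.r_pos
  let e : E d := EuclideanSpace.single ⟨0, hd⟩ r
  have he : ‖e‖ = r := by simp [e, abs_of_pos hr]
  have h1 : e ∈ X := h.ball_subset (by simp [he])
  have h2 : -e ∈ X := h.ball_subset (by simp [he])
  have h3 := h.norm_sub_le h1 h2
  have h4 : e - -e = (2 : ℝ) • e := by rw [two_smul]; abel
  rw [h4, norm_smul, he] at h3
  simpa using h3

lemma diam_pos (h : IsDecisionSet X r) (hd : 1 ≤ d) : 0 < Metric.diam X := by
  have := h.two_mul_r_le hd
  have := h.r_pos
  linarith

lemma smul_subset (h : IsDecisionSet X r) {ρ : ℝ} (h0 : 0 ≤ ρ) (h1 : ρ ≤ 1) : ρ • X ⊆ X := by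
  rintro _ ⟨x, hx, rfl⟩
  exact h.convex.smul_mem_of_zero_mem h.zero_mem hx ⟨h0, h1⟩

/-- With `y = (1 - α)x`, the sum `(1 - α)x + α(w/α)` is a convex combination of `x` and a point of
the ball of radius `r`. This is why queries around the shrunken set stay in `X`. -/
lemma add_mem_of_mem_smul (h : IsDecisionSet X r) {α : ℝ} (h0 : 0 ≤ α) (h1 : α ≤ 1) {y w : E d}
    (hy : y ∈ (1 - α) • X) (hw : ‖w‖ ≤ α * r) : y + w ∈ X := by
  obtain ⟨x, hx, rfl⟩ := hy
  rcases h0.eq_or_lt with rfl | h0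
  · have : w = 0 := norm_le_zero_iff.1 (by simpa using hw)
    simpa [this] using hx
  · have hw' : α⁻¹ • w ∈ X := by
      apply h.ball_subset
      rw [mem_closedBall_zero_iff, norm_smul, norm_inv, Real.norm_of_nonneg h0.le,
        inv_mul_le_iff₀ h0]
      exact hw
    have := h.convex hx hw' (sub_nonneg.2 h1) h0.le (by ring)
    rwa [smul_inv_smul₀ h0.ne'] at this

lemma smul_mem_nhds (h : IsDecisionSet X r) {ρ : ℝ} (h0 : 0 ≤ ρ) (h1 : ρ < 1) {x : E d}
    (hx : x ∈ X) : X ∈ nhds (ρ • x) := by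
  have hr := h.r_pos
  have hpos : 0 < (1 - ρ) * r := mul_pos (by linarith) hr
  refine Filter.mem_of_superset (Metric.closedBall_mem_nhds _ hpos) fun y hy => ?_
  rw [mem_closedBall_iff_norm] at hy
  have := h.add_mem_of_mem_smul (α := 1 - ρ) (y := ρ • x) (w := y - ρ • x) (by linarith)
    (by linarith) (by rw [sub_sub_cancel]; exact Set.smul_mem_smul_set hx) hy
  simpa using this

end IsDecisionSet

end DecisionSet

/-! ### First-order inequalities for smooth convex losses on a closed set. -/

namespace IsLoss

variable {d : ℕ} {X : Set (E d)} {r L β : ℝ} {f : E d → ℝ}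

lemma hasDerivWithinAt_segment (hX : IsDecisionSet X r) (hf : IsLoss X L β f) {x y : E d}
    (hx : x ∈ X) (hy : y ∈ X) :
    HasDerivWithinAt (fun s : ℝ => f (x + s • (y - x))) (inner ℝ (gradientWithin f X x) (y - x))
      (Set.Icc 0 1) 0 := by
  have h1 : HasFDerivWithinAt f (InnerProductSpace.toDual ℝ (E d) (gradientWithin f X x)) X
      (x + (0 : ℝ) • (y - x)) := by
    simpa using (hf.differentiableOn x hx).hasGradientWithinAt.hasFDerivWithinAt
  have h2 : HasDerivWithinAt (fun s : ℝ => x + s • (y - x)) (y - x) (Set.Icc 0 1) 0 := by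
    simpa using (((hasDerivAt_id (0 : ℝ)).smul_const (y - x)).const_add x).hasDerivWithinAt
  have h3 := h1.comp_hasDerivWithinAt (0 : ℝ) h2 (fun s hs =>
    hX.convex.add_smul_sub_mem hx hy hs)
  exact h3

/-- First-order characterization of convexity. -/
lemma inner_gradient_le (hX : IsDecisionSet X r) (hf : IsLoss X L β f) {x y : E d}
    (hx : x ∈ X) (hy : y ∈ X) : inner ℝ (gradientWithin f X x) (y - x) ≤ f y - f x := by
  have hconv : ConvexOn ℝ (Set.Icc (0 : ℝ) 1) (fun s : ℝ => f (x + s • (y - x))) := by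
    refine ⟨convex_Icc 0 1, fun s hs t ht a b ha hb hab => ?_⟩
    have := hf.convexOn.2 (hX.convex.add_smul_sub_mem hx hy hs)
      (hX.convex.add_smul_sub_mem hx hy ht) ha hb hab
    refine (le_of_eq ?_).trans this
    obtain rfl : b = 1 - a := by linarith
    change f _ = f _
    congr 1
    simp only [smul_eq_mul]
    module
  have := hconv.le_slope_of_hasDerivWithinAt (x := 0) (y := 1) (by simp) (by simp) one_pos
    (hasDerivWithinAt_segment hX hf hx hy)
  simpa [slope] using this

/-- Convexity at `y` and the Lipschitz gradient give the quadratic upper bound without integration,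
with `β` in place of the sharp `β/2`. -/
lemma le_add_inner_add (hX : IsDecisionSet X r) (hf : IsLoss X L β f) {x y : E d}
    (hx : x ∈ X) (hy : y ∈ X) :
    f y - f x ≤ inner ℝ (gradientWithin f X x) (y - x) + β * ‖y - x‖ ^ 2 := by
  have h1 := inner_gradient_le hX hf hy hx
  have h2 : inner ℝ (gradientWithin f X y) (x - y) = -inner ℝ (gradientWithin f X x) (y - x)
      - inner ℝ (gradientWithin f X y - gradientWithin f X x) (y - x) := by
    simp only [inner_sub_left, inner_sub_right]
    ring
  have h3 := real_inner_le_norm (gradientWithin f X y - gradientWithin f X x) (y - x)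
  have h4 := mul_le_mul_of_nonneg_right (hf.smooth y hy x hx) (norm_nonneg (y - x))
  nlinarith

/-- Both first-order remainders, at `y + w` and at `y - w`, lie in `[0, β‖w‖²]`, so their difference
is at most `β‖w‖²` in absolute value. -/
lemma abs_two_point_sub_le (hX : IsDecisionSet X r) (hf : IsLoss X L β f) {y w : E d}
    (hy : y ∈ X) (hp : y + w ∈ X) (hm : y - w ∈ X) :
    |f (y + w) - f (y - w) - 2 * inner ℝ (gradientWithin f X y) w| ≤ β * ‖w‖ ^ 2 := by
  have h1 := inner_gradient_le hX hf hy hp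
  have h2 := inner_gradient_le hX hf hy hm
  have h3 := le_add_inner_add hX hf hy hp
  have h4 := le_add_inner_add hX hf hy hm
  have e : y - w - y = -w := by abel
  rw [add_sub_cancel_left] at h1 h3
  rw [e, inner_neg_right] at h2 h4
  rw [norm_neg] at h4
  rw [abs_le]
  constructor <;> linarith

lemma norm_gradient_zero_le (hX : IsDecisionSet X r) (hf : IsLoss X L β f) (hL : 0 ≤ L) :
    ‖gradientWithin f X 0‖ ≤ L := by
  set G := gradientWithin f X 0 with hG
  rcases eq_or_ne G 0 with h0 | h0
  · simpa [h0] using hL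
  have hr := hX.r_pos
  have hn : 0 < ‖G‖ := norm_pos_iff.2 h0
  set p : E d := (r / ‖G‖) • G with hp
  have hpn : ‖p‖ = r := by
    rw [hp, norm_smul, norm_div, norm_norm, Real.norm_of_nonneg hr.le, div_mul_cancel₀ _ hn.ne']
  have hpX : p ∈ X := hX.ball_subset (by simp [hpn])
  have h1 := inner_gradient_le hX hf hX.zero_mem hpX
  have h2 := (le_abs_self _).trans (hf.lipschitz p hpX 0 hX.zero_mem)
  rw [sub_zero] at h1 h2
  rw [← hG, hp, inner_smul_right, real_inner_self_eq_norm_sq, ← hp] at h1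
  rw [hpn] at h2
  have h3 : r / ‖G‖ * ‖G‖ ^ 2 = r * ‖G‖ := by field_simp
  rw [h3] at h1
  have : r * ‖G‖ ≤ r * L := by linarith
  exact le_of_mul_le_mul_left this hr

/-- A crude bound obtained from the gradient at the origin; only its finiteness matters, for
integrability. -/
lemma norm_gradient_le (hX : IsDecisionSet X r) (hf : IsLoss X L β f) (hL : 0 ≤ L) (hβ : 0 ≤ β)
    {x : E d} (hx : x ∈ X) : ‖gradientWithin f X x‖ ≤ L + β * Metric.diam X := by
  have h1 := norm_gradient_zero_le hX hf hL
  have h2 := hf.smooth x hx 0 hX.zero_mem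
  have h3 := mul_le_mul_of_nonneg_left (hX.norm_sub_le hx hX.zero_mem) hβ
  have h4 := norm_le_norm_add_norm_sub (gradientWithin f X x) (gradientWithin f X 0)
  have h5 := norm_le_norm_add_norm_sub' (gradientWithin f X x) (gradientWithin f X 0)
  linarith

lemma tendsto_difference_quotient (hf : IsLoss X L β f) {x : E d}
    (hx : X ∈ nhds x) (e : E d) :
    Filter.Tendsto (fun n : ℕ => ((n : ℝ) + 1) * (f (x + ((n : ℝ) + 1)⁻¹ • e) - f x)) Filter.atTop
      (nhds (inner ℝ (gradientWithin f X x) e)) := by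
  have h1 : HasFDerivAt f (InnerProductSpace.toDual ℝ (E d) (gradientWithin f X x)) x :=
    (hf.differentiableOn x (mem_of_mem_nhds hx)).hasGradientWithinAt.hasFDerivWithinAt.hasFDerivAt
      hx
  exact (h1.lim_real e).comp
    (Filter.tendsto_atTop_add_const_right _ 1 tendsto_natCast_atTop_atTop)

end IsLoss

end TPVR

namespace TPVR

/-! ### Invariance and isotropy of the uniform distribution on the sphere. -/

section Sphere

variable {d : ℕ}

lemma isProbabilityMeasure_uniformSphere (hd : 1 ≤ d) : IsProbabilityMeasure (uniformSphere d) := by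
  have : Nonempty (Fin d) := ⟨⟨0, hd⟩⟩
  have : Nontrivial (E d) := inferInstance
  constructor
  rw [uniformSphere, Measure.smul_apply, smul_eq_mul]
  refine ENNReal.inv_mul_cancel ?_ (measure_ne_top _ _)
  rw [Ne, Measure.measure_univ_eq_zero]
  exact Measure.toSphere_ne_zero _

/-- The action of a linear isometry on the unit sphere. -/
noncomputable def sphereMap (φ : E d ≃ₗᵢ[ℝ] E d) (v : Metric.sphere (0 : E d) 1) :
    Metric.sphere (0 : E d) 1 :=
  ⟨φ v, by simp⟩

lemma measurable_sphereMap (φ : E d ≃ₗᵢ[ℝ] E d) : Measurable (sphereMap φ) :=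
  (φ.continuous.measurable.comp measurable_subtype_coe).subtype_mk

/-- The surface measure of a set is a multiple of the volume of the cone over it, and isometries
carry cones to cones and preserve volume. -/
lemma map_sphereMap_uniformSphere (φ : E d ≃ₗᵢ[ℝ] E d) :
    (uniformSphere d).map (sphereMap φ) = uniformSphere d := by
  rw [uniformSphere, Measure.map_smul]
  congr 1
  ext s hs
  rw [Measure.map_apply (measurable_sphereMap φ) hs,
    Measure.toSphere_apply' _ (measurable_sphereMap φ hs), Measure.toSphere_apply' _ hs]
  congr 1
  have : Set.Ioo (0 : ℝ) 1 • (Subtype.val '' (sphereMap φ ⁻¹' s) : Set (E d))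
      = φ ⁻¹' (Set.Ioo (0 : ℝ) 1 • (Subtype.val '' s)) := by
    ext x
    simp only [Set.mem_smul, Set.mem_preimage, Set.mem_image]
    constructor
    · rintro ⟨c, hc, _, ⟨w, hw, rfl⟩, rfl⟩
      exact ⟨c, hc, _, ⟨_, hw, rfl⟩, by simp [sphereMap]⟩
    · rintro ⟨c, hc, _, ⟨w, hw, rfl⟩, h⟩
      refine ⟨c, hc, _, ⟨sphereMap φ.symm w, ?_, rfl⟩, ?_⟩
      · have : sphereMap φ (sphereMap φ.symm w) = w := by
          ext1
          simp [sphereMap]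
        change sphereMap φ (sphereMap φ.symm w) ∈ s
        rwa [this]
      · apply φ.injective
        rw [← h]
        simp [sphereMap]
  rw [this]
  exact φ.measurePreserving.measure_preimage_equiv (f := φ.toHomeomorph.toMeasurableEquiv) _

lemma integral_comp_sphereMap (φ : E d ≃ₗᵢ[ℝ] E d) {F : Metric.sphere (0 : E d) 1 → ℝ}
    (hF : Measurable F) :
    ∫ v, F (sphereMap φ v) ∂(uniformSphere d) = ∫ v, F v ∂(uniformSphere d) := by
  conv_rhs => rw [← map_sphereMap_uniformSphere φ]
  rw [integral_map (measurable_sphereMap φ).aemeasurable hF.aestronglyMeasurable]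

lemma measurable_inner_sphere (a : E d) :
    Measurable fun v : Metric.sphere (0 : E d) 1 => inner ℝ a (v : E d) := by fun_prop

lemma abs_inner_sphere_le (a : E d) (v : Metric.sphere (0 : E d) 1) :
    |inner ℝ a (v : E d)| ≤ ‖a‖ := by
  simpa using abs_real_inner_le_norm a (v : E d)

lemma integral_inner_sphere (a : E d) : ∫ v, inner ℝ a (v : E d) ∂(uniformSphere d) = 0 := by
  have h := integral_comp_sphereMap (LinearIsometryEquiv.neg ℝ) (measurable_inner_sphere a)
  simp only [sphereMap, LinearIsometryEquiv.coe_neg, inner_neg_right, integral_neg] at h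
  linarith

lemma integrable_inner_mul_inner_sphere (hd : 1 ≤ d) (a b : E d) :
    Integrable (fun v : Metric.sphere (0 : E d) 1 => inner ℝ a (v : E d) * inner ℝ b (v : E d))
      (uniformSphere d) := by
  have := isProbabilityMeasure_uniformSphere hd
  refine Integrable.of_bound (C := ‖a‖ * ‖b‖) (by fun_prop) (Filter.Eventually.of_forall fun v => ?_)
  rw [norm_mul]
  exact mul_le_mul (abs_inner_sphere_le a v) (abs_inner_sphere_le b v) (abs_nonneg _)
    (norm_nonneg _)

/-- The reflection in the hyperplane orthogonal to `a - b` exchanges two vectors of equal norm. -/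
lemma integral_inner_sq_sphere_eq {a b : E d} (hab : ‖a‖ = ‖b‖) :
    ∫ v, inner ℝ a (v : E d) * inner ℝ a (v : E d) ∂(uniformSphere d) =
      ∫ v, inner ℝ b (v : E d) * inner ℝ b (v : E d) ∂(uniformSphere d) := by
  set φ := (ℝ ∙ (a - b))ᗮ.reflection with hφ
  have h := integral_comp_sphereMap φ (F := fun v => inner ℝ a (v : E d) * inner ℝ a (v : E d))
    (by fun_prop)
  rw [← h]
  have hφa : φ b = a := by
    rw [← Submodule.reflection_sub hab, hφ, Submodule.reflection_reflection]
  have : ∀ v : E d, inner ℝ a (φ v) = inner ℝ b v := fun v => by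
    rw [← hφa, LinearIsometryEquiv.inner_map_map]
  simp only [sphereMap, this]

/-- The uniform distribution on the sphere is isotropic. -/
lemma integral_inner_mul_inner_sphere (hd : 1 ≤ d) (a b : E d) :
    ∫ v, inner ℝ a (v : E d) * inner ℝ b (v : E d) ∂(uniformSphere d) = inner ℝ a b / d := by
  have := isProbabilityMeasure_uniformSphere hd
  have hd0 : (d : ℝ) ≠ 0 := by positivity
  have hint := integrable_inner_mul_inner_sphere hd
  have key : ∀ a : E d, ∫ v, inner ℝ a (v : E d) * inner ℝ a (v : E d) ∂(uniformSphere d)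
      = ‖a‖ ^ 2 / d := by
    intro a
    -- By invariance `a` may be replaced by `‖a‖` times any basis vector; averaging over the basis
    -- uses that the squared coordinates of `v` sum to one.
    have h1 : ∀ i : Fin d, ∫ v, inner ℝ a (v : E d) * inner ℝ a (v : E d) ∂(uniformSphere d)
        = ∫ v : Metric.sphere (0 : E d) 1, ‖a‖ ^ 2 * ((v : E d) i) ^ 2 ∂(uniformSphere d) := by
      intro i
      rw [integral_inner_sq_sphere_eq (a := a) (b := EuclideanSpace.single i ‖a‖) (by simp)]
      refine integral_congr_ae (Filter.Eventually.of_forall fun v => ?_)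
      simp only [EuclideanSpace.inner_single_left, conj_trivial]
      ring
    have h2 : ∑ _i : Fin d, ∫ v, inner ℝ a (v : E d) * inner ℝ a (v : E d) ∂(uniformSphere d)
        = ‖a‖ ^ 2 := by
      rw [Finset.sum_congr rfl fun i _ => h1 i, ← integral_finsetSum]
      · have : ∀ v : Metric.sphere (0 : E d) 1, ∑ i, ‖a‖ ^ 2 * ((v : E d) i) ^ 2 = ‖a‖ ^ 2 := by
          intro v
          rw [← Finset.mul_sum, ← EuclideanSpace.real_norm_sq_eq]
          simp
        simp [this]
      · intro i _
        refine Integrable.of_bound (C := ‖a‖ ^ 2) (by fun_prop)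
          (Filter.Eventually.of_forall fun v => ?_)
        rw [norm_mul, norm_pow, norm_norm, norm_pow]
        have : ‖(v : E d) i‖ ≤ 1 := by simpa using PiLp.norm_apply_le (v : E d) i
        exact mul_le_of_le_one_right (by positivity) (pow_le_one₀ (norm_nonneg _) this)
    rw [Finset.sum_const, Finset.card_univ, Fintype.card_fin, nsmul_eq_mul] at h2
    rw [eq_div_iff hd0, mul_comm, h2]
  -- Polarization: the quadratic case at `a + b` yields the bilinear one.
  have h := key (a + b)
  have e : ∀ v : Metric.sphere (0 : E d) 1,
      inner ℝ (a + b) (v : E d) * inner ℝ (a + b) (v : E d)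
      = inner ℝ a (v : E d) * inner ℝ a (v : E d) + inner ℝ b (v : E d) * inner ℝ b (v : E d)
        + 2 * (inner ℝ a (v : E d) * inner ℝ b (v : E d)) := by
    intro v
    rw [inner_add_left]
    ring
  have h3 : ∫ v, inner ℝ (a + b) (v : E d) * inner ℝ (a + b) (v : E d) ∂(uniformSphere d)
      = ‖a‖ ^ 2 / d + ‖b‖ ^ 2 / d +
        2 * ∫ v, inner ℝ a (v : E d) * inner ℝ b (v : E d) ∂(uniformSphere d) := by
    rw [← key a, ← key b, ← integral_const_mul, ← integral_add (hint a a) (hint b b),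
      ← integral_add ?_ ((hint a b).const_mul 2)]
    · exact integral_congr_ae (Filter.Eventually.of_forall e)
    · exact (hint a a).add (hint b b)
  rw [h3, norm_add_sq_real] at h
  field_simp at h ⊢
  linarith

end Sphere

section Independence

variable {d : ℕ} {Ω : Type*} {m mΩ : MeasurableSpace Ω} {μ : Measure Ω} [IsProbabilityMeasure μ]
  {v : Ω → Metric.sphere (0 : E d) 1}

/-- Independence makes the joint law a product, so by Fubini the direction can be averaged with the
past frozen. This plays the role of conditional expectation. -/
lemma integral_eq_integral_integral_of_indep {α : Type*} [MeasurableSpace α] (hm : m ≤ mΩ)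
    (hd : 1 ≤ d) (hv : Measurable v) (hlaw : μ.map v = uniformSphere d)
    (hind : Indep m (MeasurableSpace.comap v inferInstance) μ) {x : Ω → α} (hx : Measurable[m] x)
    {F : α × Metric.sphere (0 : E d) 1 → ℝ} (hF : Measurable F)
    (hint : Integrable (fun ω => F (x ω, v ω)) μ) :
    ∫ ω, F (x ω, v ω) ∂μ = ∫ ω, ∫ w, F (x ω, w) ∂(uniformSphere d) ∂μ := by
  have := isProbabilityMeasure_uniformSphere hd
  have hx' : Measurable x := hx.mono hm le_rfl
  have hind' : IndepFun x v μ := by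
    rw [IndepFun_iff_Indep]
    exact indep_of_indep_of_le_left hind hx.comap_le
  have hmap : μ.map (fun ω => (x ω, v ω)) = (μ.map x).prod (uniformSphere d) := by
    rw [← hlaw]
    exact (indepFun_iff_map_prod_eq_prod_map_map hx'.aemeasurable hv.aemeasurable).1 hind'
  have hpx : IsProbabilityMeasure (μ.map x) := Measure.isProbabilityMeasure_map hx'.aemeasurable
  have hF' : AEStronglyMeasurable F (μ.map (fun ω => (x ω, v ω))) := hF.aestronglyMeasurable
  have h1 : ∫ ω, F (x ω, v ω) ∂μ = ∫ q, F q ∂(μ.map (fun ω => (x ω, v ω))) :=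
    (integral_map (hx'.prodMk hv).aemeasurable hF').symm
  have h2 : Integrable F ((μ.map x).prod (uniformSphere d)) := by
    rw [← hmap]
    exact (integrable_map_measure hF' (hx'.prodMk hv).aemeasurable).2 hint
  rw [h1, hmap, integral_prod _ h2, integral_map hx'.aemeasurable]
  exact (hF.stronglyMeasurable.integral_prod_right').aestronglyMeasurable

end Independence

end TPVR

/-! ### Parameters of the algorithm: radius, step-size grid, prior. -/

namespace TPVR

namespace Config

variable {d : ℕ} {A : Config d}

/-- The standing assumptions on the inputs of the algorithm. -/
structure Valid (A : Config d) : Prop where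
  one_le_dim : 1 ≤ d
  isDecisionSet : IsDecisionSet A.X A.r
  L_nonneg : 0 ≤ A.L
  β_pos : 0 < A.β

namespace Valid

lemma one_le_cast (hA : A.Valid) : (1 : ℝ) ≤ d := by exact_mod_cast hA.one_le_dim

lemma r_pos (hA : A.Valid) : 0 < A.r := hA.isDecisionSet.r_pos

lemma D_pos (hA : A.Valid) : 0 < A.D := hA.isDecisionSet.diam_pos hA.one_le_dim

lemma two_mul_r_le (hA : A.Valid) : 2 * A.r ≤ A.D := hA.isDecisionSet.two_mul_r_le hA.one_le_dim

end Valid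

lemma one_le_Smin : 1 ≤ A.Smin := le_max_left _ _

lemma sq_L_le_Smin : A.L ^ 2 ≤ A.Smin := le_max_right _ _

lemma δ_nonneg (hA : A.Valid) (H : ℕ) (S : ℝ) : 0 ≤ A.δ H S := by
  have := hA.β_pos
  have := hA.r_pos
  rw [δ]
  refine le_min (le_min ?_ ?_) ?_ <;> positivity

lemma δ_pos (hA : A.Valid) {H : ℕ} {S : ℝ} (hH : 1 ≤ H) (hS : 0 < S) : 0 < A.δ H S := by
  have := hA.β_pos
  have := hA.r_pos
  have h1 : (0 : ℝ) < d := by linarith [hA.one_le_cast]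
  have h2 : (0 : ℝ) < H := by exact_mod_cast hH
  rw [δ]
  refine lt_min (lt_min ?_ ?_) ?_ <;> positivity

lemma δ_le_half_r (H : ℕ) (S : ℝ) : A.δ H S ≤ A.r / 2 := min_le_right _ _

/-- Each term of the minimum in `δ` has its own task: the first keeps the total bias of an epoch of
`H` rounds of order `√S`, the second keeps `β²δ²` below `1/H`, and the third keeps `α` below one
half. -/
lemma δ_mul_le (hA : A.Valid) {H : ℕ} {S : ℝ} (hH : 1 ≤ H) :
    d * A.β * H * A.δ H S ≤ √S := by
  have h0 := hA.β_pos
  have h1 : (0 : ℝ) < d := by linarith [hA.one_le_cast]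
  have h2 : (0 : ℝ) < H := by exact_mod_cast hH
  have h : A.δ H S ≤ √S / (d * A.β * H) := (min_le_left _ _).trans (min_le_left _ _)
  rw [le_div_iff₀ (by positivity)] at h
  linarith

lemma sq_β_mul_sq_δ_le (hA : A.Valid) {H : ℕ} {S : ℝ} (hH : 1 ≤ H) :
    A.β ^ 2 * A.δ H S ^ 2 ≤ 1 / H := by
  have h0 := hA.β_pos
  have h2 : (0 : ℝ) < H := by exact_mod_cast hH
  have h : A.δ H S ≤ 1 / (A.β * √H) := (min_le_left _ _).trans (min_le_right _ _)
  calc A.β ^ 2 * A.δ H S ^ 2 ≤ A.β ^ 2 * (1 / (A.β * √H)) ^ 2 := by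
        gcongr
        exact δ_nonneg hA H S
    _ = 1 / (H : ℝ) := by
        rw [div_pow, mul_pow, Real.sq_sqrt h2.le]
        field_simp

lemma δ_div_r_nonneg (hA : A.Valid) (H : ℕ) (S : ℝ) : 0 ≤ A.δ H S / A.r :=
  div_nonneg (δ_nonneg hA H S) hA.r_pos.le

lemma δ_div_r_le (hA : A.Valid) (H : ℕ) (S : ℝ) : A.δ H S / A.r ≤ 1 / 2 := by
  rw [div_le_iff₀ hA.r_pos]
  linarith [δ_le_half_r (A := A) H S]

lemma isClosed_shrunk (hA : A.Valid) (H : ℕ) (S : ℝ) : IsClosed (A.shrunk H S) :=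
  hA.isDecisionSet.isClosed.smul₀ _

lemma convex_shrunk (hA : A.Valid) (H : ℕ) (S : ℝ) : Convex ℝ (A.shrunk H S) :=
  hA.isDecisionSet.convex.smul _

lemma nonempty_shrunk (hA : A.Valid) (H : ℕ) (S : ℝ) : (A.shrunk H S).Nonempty :=
  hA.isDecisionSet.nonempty.smul_set

lemma shrunk_subset (hA : A.Valid) (H : ℕ) (S : ℝ) : A.shrunk H S ⊆ A.X :=
  hA.isDecisionSet.smul_subset (by linarith [δ_div_r_le hA H S])
    (by linarith [δ_div_r_nonneg hA H S])

lemma proj_shrunk_mem (hA : A.Valid) (H : ℕ) (S : ℝ) (x : E d) :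
    proj (A.shrunk H S) x ∈ A.shrunk H S :=
  proj_mem (isClosed_shrunk hA H S) (nonempty_shrunk hA H S) x

lemma norm_sub_le_of_mem_shrunk (hA : A.Valid) {H : ℕ} {S : ℝ} {x y : E d}
    (hx : x ∈ A.shrunk H S) (hy : y ∈ A.shrunk H S) : ‖x - y‖ ≤ A.D :=
  hA.isDecisionSet.norm_sub_le (shrunk_subset hA H S hx) (shrunk_subset hA H S hy)

lemma add_smul_mem (hA : A.Valid) {H : ℕ} {S : ℝ} {y v : E d} (hy : y ∈ A.shrunk H S)
    (hv : ‖v‖ = 1) : y + A.δ H S • v ∈ A.X := by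
  refine hA.isDecisionSet.add_mem_of_mem_smul (δ_div_r_nonneg hA H S)
    ((δ_div_r_le hA H S).trans (by norm_num)) hy ?_
  rw [norm_smul, hv, mul_one, Real.norm_of_nonneg (δ_nonneg hA H S),
    div_mul_cancel₀ _ hA.r_pos.ne']

section Parameters

variable {H : ℕ} {S : ℝ}

lemma Vmax_pos (hA : A.Valid) (hS : 0 < S) : 0 < A.Vmax S := by
  have := hA.one_le_cast
  rw [Vmax]
  positivity

lemma η₀_eq (hA : A.Valid) (S : ℝ) : A.η₀ S = A.D / √(2 * A.Vmax S) := by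
  rw [η₀, Real.sqrt_div (sq_nonneg _), Real.sqrt_sq hA.D_pos.le]

lemma η₀_pos (hA : A.Valid) (hS : 0 < S) : 0 < A.η₀ S := by
  have := Vmax_pos hA hS
  have := hA.D_pos
  rw [η₀_eq hA]
  positivity

lemma η_pos (hA : A.Valid) (hS : 0 < S) (i : ℕ) : 0 < A.η S i :=
  mul_pos (η₀_pos hA hS) (by positivity)

/-- The diameter cancels, so the number of experts depends only on `H` and `dS`. -/
lemma D_mul_div_η₀ (hA : A.Valid) (S : ℝ) : A.D * H / A.η₀ S = 4 * H * √(d * S) := by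
  have h1 : √(2 * A.Vmax S) = 4 * √(d * S) := by
    rw [Vmax, show 2 * (8 * (d : ℝ) * S) = 4 ^ 2 * (d * S) by ring,
      Real.sqrt_mul (by norm_num), Real.sqrt_sq (by norm_num)]
  rw [η₀_eq hA, h1]
  have := hA.D_pos
  rw [div_div_eq_mul_div, div_eq_iff this.ne']
  ring

lemma one_le_sqrt_mul (hA : A.Valid) (hS : 1 ≤ S) : 1 ≤ √(d * S) := by
  rw [Real.one_le_sqrt]
  nlinarith [hA.one_le_cast]

lemma le_two_pow_numExperts (hA : A.Valid) (hH : 1 ≤ H) (hS : 1 ≤ S) :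
    4 * (H : ℝ) ≤ 2 ^ (A.numExperts H S - 1) := by
  have h1 := one_le_sqrt_mul hA hS
  have h2 : (1 : ℝ) ≤ H := by exact_mod_cast hH
  rw [numExperts, D_mul_div_η₀ hA, Nat.add_sub_cancel]
  have h3 : 0 < 4 * (H : ℝ) * √(d * S) := by positivity
  calc 4 * (H : ℝ) ≤ 4 * H * √(d * S) := by nlinarith
    _ = (2 : ℝ) ^ Real.logb 2 (4 * H * √(d * S)) :=
        (Real.rpow_logb (by norm_num) (by norm_num) h3).symm
    _ ≤ (2 : ℝ) ^ ((⌈Real.logb 2 (4 * H * √(d * S))⌉₊ : ℕ) : ℝ) :=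
        Real.rpow_le_rpow_of_exponent_le (by norm_num) (Nat.le_ceil _)
    _ = _ := Real.rpow_natCast _ _

lemma three_le_numExperts (hA : A.Valid) (hH : 1 ≤ H) (hS : 1 ≤ S) :
    3 ≤ A.numExperts H S := by
  by_contra! h
  have h1 := le_two_pow_numExperts hA hH hS
  have h2 : (1 : ℝ) ≤ H := by exact_mod_cast hH
  have h3 : (2 : ℝ) ^ (A.numExperts H S - 1) ≤ 2 ^ 1 :=
    pow_le_pow_right₀ (by norm_num) (by omega)
  linarith

lemma log_numExperts_pos (hA : A.Valid) (hH : 1 ≤ H) (hS : 1 ≤ S) :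
    0 < Real.log (A.numExperts H S) := by
  apply Real.log_pos
  exact_mod_cast (by have := three_le_numExperts hA hH hS; omega : 1 < A.numExperts H S)

lemma ε_pos (hA : A.Valid) (hH : 1 ≤ H) (hS : 1 ≤ S) : 0 < A.ε H S := by
  have h1 := log_numExperts_pos hA hH hS
  have h2 := Vmax_pos hA (by linarith : 0 < S)
  have h3 := hA.D_pos
  rw [ε]
  positivity

/-- The step sizes of the grid cover all path lengths. -/
lemma exists_expert (hA : A.Valid) (hH : 1 ≤ H) (hS : 1 ≤ S) {P : ℝ} (hP0 : 0 ≤ P)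
    (hP : P ≤ A.D * H) : ∃ i < A.numExperts H S,
      (A.D ^ 2 + 2 * A.D * P) / (2 * A.η S i) + A.η S i * A.Vmax S / 2 ≤
        2 * √((A.D ^ 2 + 2 * A.D * P) * A.Vmax S) := by
  have hS0 : 0 < S := by linarith
  have hV := Vmax_pos hA hS0
  have hD := hA.D_pos
  have hH' : (1 : ℝ) ≤ H := by exact_mod_cast hH
  set V := A.Vmax S with hVd
  set Q := A.D ^ 2 + 2 * A.D * P with hQ
  have hQ0 : A.D ^ 2 ≤ Q := by nlinarith
  have hQpos : 0 < Q := by nlinarith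
  have hQH : Q ≤ A.D ^ 2 * (1 + 2 * H) := by nlinarith
  -- `x` is the ratio of the target step size `√Q / √(2V)` to `η₀`; the bound `P ≤ D H` keeps it
  -- within the grid.
  set x := √Q / A.D with hx
  have hx1 : 1 ≤ x := by
    rw [hx, le_div_iff₀ hD, one_mul]
    exact Real.le_sqrt_of_sq_le hQ0
  have hx2 : x ≤ 4 * H := by
    rw [hx, div_le_iff₀ hD]
    apply Real.sqrt_le_iff.2
    constructor
    · positivity
    · refine hQH.trans ?_
      have : 1 + 2 * (H : ℝ) ≤ (4 * H) ^ 2 := by nlinarith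
      nlinarith [mul_le_mul_of_nonneg_left this (sq_nonneg A.D)]
  -- The power of two just below `x` gives `η ≤ e ≤ 2η` for the target `e`. The two terms are then
  -- at most `√2` and `√2/4` times `√(QV)`, together less than `2√(QV)`.
  obtain ⟨i, hi1, hi2⟩ := exists_nat_pow_near hx1 (one_lt_two (α := ℝ))
  have hN : 2 ^ i ≤ (2 : ℝ) ^ (A.numExperts H S - 1) :=
    hi1.trans (hx2.trans (le_two_pow_numExperts hA hH hS))
  have hiN : i ≤ A.numExperts H S - 1 := (pow_le_pow_iff_right₀ (by norm_num : (1 : ℝ) < 2)).1 hN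
  have h3 := three_le_numExperts hA hH hS
  refine ⟨i, by omega, ?_⟩
  have hη := η_pos hA hS0 i
  set e := √Q / √(2 * V) with he
  have hsV : 0 < √(2 * V) := by positivity
  have hsQ : 0 < √Q := by positivity
  have hηe : A.η S i = A.D * 2 ^ i / √(2 * V) := by
    rw [η, η₀_eq hA, ← hVd]
    ring
  have hle : A.η S i ≤ e := by
    rw [hηe, he]
    gcongr
    have := (le_div_iff₀ hD).1 hi1
    linarith
  have hge : e ≤ 2 * A.η S i := by
    rw [hηe, he, mul_div_assoc']
    gcongr
    have := (div_lt_iff₀ hD).1 hi2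
    rw [pow_succ] at this
    linarith
  have he0 : 0 < e := by positivity
  have hs : √(2 * V) = √2 * √V := Real.sqrt_mul (by norm_num) _
  have h2 : √2 ≤ 3 / 2 := Real.sqrt_le_iff.2 ⟨by norm_num, by norm_num⟩
  have h2' : √2 * √2 = 2 := Real.mul_self_sqrt (by norm_num)
  have hVV : √V * √V = V := Real.mul_self_sqrt hV.le
  have hQQ : √Q * √Q = Q := Real.mul_self_sqrt hQpos.le
  have hsV' : 0 < √V := by positivity
  have hs2 : 0 < √(2 : ℝ) := by positivity
  have t1 : Q / (2 * A.η S i) ≤ √2 * (√Q * √V) := by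
    calc Q / (2 * A.η S i) ≤ Q / e := by gcongr
      _ = √2 * (√Q * √V) := by
        rw [he, hs, div_div_eq_mul_div, div_eq_iff hsQ.ne']
        nth_rewrite 1 [← hQQ]
        ring
  have t2 : A.η S i * V / 2 ≤ √2 * (√Q * √V) / 4 := by
    calc A.η S i * V / 2 ≤ e * V / 2 := by gcongr
      _ = √2 * (√Q * √V) / 4 := by
        rw [he, hs]
        nth_rewrite 2 [← hVV]
        field_simp
        linarith
  rw [Real.sqrt_mul hQpos.le]
  have h4 : 0 < √Q * √V := by positivity
  nlinarith

lemma sum_one_div_mul_succ_le (N : ℕ) :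
    ∑ j ∈ Finset.range N, 1 / (((j : ℝ) + 1) * (j + 2)) ≤ 1 := by
  have : ∑ j ∈ Finset.range N, 1 / (((j : ℝ) + 1) * (j + 2)) = 1 - 1 / ((N : ℝ) + 1) := by
    induction N with
    | zero => simp
    | succ n ih =>
      rw [Finset.sum_range_succ, ih]
      push_cast
      field_simp
      ring
  rw [this]
  have : 0 ≤ 1 / ((N : ℝ) + 1) := by positivity
  linarith

lemma prior_denom_pos (N : ℕ) (hN : 0 < N) :
    0 < ∑ j ∈ Finset.range N, 1 / (((j : ℝ) + 1) * (j + 2)) :=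
  Finset.sum_pos (fun j _ => by positivity) ⟨0, Finset.mem_range.2 hN⟩

lemma numExperts_pos (H : ℕ) (S : ℝ) : 0 < A.numExperts H S := Nat.succ_pos _

lemma prior_pos (i : ℕ) : 0 < A.prior H S i :=
  div_pos (by positivity) (prior_denom_pos _ (numExperts_pos H S))

lemma sum_prior : ∑ i ∈ Finset.range (A.numExperts H S), A.prior H S i = 1 := by
  simp only [prior]
  rw [← Finset.sum_div, div_self (prior_denom_pos _ (numExperts_pos H S)).ne']

/-- The normalising sum telescopes to at most one, and `(i + 1)(i + 2) ≤ N³`. -/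
lemma neg_log_prior_le (hA : A.Valid) (hH : 1 ≤ H) (hS : 1 ≤ S) {i : ℕ}
    (hi : i < A.numExperts H S) :
    -Real.log (A.prior H S i) ≤ 3 * Real.log (A.numExperts H S) := by
  have h3 := three_le_numExperts hA hH hS
  set N := A.numExperts H S with hN
  have hN3 : (3 : ℝ) ≤ N := by exact_mod_cast h3
  have hi' : (i : ℝ) + 1 ≤ N := by exact_mod_cast hi
  have hi0 : (0 : ℝ) ≤ i := Nat.cast_nonneg i
  have h1 : ((N : ℝ) ^ 3)⁻¹ ≤ A.prior H S i := by
    rw [prior, ← hN]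
    have hd := prior_denom_pos N (by omega)
    rw [le_div_iff₀ hd]
    calc ((N : ℝ) ^ 3)⁻¹ * ∑ j ∈ Finset.range N, 1 / (((j : ℝ) + 1) * (j + 2))
        ≤ ((N : ℝ) ^ 3)⁻¹ * 1 := by
          gcongr
          exact sum_one_div_mul_succ_le N
      _ ≤ 1 / (((i : ℝ) + 1) * (i + 2)) := by
          rw [mul_one, one_div]
          apply inv_anti₀ (by positivity)
          nlinarith [sq_nonneg (N : ℝ)]
  have h2 := Real.log_le_log (by positivity) h1
  rw [Real.log_inv, Real.log_pow] at h2
  push_cast at h2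
  linarith

end Parameters

end Config

end TPVR

/-! ### Invariants of the state and regret of a single round. -/

namespace TPVR

namespace Config

variable {d : ℕ} {A : Config d}

/-- The invariants of the state of the algorithm at the beginning of round `t`. -/
structure Inv (A : Config d) (t : ℕ) (s : State d) : Prop where
  c_lt : s.c < s.H
  time : t + 1 = s.H + s.c
  Smin_le : A.Smin ≤ s.S
  S_le : s.S ≤ A.Smin * (d * s.H)
  R_nonneg : 0 ≤ s.R
  R_le : s.R ≤ A.Vmax s.S
  R_le' : s.R ≤ s.c * (4 * d ^ 2 * A.L ^ 2)
  w_pos : ∀ i < A.numExperts s.H s.S, 0 < s.w i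
  sum_w : ∑ i ∈ Finset.range (A.numExperts s.H s.S), s.w i = 1
  y'_mem : ∀ i, s.y' i ∈ A.shrunk s.H s.S

namespace Inv

variable {t : ℕ} {s : State d}

lemma one_le_H (h : A.Inv t s) : 1 ≤ s.H := by
  have := h.c_lt
  omega

lemma one_le_S (h : A.Inv t s) : 1 ≤ s.S := one_le_Smin.trans h.Smin_le

lemma expertPoint_mem (hA : A.Valid) (m : E d) (i : ℕ) :
    A.expertPoint s m i ∈ A.shrunk s.H s.S := proj_shrunk_mem hA _ _ _

lemma prob_nonneg (h : A.Inv t s) (m : E d) {i : ℕ} (hi : i < A.numExperts s.H s.S) :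
    0 ≤ A.prob s m i := (hedge_pos h.w_pos _ hi).le

lemma sum_prob (h : A.Inv t s) (m : E d) :
    ∑ i ∈ Finset.range (A.numExperts s.H s.S), A.prob s m i = 1 :=
  sum_hedge (numExperts_pos _ _) h.w_pos _

lemma center_mem (hA : A.Valid) (h : A.Inv t s) (m : E d) :
    A.center s m ∈ A.shrunk s.H s.S :=
  (convex_shrunk hA _ _).sum_mem (fun _ hi => h.prob_nonneg m (Finset.mem_range.1 hi))
    (h.sum_prob m) fun i _ => expertPoint_mem hA m i

lemma query_mem (hA : A.Valid) (h : A.Inv t s) (m : E d) {v : E d} (hv : ‖v‖ = 1) :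
    A.query s m v ∈ A.X := add_smul_mem hA (h.center_mem hA m) hv

end Inv

lemma inv_newEpoch (hA : A.Valid) {t H c : ℕ} {S : ℝ} (hc : c < H) (ht : t + 1 = H + c)
    (hS : A.Smin ≤ S) (hS' : S ≤ A.Smin * (d * H)) (z : ℕ → E d) :
    A.Inv t (A.newEpoch H c S z) where
  c_lt := hc
  time := ht
  Smin_le := hS
  S_le := hS'
  R_nonneg := le_rfl
  R_le := (Vmax_pos hA (by linarith [one_le_Smin (A := A)] : 0 < S)).le
  R_le' := by simp only [newEpoch]; positivity
  w_pos := fun i _ => prior_pos i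
  sum_w := sum_prior
  y'_mem := fun i => proj_shrunk_mem hA _ _ _

lemma Smin_le_mul (hA : A.Valid) {H : ℕ} (hH : 1 ≤ H) : A.Smin ≤ A.Smin * (d * H) := by
  have h1 := hA.one_le_cast
  have h2 : (1 : ℝ) ≤ H := by exact_mod_cast hH
  have h3 := one_le_Smin (A := A)
  nlinarith [mul_le_mul h1 h2 zero_le_one (by linarith)]

/-- The next state, in terms of the gradient estimate. -/
noncomputable def nextState (A : Config d) (s : State d) (m g : E d) (z : ℕ → E d) : State d :=
  if s.H ≤ s.c + 1 then A.newEpoch (2 * s.H) 0 A.Smin z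
  else if A.Vmax s.S < s.R + ‖g - m‖ ^ 2 then A.newEpoch s.H (s.c + 1) (2 * s.S) z
  else
    { H := s.H
      c := s.c + 1
      S := s.S
      R := s.R + ‖g - m‖ ^ 2
      w := hedge (A.numExperts s.H s.S) (A.ε s.H s.S) s.w
        (fun i => inner ℝ g (A.expertPoint s m i))
      y' := fun i => proj (A.shrunk s.H s.S) (s.y' i - A.η s.S i • g) }

lemma inv_nextState (hA : A.Valid) {t : ℕ} {s : State d} (h : A.Inv t s) {m g : E d}
    (hg : ‖g - m‖ ^ 2 ≤ 4 * d ^ 2 * A.L ^ 2) (z : ℕ → E d) :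
    A.Inv (t + 1) (A.nextState s m g z) := by
  have hH := h.one_le_H
  have hc := h.c_lt
  have ht := h.time
  rw [nextState]
  split_ifs with h1 h2
  · exact inv_newEpoch hA (by omega) (by omega) le_rfl (Smin_le_mul hA (by omega)) z
  · refine inv_newEpoch hA (by omega) (by omega) ?_ ?_ z
    · linarith [h.Smin_le, h.one_le_S]
    -- A doubling needs a residual above `8dS`, while at most `H` rounds contribute at most `4d²L²`
    -- each. Hence `2S < dHL²`, and `L² ≤ Smin`.
    · have h3 := h.R_le'
      have h4 : ((s.c : ℝ) + 1) ≤ s.H := by exact_mod_cast hc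
      have h5 : (0 : ℝ) ≤ 4 * d ^ 2 * A.L ^ 2 := by positivity
      have h6 : 8 * d * s.S < s.H * (4 * d ^ 2 * A.L ^ 2) := by
        rw [Vmax] at h2
        nlinarith [mul_le_mul_of_nonneg_right h4 h5]
      have hd := hA.one_le_cast
      have h7 : 2 * s.S < d * s.H * A.L ^ 2 := by
        have : (4 * (d : ℝ)) * (2 * s.S) < (4 * d) * (d * s.H * A.L ^ 2) := by
          linarith [h6, show (s.H : ℝ) * (4 * d ^ 2 * A.L ^ 2) = (4 * d) * (d * s.H * A.L ^ 2) by ring]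
        exact lt_of_mul_lt_mul_left this (by positivity)
      have h8 := mul_le_mul_of_nonneg_left (sq_L_le_Smin (A := A))
        (by positivity : (0 : ℝ) ≤ d * s.H)
      linarith
  · refine
      { c_lt := by simp only; omega
        time := by simp only; omega
        Smin_le := h.Smin_le
        S_le := h.S_le
        R_nonneg := by have := h.R_nonneg; positivity
        R_le := not_lt.1 h2
        R_le' := ?_
        w_pos := fun i hi => by
          simp only at hi ⊢
          exact hedge_pos h.w_pos _ hi
        sum_w := sum_hedge (numExperts_pos _ _) h.w_pos _
        y'_mem := fun i => proj_shrunk_mem hA _ _ _ }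
    push_cast
    have h3 := h.R_le'
    linarith

/-- The regret of the meta algorithm and one expert in one round. -/
lemma round_regret_le (hA : A.Valid) {t : ℕ} {s : State d} (h : A.Inv t s) (m g : E d)
    {u : E d} (hu : u ∈ A.shrunk s.H s.S) {i : ℕ} (hi : i < A.numExperts s.H s.S) :
    inner ℝ g (A.center s m - u) ≤
      (Real.log (hedge (A.numExperts s.H s.S) (A.ε s.H s.S) s.w
        (fun i => inner ℝ g (A.expertPoint s m i)) i) - Real.log (s.w i)) / A.ε s.H s.S +
      (‖s.y' i - u‖ ^ 2 - ‖proj (A.shrunk s.H s.S) (s.y' i - A.η s.S i • g) - u‖ ^ 2) /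
        (2 * A.η s.S i) +
      min ((A.ε s.H s.S * A.D ^ 2 / 2 + A.η s.S i / 2) * ‖g - m‖ ^ 2)
        (2 * A.D * ‖g - m‖) := by
  have hε := ε_pos hA h.one_le_H h.one_le_S
  have hη := η_pos hA (by linarith [h.one_le_S] : 0 < s.S) i
  have h1 := optimistic_step (isClosed_shrunk hA s.H s.S) (convex_shrunk hA s.H s.S)
    (nonempty_shrunk hA s.H s.S) hη (fun p hp q hq => norm_sub_le_of_mem_shrunk hA hp hq)
    (s.y' i) m g hu
  have hc : ∀ a : E d, inner ℝ a (A.center s m) = ∑ j ∈ Finset.range (A.numExperts s.H s.S),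
      A.prob s m j * inner ℝ a (A.expertPoint s m j) := by
    intro a
    rw [center, inner_sum]
    exact Finset.sum_congr rfl fun j _ => by rw [inner_smul_right]
  -- The centred prediction error of expert `j` is the inner product of `g - m` with the expert's
  -- distance vector from the center, hence at most `D‖g - m‖`.
  have h2 := hedge_step hε h.w_pos h.sum_w (fun i => inner ℝ g (A.expertPoint s m i))
    (fun i => inner ℝ m (A.expertPoint s m i)) (M := A.D * ‖g - m‖) (by
      intro j _
      change |inner ℝ g (A.expertPoint s m j) - inner ℝ m (A.expertPoint s m j) -
        ∑ i ∈ Finset.range (A.numExperts s.H s.S), A.prob s m i *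
          (inner ℝ g (A.expertPoint s m i) - inner ℝ m (A.expertPoint s m i))| ≤ _
      have : inner ℝ g (A.expertPoint s m j) - inner ℝ m (A.expertPoint s m j) -
        ∑ i ∈ Finset.range (A.numExperts s.H s.S), A.prob s m i *
          (inner ℝ g (A.expertPoint s m i) - inner ℝ m (A.expertPoint s m i))
          = inner ℝ (g - m) (A.expertPoint s m j - A.center s m) := by
        simp only [← inner_sub_left]
        rw [inner_sub_right, hc]
      rw [this, mul_comm]
      exact (abs_real_inner_le_norm _ _).trans (mul_le_mul_of_nonneg_left
        (norm_sub_le_of_mem_shrunk hA (Inv.expertPoint_mem hA m j) (h.center_mem hA m))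
        (norm_nonneg _))) hi
  change ∑ j ∈ Finset.range (A.numExperts s.H s.S), A.prob s m j *
    inner ℝ g (A.expertPoint s m j) - inner ℝ g (A.expertPoint s m i) ≤ _ at h2
  rw [← hc] at h2
  change inner ℝ g (A.expertPoint s m i - u) ≤ _ at h1
  rw [inner_sub_right] at h1 ⊢
  -- Both branches survive: the quadratic one is summed against the threshold, the linear one is for
  -- the last round of an epoch.
  have h3 : min (A.ε s.H s.S * (A.D * ‖g - m‖) ^ 2 / 2) (A.D * ‖g - m‖) +
      min (A.η s.S i * ‖g - m‖ ^ 2 / 2) (A.D * ‖g - m‖) ≤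
      min ((A.ε s.H s.S * A.D ^ 2 / 2 + A.η s.S i / 2) * ‖g - m‖ ^ 2) (2 * A.D * ‖g - m‖) := by
    apply le_min
    · refine (add_le_add (min_le_left _ _) (min_le_left _ _)).trans_eq ?_
      ring
    · refine (add_le_add (min_le_right _ _) (min_le_right _ _)).trans_eq ?_
      ring
  linarith

/-- Changing the comparator changes the squared distance by at most the path length. -/
lemma sq_norm_sub_le {a u u' : E d} {D : ℝ} (h1 : ‖a - u‖ ≤ D) (h2 : ‖a - u'‖ ≤ D) :
    ‖a - u'‖ ^ 2 ≤ ‖a - u‖ ^ 2 + 2 * D * ‖u' - u‖ := by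
  have h3 : ‖a - u'‖ ≤ ‖a - u‖ + ‖u' - u‖ := by
    have := norm_sub_le (a - u) (u' - u)
    rwa [sub_sub_sub_cancel_right] at this
  have h4 := norm_nonneg (u' - u)
  have h5 := norm_nonneg (a - u)
  have h6 := norm_nonneg (a - u')
  have : (‖a - u'‖ - ‖a - u‖) * (‖a - u'‖ + ‖a - u‖) ≤ ‖u' - u‖ * (2 * D) := by
    rcases le_total ‖a - u'‖ ‖a - u‖ with h | h
    · nlinarith [mul_nonneg (sub_nonneg.2 h) (add_nonneg h6 h5), h5.trans h1]
    · exact mul_le_mul (by linarith) (by linarith) (by linarith) h4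
  nlinarith

end Config

end TPVR

/-! ### Regret of one epoch against the estimated gradients. -/

namespace TPVR

namespace Config

variable {d : ℕ} {A : Config d}

/-- A trajectory of the algorithm, in terms of predictions `m` and gradient estimates `g`. -/
structure IsRun (A : Config d) (s : ℕ → State d) (m g : ℕ → E d) (z : ℕ → ℕ → E d) : Prop where
  zero : s 0 = A.newEpoch 1 0 A.Smin (z 0)
  succ : ∀ t, s (t + 1) = A.nextState (s t) (m t) (g t) (z (t + 1))
  bound : ∀ t, ‖g t - m t‖ ^ 2 ≤ 4 * d ^ 2 * A.L ^ 2

/-- The epoch does not end after the present round. -/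
def Continues (A : Config d) (s : State d) (m g : E d) : Prop :=
  ¬ s.H ≤ s.c + 1 ∧ ¬ A.Vmax s.S < s.R + ‖g - m‖ ^ 2

/-- The comparator, moved into the shrunken decision set. -/
noncomputable def shrinkPoint (A : Config d) (s : State d) (u : E d) : E d :=
  (1 - A.δ s.H s.S / A.r) • u

lemma shrinkPoint_mem {s : State d} {u : E d} (hu : u ∈ A.X) :
    A.shrinkPoint s u ∈ A.shrunk s.H s.S := Set.smul_mem_smul_set hu

namespace IsRun

variable {s : ℕ → State d} {m g : ℕ → E d} {z : ℕ → ℕ → E d}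

lemma inv (hA : A.Valid) (h : A.IsRun s m g z) (t : ℕ) : A.Inv t (s t) := by
  induction t with
  | zero =>
    rw [h.zero]
    exact inv_newEpoch hA one_pos rfl le_rfl (Smin_le_mul hA le_rfl) _
  | succ t ih =>
    rw [h.succ]
    exact inv_nextState hA ih (h.bound t) _

lemma succ_of_continues (h : A.IsRun s m g z) {t : ℕ} (hc : A.Continues (s t) (m t) (g t)) :
    s (t + 1) =
    { H := (s t).H
      c := (s t).c + 1
      S := (s t).S
      R := (s t).R + ‖g t - m t‖ ^ 2
      w := hedge (A.numExperts (s t).H (s t).S) (A.ε (s t).H (s t).S) (s t).w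
        (fun i => inner ℝ (g t) (A.expertPoint (s t) (m t) i))
      y' := fun i => proj (A.shrunk (s t).H (s t).S) ((s t).y' i - A.η (s t).S i • g t) } := by
  rw [h.succ, nextState, if_neg hc.1, if_neg hc.2]

/-- While the epoch continues, the logarithmic weight and the squared distance to the comparator
telescope, a move of the comparator costs `D/η` times its length, and the counter `R` records the
quadratic terms. The induction also carries that `H` and `S` stay fixed and that `c` counts rounds.
-/
lemma sum_inner_le_potential (hA : A.Valid) (h : A.IsRun s m g z) {t₀ t₁ : ℕ}
    (hc : ∀ t ∈ Finset.Ico t₀ t₁, A.Continues (s t) (m t) (g t)) {u : ℕ → E d}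
    (hu : ∀ t ≤ t₁, u t ∈ A.X) {H : ℕ} {S : ℝ} (hH : (s t₀).H = H) (hS : (s t₀).S = S)
    (hR : (s t₀).R = 0)
    {i : ℕ} (hi : i < A.numExperts H S) (t : ℕ) (ht₀ : t₀ ≤ t) (ht₁ : t ≤ t₁) :
    (s t).H = H ∧ (s t).S = S ∧ (s t).c = (s t₀).c + (t - t₀) ∧
    ∑ k ∈ Finset.Ico t₀ t, inner ℝ (g k) (A.center (s k) (m k) - A.shrinkPoint (s k) (u k)) ≤
      (Real.log ((s t).w i) - Real.log ((s t₀).w i)) / A.ε H S +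
      (‖(s t₀).y' i - A.shrinkPoint (s t₀) (u t₀)‖ ^ 2 -
        ‖(s t).y' i - A.shrinkPoint (s t) (u t)‖ ^ 2) / (2 * A.η S i) +
      (A.ε H S * A.D ^ 2 / 2 + A.η S i / 2) * (s t).R +
      A.D / A.η S i * ∑ k ∈ Finset.Ico t₀ t, ‖u (k + 1) - u k‖ := by
  induction t, ht₀ using Nat.le_induction with
  | base => simp [hH, hS, hR]
  | succ t ht₀ ih =>
    obtain ⟨ih1, ih2, ih3, ih4⟩ := ih (by omega)
    have hct := hc t (Finset.mem_Ico.2 ⟨ht₀, by omega⟩)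
    have hs := h.succ_of_continues hct
    have hinv := h.inv hA t
    have hη : 0 < A.η S i := η_pos hA (by rw [← ih2]; linarith [hinv.one_le_S]) i
    have hreg := round_regret_le hA hinv (m t) (g t) (shrinkPoint_mem (hu t (by omega)))
      (i := i) (by rw [ih1, ih2]; exact hi)
    have hnew : s (t + 1) =
      { H := H
        c := (s t).c + 1
        S := S
        R := (s t).R + ‖g t - m t‖ ^ 2
        w := hedge (A.numExperts H S) (A.ε H S) (s t).w
          (fun i => inner ℝ (g t) (A.expertPoint (s t) (m t) i))
        y' := fun i => proj (A.shrunk H S) ((s t).y' i - A.η S i • g t) } := by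
      rw [hs, ih1, ih2]
    have hu' : A.shrinkPoint (s (t + 1)) (u (t + 1)) ∈ A.shrunk H S := by
      have := shrinkPoint_mem (s := s (t + 1)) (hu (t + 1) ht₁)
      rwa [hnew] at this ⊢
    have hut : A.shrinkPoint (s t) (u t) ∈ A.shrunk H S := by
      have := shrinkPoint_mem (s := s t) (hu t (by omega))
      rwa [ih1, ih2] at this
    refine ⟨by rw [hnew], by rw [hnew], by rw [hnew]; simp only; omega, ?_⟩
    rw [Finset.sum_Ico_succ_top ht₀, Finset.sum_Ico_succ_top ht₀]
    have hmin := min_le_left ((A.ε H S * A.D ^ 2 / 2 + A.η S i / 2) * ‖g t - m t‖ ^ 2)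
        (2 * A.D * ‖g t - m t‖)
    rw [ih1, ih2] at hreg
    have hw : (s (t + 1)).w i = hedge (A.numExperts H S) (A.ε H S) (s t).w
          (fun i => inner ℝ (g t) (A.expertPoint (s t) (m t) i)) i := by rw [hnew]
    have hy : (s (t + 1)).y' i = proj (A.shrunk H S) ((s t).y' i - A.η S i • g t) := by rw [hnew]
    have hRn : (s (t + 1)).R = (s t).R + ‖g t - m t‖ ^ 2 := by rw [hnew]
    have hy' : (s (t + 1)).y' i ∈ A.shrunk H S := by
      rw [hy]
      exact proj_shrunk_mem hA _ _ _
    rw [← hw, ← hy] at hreg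
    have hmove := sq_norm_sub_le (norm_sub_le_of_mem_shrunk hA hy' hut)
      (norm_sub_le_of_mem_shrunk hA hy' hu')
    have hpath : ‖A.shrinkPoint (s (t + 1)) (u (t + 1)) - A.shrinkPoint (s t) (u t)‖
        ≤ ‖u (t + 1) - u t‖ := by
      rw [shrinkPoint, shrinkPoint, ih1, ih2, hnew, ← smul_sub, norm_smul, Real.norm_of_nonneg
        (by linarith [δ_div_r_le hA H S])]
      exact mul_le_of_le_one_left (norm_nonneg _) (by linarith [δ_div_r_nonneg hA H S])
    have hmove' := mul_le_mul_of_nonneg_left hpath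
      (by linarith [hA.D_pos] : 0 ≤ 2 * A.D)
    rw [hRn]
    have e1 : ∀ p q w : ℝ, (p - q) / (2 * A.η S i) = (p - w) / (2 * A.η S i)
        + (w - q) / (2 * A.η S i) := by intros; ring
    have e2 : (‖(s (t + 1)).y' i - A.shrinkPoint (s (t + 1)) (u (t + 1))‖ ^ 2 -
        ‖(s (t + 1)).y' i - A.shrinkPoint (s t) (u t)‖ ^ 2) / (2 * A.η S i) ≤
        A.D / A.η S i * ‖u (t + 1) - u t‖ := by
      rw [div_le_iff₀ (by positivity)]
      have : A.D / A.η S i * ‖u (t + 1) - u t‖ * (2 * A.η S i)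
          = 2 * A.D * ‖u (t + 1) - u t‖ := by field_simp
      rw [this]
      linarith
    have e3 := e1 (‖(s t₀).y' i - A.shrinkPoint (s t₀) (u t₀)‖ ^ 2)
      (‖(s (t + 1)).y' i - A.shrinkPoint (s (t + 1)) (u (t + 1))‖ ^ 2)
      (‖(s t).y' i - A.shrinkPoint (s t) (u t)‖ ^ 2)
    have e4 := e1 (‖(s t).y' i - A.shrinkPoint (s t) (u t)‖ ^ 2)
      (‖(s (t + 1)).y' i - A.shrinkPoint (s (t + 1)) (u (t + 1))‖ ^ 2)
      (‖(s (t + 1)).y' i - A.shrinkPoint (s t) (u t)‖ ^ 2)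
    have e5 : ∀ p q w : ℝ, (p - q) / A.ε H S = (w - q) / A.ε H S + (p - w) / A.ε H S := by
      intros; ring
    have e6 := e5 (Real.log ((s (t + 1)).w i)) (Real.log ((s t₀).w i)) (Real.log ((s t).w i))
    have e7 : (‖(s (t + 1)).y' i - A.shrinkPoint (s t) (u t)‖ ^ 2 -
        ‖(s (t + 1)).y' i - A.shrinkPoint (s (t + 1)) (u (t + 1))‖ ^ 2) / (2 * A.η S i) =
        -((‖(s (t + 1)).y' i - A.shrinkPoint (s (t + 1)) (u (t + 1))‖ ^ 2 -
        ‖(s (t + 1)).y' i - A.shrinkPoint (s t) (u t)‖ ^ 2) / (2 * A.η S i)) := by ring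
    rw [mul_add, mul_add]
    linarith

/-- The regret of one epoch with respect to the estimated gradients. -/
lemma sum_inner_epoch_le (hA : A.Valid) (h : A.IsRun s m g z) {t₀ t₁ : ℕ} (ht : t₀ ≤ t₁)
    (hc : ∀ t ∈ Finset.Ico t₀ t₁, A.Continues (s t) (m t) (g t)) {u : ℕ → E d}
    (hu : ∀ t ≤ t₁, u t ∈ A.X) {H c : ℕ} {S : ℝ} {z' : ℕ → E d}
    (h₀ : s t₀ = A.newEpoch H c S z') :
    (∀ t ∈ Finset.Icc t₀ t₁, (s t).H = H ∧ (s t).S = S) ∧ t₁ + 1 - t₀ ≤ H ∧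
    ∑ k ∈ Finset.Ico t₀ (t₁ + 1),
        inner ℝ (g k) (A.center (s k) (m k) - A.shrinkPoint (s k) (u k)) ≤
      7 / 2 * √(Real.log (A.numExperts H S)) * (A.D * √(A.Vmax S)) +
      2 * √((A.D ^ 2 + 2 * A.D * ∑ k ∈ Finset.Ico t₀ t₁, ‖u (k + 1) - u k‖) * A.Vmax S) +
      2 * A.D * ‖g t₁ - m t₁‖ := by
  have hH₀ : (s t₀).H = H := by rw [h₀]; rfl
  have hS₀ : (s t₀).S = S := by rw [h₀]; rfl
  have hR₀ : (s t₀).R = 0 := by rw [h₀]; rfl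
  have hi₀ := h.inv hA t₀
  have hH : 1 ≤ H := hH₀ ▸ hi₀.one_le_H
  have hS : 1 ≤ S := hS₀ ▸ hi₀.one_le_S
  have hpot := fun {i : ℕ} (hi : i < A.numExperts H S) =>
    h.sum_inner_le_potential hA hc hu hH₀ hS₀ hR₀ hi
  obtain ⟨hH₁, hS₁, hc₁, -⟩ := hpot (numExperts_pos H S) t₁ ht le_rfl
  -- The round counter advances once per round and stays below `H`.
  have hlen : t₁ + 1 - t₀ ≤ H := by
    have := (h.inv hA t₁).c_lt
    omega
  refine ⟨fun t ht' => ?_, hlen, ?_⟩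
  · rw [Finset.mem_Icc] at ht'
    obtain ⟨h1, h2, -⟩ := hpot (numExperts_pos H S) t ht'.1 ht'.2
    exact ⟨h1, h2⟩
  have hD := hA.D_pos
  have hP : ∑ k ∈ Finset.Ico t₀ t₁, ‖u (k + 1) - u k‖ ≤ A.D * H := by
    calc ∑ k ∈ Finset.Ico t₀ t₁, ‖u (k + 1) - u k‖ ≤ ∑ k ∈ Finset.Ico t₀ t₁, A.D :=
          Finset.sum_le_sum fun k hk => hA.isDecisionSet.norm_sub_le
            (hu _ (by have := (Finset.mem_Ico.1 hk).2; omega))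
            (hu _ (by have := (Finset.mem_Ico.1 hk).2; omega))
      _ = ((t₁ - t₀ : ℕ) : ℝ) * A.D := by simp
      _ ≤ H * A.D := by
          gcongr
          omega
      _ = A.D * H := mul_comm _ _
  obtain ⟨i, hi, hgrid⟩ := exists_expert hA hH hS
    (Finset.sum_nonneg fun k _ => norm_nonneg _) hP
  obtain ⟨-, -, -, hsum⟩ := hpot hi t₁ ht le_rfl
  have hi₁ := h.inv hA t₁
  have hε := ε_pos hA hH hS
  have hη : 0 < A.η S i := η_pos hA (by linarith) i
  -- The last round stands apart: its residual may cross the threshold, so it is charged through the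
  -- linear branch of the minimum.
  have hlast := round_regret_le hA hi₁ (m t₁) (g t₁) (shrinkPoint_mem (hu t₁ le_rfl))
    (i := i) (by rw [hH₁, hS₁]; exact hi)
  rw [hH₁, hS₁] at hlast
  have hmin := min_le_right ((A.ε H S * A.D ^ 2 / 2 + A.η S i / 2) * ‖g t₁ - m t₁‖ ^ 2)
    (2 * A.D * ‖g t₁ - m t₁‖)
  have hwp := hi₁.w_pos
  rw [hH₁, hS₁] at hwp
  have hlog : Real.log (hedge (A.numExperts H S) (A.ε H S) (s t₁).w
      (fun i => inner ℝ (g t₁) (A.expertPoint (s t₁) (m t₁) i)) i) ≤ 0 := by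
    refine Real.log_nonpos (hedge_pos hwp _ hi).le ?_
    rw [← sum_hedge (numExperts_pos H S) hwp
      (fun i => inner ℝ (g t₁) (A.expertPoint (s t₁) (m t₁) i))]
    exact Finset.single_le_sum (fun j hj => (hedge_pos hwp _ (Finset.mem_range.1 hj)).le)
      (Finset.mem_range.2 hi)
  have hprior : -Real.log ((s t₀).w i) ≤ 3 * Real.log (A.numExperts H S) := by
    rw [h₀]
    exact neg_log_prior_le hA hH hS hi
  have hdist : ‖(s t₀).y' i - A.shrinkPoint (s t₀) (u t₀)‖ ≤ A.D :=
    norm_sub_le_of_mem_shrunk hA (hi₀.y'_mem i) (shrinkPoint_mem (hu t₀ ht))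
  have hdist2 : ‖(s t₀).y' i - A.shrinkPoint (s t₀) (u t₀)‖ ^ 2 ≤ A.D ^ 2 :=
    pow_le_pow_left₀ (norm_nonneg _) hdist 2
  have hR := hi₁.R_le
  rw [hS₁] at hR
  rw [Finset.sum_Ico_succ_top ht]
  have hV := Vmax_pos hA (by linarith : 0 < S)
  have hlogN := log_numExperts_pos hA hH hS
  set V := A.Vmax S with hVd
  set ℓ := Real.log (A.numExperts H S) with hℓ
  set P := ∑ k ∈ Finset.Ico t₀ t₁, ‖u (k + 1) - u k‖ with hPd
  have hsV : √V * √V = V := Real.mul_self_sqrt hV.le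
  have hsℓ : √ℓ * √ℓ = ℓ := Real.mul_self_sqrt hlogN.le
  have hsV0 : 0 < √V := Real.sqrt_pos.2 hV
  have hsℓ0 : 0 < √ℓ := Real.sqrt_pos.2 hlogN
  have hεd : A.ε H S = √ℓ / (A.D * √V) := rfl
  have t1 : (Real.log ((s t₁).w i) - Real.log ((s t₀).w i)) / A.ε H S +
      (Real.log (hedge (A.numExperts H S) (A.ε H S) (s t₁).w
      (fun i => inner ℝ (g t₁) (A.expertPoint (s t₁) (m t₁) i)) i) -
        Real.log ((s t₁).w i)) / A.ε H S ≤ 3 * ℓ / A.ε H S := by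
    rw [← add_div]
    apply div_le_div_of_nonneg_right _ hε.le
    linarith
  -- With the chosen `ε` the two summands are `3` and `1/2` times `√ℓ D √V`.
  have t2 : 3 * ℓ / A.ε H S + A.ε H S * A.D ^ 2 / 2 * V = 7 / 2 * √ℓ * (A.D * √V) := by
    rw [hεd]
    field_simp
    rw [pow_two √ℓ, pow_two √V, hsℓ, hsV]
    ring
  have t3 : (‖(s t₀).y' i - A.shrinkPoint (s t₀) (u t₀)‖ ^ 2 -
        ‖(s t₁).y' i - A.shrinkPoint (s t₁) (u t₁)‖ ^ 2) / (2 * A.η S i) +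
      (‖(s t₁).y' i - A.shrinkPoint (s t₁) (u t₁)‖ ^ 2 -
        ‖proj (A.shrunk H S) ((s t₁).y' i - A.η S i • g t₁) -
          A.shrinkPoint (s t₁) (u t₁)‖ ^ 2) / (2 * A.η S i) ≤ A.D ^ 2 / (2 * A.η S i) := by
    rw [← add_div]
    apply div_le_div_of_nonneg_right _ (by positivity)
    have := sq_nonneg ‖proj (A.shrunk H S) ((s t₁).y' i - A.η S i • g t₁) -
          A.shrinkPoint (s t₁) (u t₁)‖
    linarith
  have t4 : A.D ^ 2 / (2 * A.η S i) + A.D / A.η S i * P =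
      (A.D ^ 2 + 2 * A.D * P) / (2 * A.η S i) := by field_simp
  have t5 : (A.ε H S * A.D ^ 2 / 2 + A.η S i / 2) * (s t₁).R ≤
      A.ε H S * A.D ^ 2 / 2 * V + A.η S i * V / 2 := by
    calc _ ≤ (A.ε H S * A.D ^ 2 / 2 + A.η S i / 2) * V := by gcongr
      _ = _ := by ring
  linarith

end IsRun

end Config

end TPVR

/-! ### Summation over epochs and phases. -/

namespace TPVR

lemma pathLength_nonneg {d : ℕ} (u : ℕ → E d) (T : ℕ) : 0 ≤ pathLength u T :=
  Finset.sum_nonneg fun _ _ => norm_nonneg _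

namespace Config

variable {d : ℕ} {A : Config d}

/-- The error of one round from smoothing, biased estimation and shrinking the decision set. -/
noncomputable def roundError (A : Config d) (s : State d) : ℝ :=
  A.β * A.δ s.H s.S ^ 2 + d * A.β * A.δ s.H s.S * A.D / 2 + A.δ s.H s.S * A.L * A.D / A.r

lemma roundError_nonneg (hA : A.Valid) (s : State d) : 0 ≤ A.roundError s := by
  have := δ_nonneg hA s.H s.S
  have := hA.β_pos
  have := hA.D_pos
  have := hA.r_pos
  have := hA.L_nonneg
  rw [roundError]
  positivity

/-- Every error term is a multiple of `dβHδ ≤ √S`; for the quadratic term one factor `δ` is first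
bounded by `r/2 ≤ D/4`. -/
lemma H_mul_roundError_le (hA : A.Valid) {s : State d} (hH : 1 ≤ s.H) :
    s.H * A.roundError s ≤ (A.D + A.L * A.D / A.r / (d * A.β)) * √s.S := by
  have h0 := δ_nonneg hA s.H s.S
  have hβ := hA.β_pos
  have hD := hA.D_pos
  have hr := hA.r_pos
  have hL := hA.L_nonneg
  have hd := hA.one_le_cast
  have h1 := δ_mul_le hA (S := s.S) hH
  have h2 := δ_le_half_r (A := A) s.H s.S
  have h3 := hA.two_mul_r_le
  have hs := Real.sqrt_nonneg s.S
  set δ := A.δ s.H s.S with hδ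
  have h4 : s.H * (A.β * δ ^ 2) ≤ √s.S * (A.D / 4) := by
    calc s.H * (A.β * δ ^ 2) ≤ d * A.β * s.H * δ * δ := by
          have : 0 ≤ A.β * s.H * δ * δ := by positivity
          nlinarith
      _ ≤ √s.S * (A.D / 4) := mul_le_mul h1 (by linarith) h0 hs
  have h5 : s.H * (d * A.β * δ * A.D / 2) ≤ √s.S * (A.D / 2) := by
    calc _ = d * A.β * s.H * δ * (A.D / 2) := by ring
      _ ≤ _ := mul_le_mul_of_nonneg_right h1 (by positivity)
  have h6 : s.H * (δ * A.L * A.D / A.r) ≤ √s.S * (A.L * A.D / A.r / (d * A.β)) := by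
    calc _ = d * A.β * s.H * δ * (A.L * A.D / A.r / (d * A.β)) := by field_simp
      _ ≤ _ := mul_le_mul_of_nonneg_right h1 (by positivity)
  rw [roundError, mul_add, mul_add]
  have h7 : 0 ≤ √s.S * A.D := by positivity
  linarith

namespace IsRun

variable {s : ℕ → State d} {m g : ℕ → E d} {z : ℕ → ℕ → E d}

/-- A doubled budget `2S` was preceded by a residual above `8dS`, that is by more than `4d` times
the new budget. This replaces prior knowledge of the prediction error. -/
lemma R_le_S_le (hA : A.Valid) (h : A.IsRun s m g z) (t : ℕ) :
    (s t).R ≤ ∑ k ∈ Finset.range t, ‖g k - m k‖ ^ 2 ∧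
      (s t).S ≤ A.Smin + (∑ k ∈ Finset.range t, ‖g k - m k‖ ^ 2) / (4 * d) := by
  have hd := hA.one_le_cast
  induction t with
  | zero => simp [h.zero, newEpoch]
  | succ t ih =>
    obtain ⟨ih1, ih2⟩ := ih
    have hq : 0 ≤ ‖g t - m t‖ ^ 2 := by positivity
    have hsum : 0 ≤ ∑ k ∈ Finset.range t, ‖g k - m k‖ ^ 2 :=
      Finset.sum_nonneg fun _ _ => by positivity
    rw [h.succ, nextState, Finset.sum_range_succ]
    generalize ∑ k ∈ Finset.range t, ‖g k - m k‖ ^ 2 = a at ih1 ih2 hsum ⊢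
    generalize ‖g t - m t‖ ^ 2 = q at hq ⊢
    have hdiv : a / (4 * d) ≤ (a + q) / (4 * d) := by
      gcongr
      linarith
    have hnn : 0 ≤ (a + q) / (4 * d) := by positivity
    have haq : 0 ≤ a + q := by positivity
    split_ifs with h1 h2
    · exact ⟨haq, le_add_of_nonneg_right hnn⟩
    · refine ⟨haq, ?_⟩
      have h3 : 2 * (s t).S ≤ (a + q) / (4 * d) := by
        rw [le_div_iff₀ (by positivity)]
        rw [Vmax] at h2
        linarith
      change 2 * (s t).S ≤ _
      linarith [one_le_Smin (A := A)]
    · exact ⟨by simp only; linarith, by simp only; linarith⟩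

/-- The bound on the contribution of one epoch. -/
noncomputable def epochBound (A : Config d) (ν P V : ℝ) : ℝ :=
  25 * ν * ((√(d * (A.D ^ 2 + A.D * P)) + A.L * A.D / A.r / (d * A.β)) * √(A.Smin + V / (4 * d)))

lemma epochBound_nonneg (hA : A.Valid) {ν P V : ℝ} (hν : 0 ≤ ν) : 0 ≤ epochBound A ν P V := by
  have := hA.β_pos
  have := hA.D_pos
  have := hA.r_pos
  have := hA.L_nonneg
  rw [epochBound]
  positivity

/-- The bound uses the residual and the path length of the whole horizon, so it is the same for all
epochs and can simply be multiplied by their number. -/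
lemma sum_epoch_le (hA : A.Valid) (h : A.IsRun s m g z) {T t₀ t₁ : ℕ} (ht : t₀ ≤ t₁)
    (hT : t₁ < T) (hc : ∀ t ∈ Finset.Ico t₀ t₁, A.Continues (s t) (m t) (g t)) {u : ℕ → E d}
    (hu : ∀ t < T, u t ∈ A.X) {H c : ℕ} {S : ℝ} {z' : ℕ → E d}
    (h₀ : s t₀ = A.newEpoch H c S z') {ν : ℝ} (hν : 1 ≤ ν)
    (hNν : √(Real.log (A.numExperts H S)) ≤ ν) :
    ∑ k ∈ Finset.Ico t₀ (t₁ + 1),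
        (inner ℝ (g k) (A.center (s k) (m k) - A.shrinkPoint (s k) (u k)) + A.roundError (s k)) ≤
      epochBound A ν (pathLength u T) (∑ k ∈ Finset.range T, ‖g k - m k‖ ^ 2) := by
  obtain ⟨hHS, hlen, hsum⟩ := h.sum_inner_epoch_le hA ht hc
    (fun t ht => hu t (by omega)) h₀
  have hH₀ : (s t₀).H = H := by rw [h₀]; rfl
  have hS₀ : (s t₀).S = S := by rw [h₀]; rfl
  have hi₀ := h.inv hA t₀
  have hH : 1 ≤ H := hH₀ ▸ hi₀.one_le_H
  have hS : 1 ≤ S := hS₀ ▸ hi₀.one_le_S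
  have hd := hA.one_le_cast
  have hD := hA.D_pos
  have hr := hA.r_pos
  have hL := hA.L_nonneg
  have hβ := hA.β_pos
  set V := ∑ k ∈ Finset.range T, ‖g k - m k‖ ^ 2 with hV
  set P := pathLength u T with hP
  have hP0 : 0 ≤ P := pathLength_nonneg u T
  have hV0 : 0 ≤ V := Finset.sum_nonneg fun _ _ => by positivity
  set W := A.Smin + V / (4 * d) with hW
  have hSW : S ≤ W := by
    have h1 := (h.R_le_S_le hA t₀).2
    rw [hS₀] at h1
    refine h1.trans ?_
    rw [hW]
    gcongr
    exact Finset.sum_le_sum_of_subset_of_nonneg (Finset.range_subset_range.2 (by omega))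
      fun _ _ _ => by positivity
  have hW0 : 0 < W := by linarith
  have herr : ∑ k ∈ Finset.Ico t₀ (t₁ + 1), A.roundError (s k) ≤
      (A.D + A.L * A.D / A.r / (d * A.β)) * √W := by
    have h1 : ∀ k ∈ Finset.Ico t₀ (t₁ + 1), A.roundError (s k) = A.roundError (s t₀) := by
      intro k hk
      have := hHS k (by rw [Finset.mem_Ico] at hk; rw [Finset.mem_Icc]; omega)
      rw [roundError, roundError, this.1, this.2, hH₀, hS₀]
    rw [Finset.sum_congr rfl h1, Finset.sum_const, Nat.card_Ico, nsmul_eq_mul]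
    have h2 := H_mul_roundError_le hA hi₀.one_le_H
    rw [hS₀, hH₀] at h2
    calc _ ≤ H * A.roundError (s t₀) := by
          have := roundError_nonneg hA (s t₀)
          gcongr
      _ ≤ _ := h2
      _ ≤ _ := by gcongr
  have hpath : ∑ k ∈ Finset.Ico t₀ t₁, ‖u (k + 1) - u k‖ ≤ P := by
    rw [hP, pathLength]
    refine Finset.sum_le_sum_of_subset_of_nonneg (fun k hk => ?_) fun _ _ _ => norm_nonneg _
    rw [Finset.mem_Ico] at hk
    rw [Finset.mem_range]
    omega
  -- The overshooting residual is itself one summand of `V`, and `V ≤ 4dW`.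
  have hlast : ‖g t₁ - m t₁‖ ≤ 2 * (√d * √W) := by
    have h1 : ‖g t₁ - m t₁‖ ^ 2 ≤ V := Finset.single_le_sum
      (f := fun k => ‖g k - m k‖ ^ 2) (fun _ _ => by positivity) (Finset.mem_range.2 hT)
    have h2 : V ≤ 2 ^ 2 * (d * W) := by
      rw [hW]
      have : 2 ^ 2 * (d * (A.Smin + V / (4 * d))) = 4 * d * A.Smin + V := by
        field_simp
        ring
      rw [this]
      have := one_le_Smin (A := A)
      have : 0 ≤ 4 * d * A.Smin := by positivity
      linarith
    calc ‖g t₁ - m t₁‖ ≤ √(2 ^ 2 * (d * W)) := Real.le_sqrt_of_sq_le (h1.trans h2)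
      _ = 2 * (√d * √W) := by
        rw [Real.sqrt_mul (by norm_num), Real.sqrt_sq (by norm_num),
          Real.sqrt_mul (by positivity)]
  have hVS : √(A.Vmax S) ≤ 3 * (√d * √W) := by
    calc √(A.Vmax S) ≤ √(3 ^ 2 * (d * W)) := by
          apply Real.sqrt_le_sqrt
          rw [Vmax]
          have := mul_le_mul_of_nonneg_left hSW (by positivity : (0 : ℝ) ≤ d)
          have : 0 < d * W := by positivity
          linarith
      _ = 3 * (√d * √W) := by
        rw [Real.sqrt_mul (by norm_num), Real.sqrt_sq (by norm_num),
          Real.sqrt_mul (by positivity)]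
  have hQ : √((A.D ^ 2 + 2 * A.D * ∑ k ∈ Finset.Ico t₀ t₁, ‖u (k + 1) - u k‖) * A.Vmax S) ≤
      3 / 2 * √(A.D ^ 2 + A.D * P) * (3 * (√d * √W)) := by
    rw [Real.sqrt_mul (by positivity)]
    refine mul_le_mul ?_ hVS (Real.sqrt_nonneg _) (by positivity)
    calc _ ≤ √((3 / 2) ^ 2 * (A.D ^ 2 + A.D * P)) := by
          apply Real.sqrt_le_sqrt
          nlinarith [mul_le_mul_of_nonneg_left hpath hD.le, mul_nonneg hD.le hP0]
      _ = _ := by rw [Real.sqrt_mul (by norm_num), Real.sqrt_sq (by norm_num)]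
  set G := √(A.D ^ 2 + A.D * P) with hG
  have hDG : A.D ≤ G := Real.le_sqrt_of_sq_le (by nlinarith [mul_nonneg hD.le hP0])
  have hG0 : 0 ≤ G := Real.sqrt_nonneg _
  have hGd : √(d * (A.D ^ 2 + A.D * P)) = √d * G := Real.sqrt_mul (by positivity) _
  have hsd : 1 ≤ √(d : ℝ) := Real.one_le_sqrt.2 hd
  rw [Finset.sum_add_distrib, epochBound, hGd]
  set w := √W with hw
  have hw0 : 0 ≤ w := Real.sqrt_nonneg _
  set K := A.L * A.D / A.r / (d * A.β) with hK
  have hK0 : 0 ≤ K := by positivity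
  set x := √(d : ℝ) * G * w with hx
  have hx0 : 0 ≤ x := by positivity
  have b1 : A.D * √(A.Vmax S) ≤ 3 * x := by
    calc _ ≤ G * (3 * (√d * w)) := mul_le_mul hDG hVS (Real.sqrt_nonneg _) hG0
      _ = 3 * x := by rw [hx]; ring
  have b2 : 7 / 2 * √(Real.log (A.numExperts H S)) * (A.D * √(A.Vmax S)) ≤
      7 / 2 * ν * (3 * x) := by gcongr
  have b3 : A.D * ‖g t₁ - m t₁‖ ≤ 2 * x := by
    calc _ ≤ G * (2 * (√d * w)) := mul_le_mul hDG hlast (norm_nonneg _) hG0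
      _ = 2 * x := by rw [hx]; ring
  have b4 : A.D * w ≤ x := by
    calc A.D * w ≤ G * w := by gcongr
      _ = 1 * G * w := by ring
      _ ≤ x := by rw [hx]; gcongr
  have b5 : 3 / 2 * G * (3 * (√d * w)) = 9 / 2 * x := by rw [hx]; ring
  rw [b5] at hQ
  have b6 : x ≤ ν * x := le_mul_of_one_le_left hx0 hν
  have b7 : K * w ≤ ν * (K * w) := le_mul_of_one_le_left (by positivity) hν
  -- The coefficients of `x` add up to `21/2 + 9 + 4 + 1`, which is below `25`.
  have b8 : 25 * ν * ((√d * G + K) * w) = 25 * (ν * x) + 25 * (ν * (K * w)) := by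
    rw [hx]; ring
  rw [b8]
  have b9 : 0 ≤ K * w := by positivity
  rw [add_mul] at herr
  linarith

/-- Here `t₀` starts the current epoch, `n` counts the finished epochs, `i` the doublings of `H`,
and `j` the doublings of `S` in the current phase. Since `S ≤ Smin·dH` and `H ≤ T`, `j` is at most
`log₂(dT)`, so a finished phase had at most `log₂(dT) + 1` epochs. -/
lemma exists_epoch_start (hA : A.Valid) (h : A.IsRun s m g z) {T : ℕ} {u : ℕ → E d}
    (hu : ∀ t < T, u t ∈ A.X) {ν : ℝ} (hν : 1 ≤ ν)
    (hNν : ∀ t < T, √(Real.log (A.numExperts (s t).H (s t).S)) ≤ ν) (t : ℕ) (ht : t < T) :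
    ∃ t₀ n i j : ℕ, t₀ ≤ t ∧ (∃ H c S z', s t₀ = A.newEpoch H c S z') ∧
      (∀ k ∈ Finset.Ico t₀ t, A.Continues (s k) (m k) (g k)) ∧
      (s t).H = 2 ^ i ∧ (s t).S = A.Smin * 2 ^ j ∧ n ≤ i * (Nat.log 2 (d * T) + 1) + j ∧
      ∑ k ∈ Finset.range t₀,
        (inner ℝ (g k) (A.center (s k) (m k) - A.shrinkPoint (s k) (u k)) + A.roundError (s k)) ≤
      n * epochBound A ν (pathLength u T) (∑ k ∈ Finset.range T, ‖g k - m k‖ ^ 2) := by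
  induction t with
  | zero =>
    refine ⟨0, 0, 0, 0, le_rfl, ⟨_, _, _, _, h.zero⟩, by simp, ?_, ?_, by simp, by simp⟩
    · rw [h.zero]; rfl
    · rw [h.zero]; simp [newEpoch]
  | succ t ih =>
    obtain ⟨t₀, n, i, j, h1, ⟨H, c, S, z', h₀⟩, h3, h4, h5, h6, h7⟩ := ih (by omega)
    set B := epochBound A ν (pathLength u T) (∑ k ∈ Finset.range T, ‖g k - m k‖ ^ 2) with hB
    have hnext : ∑ k ∈ Finset.range (t + 1),
        (inner ℝ (g k) (A.center (s k) (m k) - A.shrinkPoint (s k) (u k)) + A.roundError (s k)) ≤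
        ((n + 1 : ℕ) : ℝ) * B := by
      have h8 := h.sum_epoch_le hA h1 (by omega : t < T) h3 hu h₀ hν (by
        have := hNν t₀ (by omega)
        rwa [h₀] at this)
      rw [← Finset.sum_range_add_sum_Ico _ (by omega : t₀ ≤ t + 1)]
      push_cast
      linarith
    have hinv := h.inv hA t
    have hj : j ≤ Nat.log 2 (d * T) := by
      have hs := hinv.S_le
      rw [h5] at hs
      have h8 := le_of_mul_le_mul_left hs (by linarith [one_le_Smin (A := A)])
      have h9 : 2 ^ j ≤ d * (s t).H := by exact_mod_cast h8
      have h10 : (s t).H ≤ T := by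
        have := hinv.time
        omega
      exact Nat.le_log_of_pow_le (by norm_num) (h9.trans (Nat.mul_le_mul_left d h10))
    by_cases hc1 : (s t).H ≤ (s t).c + 1
    · have hs : s (t + 1) = A.newEpoch (2 * (s t).H) 0 A.Smin (z (t + 1)) := by
        rw [h.succ, nextState, if_pos hc1]
      refine ⟨t + 1, n + 1, i + 1, 0, le_rfl, ⟨_, _, _, _, hs⟩, by simp, ?_, ?_, ?_, hnext⟩
      · rw [hs]
        simp only [newEpoch]
        rw [h4, pow_succ, mul_comm]
      · rw [hs]
        simp [newEpoch]
      · rw [add_mul]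
        omega
    · by_cases hc2 : A.Vmax (s t).S < (s t).R + ‖g t - m t‖ ^ 2
      · have hs : s (t + 1) = A.newEpoch (s t).H ((s t).c + 1) (2 * (s t).S) (z (t + 1)) := by
          rw [h.succ, nextState, if_neg hc1, if_pos hc2]
        refine ⟨t + 1, n + 1, i, j + 1, le_rfl, ⟨_, _, _, _, hs⟩, by simp, ?_, ?_, by omega,
          hnext⟩
        · rw [hs]
          exact h4
        · rw [hs]
          simp only [newEpoch]
          rw [h5, pow_succ]
          ring
      · have hs := h.succ_of_continues ⟨hc1, hc2⟩
        refine ⟨t₀, n, i, j, by omega, ⟨H, c, S, z', h₀⟩, fun k hk => ?_, ?_, ?_, h6, h7⟩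
        · rw [Finset.mem_Ico] at hk
          rcases Nat.lt_succ_iff_lt_or_eq.1 hk.2 with hk' | rfl
          · exact h3 k (Finset.mem_Ico.2 ⟨hk.1, hk'⟩)
          · exact ⟨hc1, hc2⟩
        · rw [hs]
          exact h4
        · rw [hs]
          exact h5

/-- The regret with respect to the estimated gradients, along every trajectory. -/
lemma sum_inner_add_roundError_le (hA : A.Valid) (h : A.IsRun s m g z) {T : ℕ} (hT : 1 ≤ T)
    {u : ℕ → E d} (hu : ∀ t < T, u t ∈ A.X) {ν : ℝ} (hν : 1 ≤ ν)
    (hNν : ∀ t < T, √(Real.log (A.numExperts (s t).H (s t).S)) ≤ ν) :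
    ∑ k ∈ Finset.range T,
        (inner ℝ (g k) (A.center (s k) (m k) - A.shrinkPoint (s k) (u k)) + A.roundError (s k)) ≤
      (((Nat.log 2 T + 1) * (Nat.log 2 (d * T) + 1) : ℕ) : ℝ) *
        epochBound A ν (pathLength u T) (∑ k ∈ Finset.range T, ‖g k - m k‖ ^ 2) := by
  obtain ⟨T, rfl⟩ : ∃ T', T = T' + 1 := ⟨T - 1, by omega⟩
  obtain ⟨t₀, n, i, j, h1, ⟨H, c, S, z', h₀⟩, h3, h4, h5, h6, h7⟩ :=
    h.exists_epoch_start hA hu hν hNν T (by omega)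
  set B := epochBound A ν (pathLength u (T + 1))
    (∑ k ∈ Finset.range (T + 1), ‖g k - m k‖ ^ 2) with hB
  have hB0 : 0 ≤ B := epochBound_nonneg hA (by linarith)
  have h8 := h.sum_epoch_le hA h1 (by omega : T < T + 1) h3 hu h₀ hν (by
        have := hNν t₀ (by omega)
        rwa [h₀] at this)
  have hinv := h.inv hA T
  have hHT : (s T).H ≤ T + 1 := by
    have := hinv.time
    omega
  have hj : j ≤ Nat.log 2 (d * (T + 1)) := by
    have hs := hinv.S_le
    rw [h5] at hs
    have h8 := le_of_mul_le_mul_left hs (by linarith [one_le_Smin (A := A)])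
    have h9 : 2 ^ j ≤ d * (s T).H := by exact_mod_cast h8
    exact Nat.le_log_of_pow_le (by norm_num) (h9.trans (Nat.mul_le_mul_left d hHT))
  have hi : i ≤ Nat.log 2 (T + 1) := by
    rw [h4] at hHT
    exact Nat.le_log_of_pow_le (by norm_num) hHT
  have hn : n + 1 ≤ (Nat.log 2 (T + 1) + 1) * (Nat.log 2 (d * (T + 1)) + 1) := by
    have := Nat.mul_le_mul_right (Nat.log 2 (d * (T + 1)) + 1) hi
    rw [add_mul]
    omega
  calc _ ≤ ((n + 1 : ℕ) : ℝ) * B := by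
        rw [← Finset.sum_range_add_sum_Ico _ (by omega : t₀ ≤ T + 1)]
        push_cast
        linarith
    _ ≤ _ := by
        gcongr

end IsRun

end Config

end TPVR

/-! ### From losses to estimated gradients: bias, noise and residual. -/

namespace TPVR

namespace Config

variable {d : ℕ} {A : Config d}

/-- The coefficient of the direction in the gradient estimate. -/
noncomputable def coeff (A : Config d) (s : State d) (m v : E d) (f : E d → ℝ) : ℝ :=
  d / (2 * A.δ s.H s.S) *
    (f (A.query s m v) - f (A.query s m (-v)) - 2 * A.δ s.H s.S * inner ℝ m v)

/-- The gradient estimate of one round. -/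
noncomputable def gradEst (A : Config d) (s : State d) (m v : E d) (f : E d → ℝ) : E d :=
  A.estimator s m v (f (A.query s m v)) (f (A.query s m (-v)))

lemma gradEst_eq (s : State d) (m v : E d) (f : E d → ℝ) :
    A.gradEst s m v f = m + A.coeff s m v f • v := rfl

section Round

variable {t : ℕ} {s : State d} {m v : E d} {f : E d → ℝ}

/-- The gradient of the loss at the center point, minus the prediction. -/
noncomputable def gradGap (A : Config d) (s : State d) (m : E d) (f : E d → ℝ) : E d :=
  gradientWithin f A.X (A.center s m) - m

lemma sq_norm_gradEst_sub (hv : ‖v‖ = 1) :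
    ‖A.gradEst s m v f - m‖ ^ 2 = A.coeff s m v f ^ 2 := by
  rw [gradEst_eq, add_sub_cancel_left, norm_smul, hv, mul_one, Real.norm_eq_abs, sq_abs]

lemma query_eq (s : State d) (m v : E d) :
    A.query s m v = A.center s m + A.δ s.H s.S • v := rfl

lemma query_neg_eq (s : State d) (m v : E d) :
    A.query s m (-v) = A.center s m - A.δ s.H s.S • v := by
  rw [query_eq, smul_neg, ← sub_eq_add_neg]

lemma Inv.δ_pos (hA : A.Valid) (h : A.Inv t s) : 0 < A.δ s.H s.S :=
  Config.δ_pos hA h.one_le_H (by linarith [h.one_le_S])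

lemma abs_coeff_le (hA : A.Valid) (h : A.Inv t s) (hf : IsLoss A.X A.L A.β f) (hm : ‖m‖ ≤ A.L)
    (hv : ‖v‖ = 1) : |A.coeff s m v f| ≤ 2 * d * A.L := by
  have hδ := h.δ_pos hA
  have hd := hA.one_le_cast
  have h1 := hf.lipschitz _ (h.query_mem hA m hv) _ (h.query_mem hA m (by rwa [norm_neg]))
  have h2 : ‖A.query s m v - A.query s m (-v)‖ = 2 * A.δ s.H s.S := by
    have : A.query s m v - A.query s m (-v) = (2 * A.δ s.H s.S) • v := by
      rw [query_eq, query_neg_eq]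
      module
    rw [this, norm_smul, hv, mul_one, Real.norm_of_nonneg (by positivity)]
  rw [h2] at h1
  have h3 : |inner ℝ m v| ≤ A.L := by
    have := abs_real_inner_le_norm m v
    rw [hv, mul_one] at this
    exact this.trans hm
  have h4 : |f (A.query s m v) - f (A.query s m (-v)) - 2 * A.δ s.H s.S * inner ℝ m v| ≤
      4 * A.δ s.H s.S * A.L := by
    refine (abs_sub _ _).trans ?_
    rw [abs_mul, abs_of_pos (by positivity : 0 < 2 * A.δ s.H s.S)]
    nlinarith [mul_le_mul_of_nonneg_left h3 hδ.le]
  rw [coeff, abs_mul, abs_of_nonneg (by positivity : 0 ≤ (d : ℝ) / (2 * A.δ s.H s.S))]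
  calc _ ≤ (d : ℝ) / (2 * A.δ s.H s.S) * (4 * A.δ s.H s.S * A.L) := by gcongr
    _ = 2 * d * A.L := by field_simp; norm_num

lemma sq_norm_gradEst_sub_le (hA : A.Valid) (h : A.Inv t s) (hf : IsLoss A.X A.L A.β f)
    (hm : ‖m‖ ≤ A.L) (hv : ‖v‖ = 1) :
    ‖A.gradEst s m v f - m‖ ^ 2 ≤ 4 * d ^ 2 * A.L ^ 2 := by
  rw [sq_norm_gradEst_sub hv, ← sq_abs]
  calc |A.coeff s m v f| ^ 2 ≤ (2 * d * A.L) ^ 2 :=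
        pow_le_pow_left₀ (abs_nonneg _) (abs_coeff_le hA h hf hm hv) 2
    _ = _ := by ring

/-- Subtracting `2δ⟨m, v⟩` from the two-point difference leaves `∇f(y) - m` instead of `∇f(y)` in
the leading term, so the size of the estimate's deviation follows the prediction error. -/
lemma abs_coeff_sub_le (hA : A.Valid) (h : A.Inv t s) (hf : IsLoss A.X A.L A.β f)
    (hv : ‖v‖ = 1) : |A.coeff s m v f - d * inner ℝ (A.gradGap s m f) v| ≤
      d * A.β * A.δ s.H s.S / 2 := by
  have hδ := h.δ_pos hA
  have hd := hA.one_le_cast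
  have hp := h.query_mem hA m hv
  have hn := h.query_mem hA m (v := -v) (by rwa [norm_neg])
  rw [query_eq] at hp
  rw [query_neg_eq] at hn
  have h1 := IsLoss.abs_two_point_sub_le hA.isDecisionSet hf
    (shrunk_subset hA _ _ (h.center_mem hA m)) hp hn
  rw [norm_smul, hv, mul_one, Real.norm_of_nonneg hδ.le, inner_smul_right] at h1
  have e : A.coeff s m v f - d * inner ℝ (A.gradGap s m f) v =
      d / (2 * A.δ s.H s.S) * (f (A.center s m + A.δ s.H s.S • v) -
        f (A.center s m - A.δ s.H s.S • v) - 2 * (A.δ s.H s.S *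
          inner ℝ (gradientWithin f A.X (A.center s m)) v)) := by
    rw [coeff, query_eq, query_neg_eq, gradGap, inner_sub_left]
    field_simp
    ring
  rw [e, abs_mul, abs_of_nonneg (by positivity : 0 ≤ (d : ℝ) / (2 * A.δ s.H s.S))]
  calc _ ≤ (d : ℝ) / (2 * A.δ s.H s.S) * (A.β * A.δ s.H s.S ^ 2) := by gcongr
    _ = _ := by field_simp

/-- The part of the regret of one round that has mean zero given the past. -/
noncomputable def noise (A : Config d) (s : State d) (m v u : E d) (f : E d → ℝ) : ℝ :=
  inner ℝ (A.δ s.H s.S • gradientWithin f A.X (A.center s m)) v +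
    (inner ℝ (A.gradGap s m f) (A.center s m - A.shrinkPoint s u) -
      d * (inner ℝ (A.gradGap s m f) v * inner ℝ (A.center s m - A.shrinkPoint s u) v))

/-- Smoothness passes from the played point to the center, convexity from the center to the shrunken
comparator, the Lipschitz bound from there to `u`. The part along `m` is common to the gradient and
its estimate; the bias is paired with a vector of length at most `D`, and the rest is the noise. -/
lemma round_le (hA : A.Valid) (h : A.Inv t s) (hf : IsLoss A.X A.L A.β f)
    (hv : ‖v‖ = 1) {u : E d} (hu : u ∈ A.X) :
    f (A.query s m v) - f u ≤
      inner ℝ (A.gradEst s m v f) (A.center s m - A.shrinkPoint s u) + A.roundError s +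
        A.noise s m v u f := by
  have hδ := h.δ_pos hA
  have hd := hA.one_le_cast
  have hβ := hA.β_pos
  have hX := hA.isDecisionSet
  have hy := shrunk_subset hA _ _ (h.center_mem hA m)
  have hu'' := shrinkPoint_mem (s := s) hu
  have hu' := shrunk_subset hA _ _ hu''
  have h1 := IsLoss.le_add_inner_add hX hf hy (h.query_mem hA m hv)
  have h2 := IsLoss.inner_gradient_le hX hf hy hu'
  have h3 := (le_abs_self _).trans (hf.lipschitz _ hu' _ hu)
  have h4 : ‖A.shrinkPoint s u - u‖ ≤ A.δ s.H s.S / A.r * A.D := by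
    have : A.shrinkPoint s u - u = -((A.δ s.H s.S / A.r) • u) := by
      rw [shrinkPoint]
      module
    rw [this, norm_neg, norm_smul, Real.norm_of_nonneg (δ_div_r_nonneg hA _ _)]
    exact mul_le_mul_of_nonneg_left (hX.norm_le hu) (δ_div_r_nonneg hA _ _)
  have h4' := mul_le_mul_of_nonneg_left h4 hA.L_nonneg
  have h5 := abs_coeff_sub_le (m := m) hA h hf hv
  have h6 : A.query s m v - A.center s m = A.δ s.H s.S • v := by
    rw [query_eq, add_sub_cancel_left]
  rw [h6, inner_smul_right, norm_smul, hv, mul_one, Real.norm_of_nonneg hδ.le] at h1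
  set y := A.center s m with hyd
  set w := y - A.shrinkPoint s u with hw
  have h7 : ‖w‖ ≤ A.D := norm_sub_le_of_mem_shrunk hA (h.center_mem hA m) hu''
  have h8 : inner ℝ (gradientWithin f A.X y) (A.shrinkPoint s u - y) =
      -inner ℝ (gradientWithin f A.X y) w := by
    rw [← inner_neg_right, hw, neg_sub]
  have h9 : inner ℝ (gradientWithin f A.X y) w = inner ℝ m w + inner ℝ (A.gradGap s m f) w := by
    rw [gradGap, inner_sub_left, ← hyd]
    ring
  have h10 : inner ℝ (A.gradEst s m v f) w = inner ℝ m w + A.coeff s m v f * inner ℝ w v := by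
    rw [gradEst_eq, inner_add_left, inner_smul_left, real_inner_comm v w]
    rfl
  have h11 : |inner ℝ w v| ≤ A.D := by
    have := abs_real_inner_le_norm w v
    rw [hv, mul_one] at this
    exact this.trans h7
  have h12 : (d * inner ℝ (A.gradGap s m f) v - A.coeff s m v f) * inner ℝ w v ≤
      d * A.β * A.δ s.H s.S / 2 * A.D := by
    refine (le_abs_self _).trans ?_
    rw [abs_mul, abs_sub_comm]
    exact mul_le_mul h5 h11 (abs_nonneg _) (by positivity)
  rw [noise, roundError, inner_smul_left]
  simp only [conj_trivial]
  rw [← hyd, ← hw]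
  have e1 : A.L * (A.δ s.H s.S / A.r * A.D) = A.δ s.H s.S * A.L * A.D / A.r := by ring
  linarith

lemma sq_norm_gradEst_sub_le' (hA : A.Valid) (h : A.Inv t s) (hf : IsLoss A.X A.L A.β f)
    (hv : ‖v‖ = 1) : ‖A.gradEst s m v f - m‖ ^ 2 ≤
      2 * d ^ 2 * (inner ℝ (A.gradGap s m f) v * inner ℝ (A.gradGap s m f) v) +
        d ^ 2 * A.β ^ 2 * A.δ s.H s.S ^ 2 / 2 := by
  rw [sq_norm_gradEst_sub hv]
  have h1 := abs_coeff_sub_le (m := m) hA h hf hv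
  have h2 : (A.coeff s m v f - d * inner ℝ (A.gradGap s m f) v) ^ 2 ≤
      (d * A.β * A.δ s.H s.S / 2) ^ 2 := by
    rw [← sq_abs]
    exact pow_le_pow_left₀ (abs_nonneg _) h1 2
  nlinarith [sq_nonneg (A.coeff s m v f - 2 * (d * inner ℝ (A.gradGap s m f) v))]

/-- The estimate sees the gradient at the center, whereas the prediction error is measured at the
played point; smoothness bridges the distance `δ`. -/
lemma sq_norm_gradGap_le (hA : A.Valid) (h : A.Inv t s) (hf : IsLoss A.X A.L A.β f)
    (hv : ‖v‖ = 1) : ‖A.gradGap s m f‖ ^ 2 ≤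
      2 * ‖gradientWithin f A.X (A.query s m v) - m‖ ^ 2 + 2 * (A.β ^ 2 * A.δ s.H s.S ^ 2) := by
  have hδ := h.δ_pos hA
  have h1 := hf.smooth _ (shrunk_subset hA _ _ (h.center_mem hA m)) _ (h.query_mem hA m hv)
  have h2 : A.center s m - A.query s m v = -(A.δ s.H s.S • v) := by
    rw [query_eq]
    abel
  rw [h2, norm_neg, norm_smul, hv, mul_one, Real.norm_of_nonneg hδ.le] at h1
  have h3 := norm_sub_le_norm_sub_add_norm_sub (gradientWithin f A.X (A.center s m))
    (gradientWithin f A.X (A.query s m v)) m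
  rw [gradGap, ← mul_pow]
  set a := ‖gradientWithin f A.X (A.center s m) - gradientWithin f A.X (A.query s m v)‖
  set b := ‖gradientWithin f A.X (A.query s m v) - m‖
  have ha : 0 ≤ a := norm_nonneg _
  have hb : 0 ≤ b := norm_nonneg _
  calc _ ≤ (a + b) ^ 2 := pow_le_pow_left₀ (norm_nonneg _) h3 2
    _ ≤ 2 * b ^ 2 + 2 * a ^ 2 := by nlinarith [sq_nonneg (a - b)]
    _ ≤ _ := by gcongr

/-- The error terms in the residual are summable up to a logarithm. -/
lemma residual_error_le (hA : A.Valid) (h : A.Inv t s) :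
    d ^ 2 * A.β ^ 2 * A.δ s.H s.S ^ 2 / 2 + 4 * d * (A.β ^ 2 * A.δ s.H s.S ^ 2) ≤
      9 * d * A.Smin * ((t : ℝ) + 1)⁻¹ := by
  have hd := hA.one_le_cast
  have hS := one_le_Smin (A := A)
  have hH : (1 : ℝ) ≤ s.H := by exact_mod_cast h.one_le_H
  have hδ := h.δ_pos hA
  have hβ := hA.β_pos
  -- The first term of `δ` gives `d²β²δ² ≤ S/H²`, and the invariant `S ≤ Smin·dH` removes one power
  -- of `H`.
  have h1 : d ^ 2 * A.β ^ 2 * A.δ s.H s.S ^ 2 ≤ d * A.Smin * (1 / s.H) := by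
    have h2 := pow_le_pow_left₀ (by positivity) (δ_mul_le hA (S := s.S) h.one_le_H) 2
    rw [Real.sq_sqrt (by linarith [h.one_le_S])] at h2
    have h3 := h2.trans h.S_le
    have : (s.H : ℝ) ^ 2 * (d ^ 2 * A.β ^ 2 * A.δ s.H s.S ^ 2) ≤
        (s.H : ℝ) ^ 2 * (d * A.Smin * (1 / s.H)) := by
      have e : (s.H : ℝ) ^ 2 * (d * A.Smin * (1 / s.H)) = A.Smin * (d * s.H) := by field_simp
      rw [e]
      linarith
    exact le_of_mul_le_mul_left this (by positivity)
  have h2 : (d : ℝ) * (A.β ^ 2 * A.δ s.H s.S ^ 2) ≤ d * A.Smin * (1 / s.H) := by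
    calc _ ≤ (d : ℝ) * (1 / s.H) := by
          have := sq_β_mul_sq_δ_le hA (S := s.S) h.one_le_H
          gcongr
      _ ≤ d * A.Smin * (1 / s.H) := by
          have : (d : ℝ) * 1 ≤ d * A.Smin := by gcongr
          have h0 : 0 ≤ 1 / (s.H : ℝ) := by positivity
          nlinarith
  -- Earlier phases last `H - 1` rounds in total, so `t + 1 = H + c ≤ 2H`.
  have h3 : 1 / (s.H : ℝ) ≤ 2 * ((t : ℝ) + 1)⁻¹ := by
    rw [one_div, inv_eq_one_div, inv_eq_one_div, mul_one_div, div_le_div_iff₀ (by positivity)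
      (by positivity)]
    have h4 := h.time
    have h5 := h.c_lt
    have : t + 1 ≤ 2 * s.H := by omega
    have : ((t : ℝ) + 1) ≤ 2 * s.H := by exact_mod_cast this
    linarith
  have h4 : d * A.Smin * (1 / s.H) ≤ d * A.Smin * (2 * ((t : ℝ) + 1)⁻¹) := by gcongr
  linarith

end Round

section Trajectory

variable {f : ℕ → E d → ℝ} {m v : ℕ → E d} {z : ℕ → ℕ → E d}

lemma state_succ (t : ℕ) : A.state f m v z (t + 1) = A.nextState (A.state f m v z t) (m t)
    (A.gradEst (A.state f m v z t) (m t) (v t) (f t)) (z (t + 1)) := rfl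

lemma inv_state (hA : A.Valid) (hf : ∀ t, IsLoss A.X A.L A.β (f t)) (hm : ∀ t, ‖m t‖ ≤ A.L)
    (hv : ∀ t, ‖v t‖ = 1) (t : ℕ) : A.Inv t (A.state f m v z t) := by
  induction t with
  | zero => exact inv_newEpoch hA one_pos rfl le_rfl (Smin_le_mul hA le_rfl) _
  | succ t ih =>
    rw [state_succ]
    exact inv_nextState hA ih (sq_norm_gradEst_sub_le hA ih (hf t) (hm t) (hv t)) _

lemma isRun_state (hA : A.Valid) (hf : ∀ t, IsLoss A.X A.L A.β (f t)) (hm : ∀ t, ‖m t‖ ≤ A.L)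
    (hv : ∀ t, ‖v t‖ = 1) :
    A.IsRun (A.state f m v z) m
      (fun t => A.gradEst (A.state f m v z t) (m t) (v t) (f t)) z where
  zero := rfl
  succ := state_succ
  bound := fun t => sq_norm_gradEst_sub_le hA (inv_state hA hf hm hv t) (hf t) (hm t) (hv t)

/-- The observed residual of the first `T` rounds. -/
noncomputable def residual (A : Config d) (f : ℕ → E d → ℝ) (m v : ℕ → E d) (z : ℕ → ℕ → E d)
    (T : ℕ) : ℝ :=
  ∑ t ∈ Finset.range T, ‖A.gradEst (A.state f m v z t) (m t) (v t) (f t) - m t‖ ^ 2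

/-- The dynamic regret, along every trajectory. -/
lemma dynRegret_le (hA : A.Valid) (hf : ∀ t, IsLoss A.X A.L A.β (f t)) (hm : ∀ t, ‖m t‖ ≤ A.L)
    (hv : ∀ t, ‖v t‖ = 1) {T : ℕ} (hT : 1 ≤ T) {u : ℕ → E d} (hu : ∀ t < T, u t ∈ A.X) {ν : ℝ}
    (hν : 1 ≤ ν) (hNν : ∀ t < T, √(Real.log (A.numExperts (A.state f m v z t).H
      (A.state f m v z t).S)) ≤ ν) :
    A.dynRegret f m v z u T ≤
      (((Nat.log 2 T + 1) * (Nat.log 2 (d * T) + 1) : ℕ) : ℝ) *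
        IsRun.epochBound A ν (pathLength u T) (A.residual f m v z T) +
      ∑ t ∈ Finset.range T, A.noise (A.state f m v z t) (m t) (v t) (u t) (f t) := by
  have h1 := (isRun_state (z := z) hA hf hm hv).sum_inner_add_roundError_le hA hT hu hν hNν
  refine le_trans ?_ (add_le_add_left h1 _)
  rw [dynRegret, ← Finset.sum_add_distrib]
  exact Finset.sum_le_sum fun t ht => round_le hA (inv_state hA hf hm hv t) (hf t) (hv t)
    (hu t (Finset.mem_range.1 ht))

end Trajectory

end Config

end TPVR

/-! ### Measurability of losses, gradients and states. -/

namespace TPVR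

section Losses

variable {d : ℕ} {X : Set (E d)} {r L β : ℝ} {Ω : Type*} {mΩ : MeasurableSpace Ω}
  {f : Ω → E d → ℝ}

/-- Precomposing with the projection gives a function continuous in the point on the whole space and
measurable in `ω`, hence jointly measurable; on `X` the projection does nothing. -/
lemma measurable_loss_comp (hX : IsDecisionSet X r) (hf : ∀ ω, IsLoss X L β (f ω))
    (hfm : ∀ x ∈ X, Measurable fun ω => f ω x) {y : Ω → E d} (hy : Measurable y)
    (hyX : ∀ ω, y ω ∈ X) : Measurable fun ω => f ω (y ω) := by
  have hmem := fun x => proj_mem hX.isClosed hX.nonempty x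
  have hcont : ∀ ω, Continuous fun x => f ω (proj X x) := by
    intro ω
    have : ContinuousOn (f ω) X := (hf ω).differentiableOn.continuousOn
    exact this.comp_continuous (continuous_proj hX.isClosed hX.convex hX.nonempty) hmem
  have h := measurable_uncurry_of_continuous_of_measurable (u := fun x ω => f ω (proj X x)) hcont
    fun x => hfm _ (hmem x)
  have h2 : Measurable fun ω => f ω (proj X (y ω)) := h.comp (hy.prodMk measurable_id)
  simpa only [proj_eq_self hX.isClosed hX.convex (hyX _)] using h2

/-- The gradient is a limit of difference quotients. The index is shifted by `N` because the losses
are measurable only at points of `X`. -/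
lemma measurable_gradient_of_mem_nhds (hf : ∀ ω, IsLoss X L β (f ω))
    (hfm : ∀ x ∈ X, Measurable fun ω => f ω x) {x : E d} (hx : X ∈ nhds x) :
    Measurable fun ω => gradientWithin (f ω) X x := by
  have h : ∀ e : E d, Measurable fun ω => inner ℝ (gradientWithin (f ω) X x) e := by
    intro e
    have hev : ∀ᶠ n : ℕ in Filter.atTop, x + ((n : ℝ) + 1)⁻¹ • e ∈ X := by
      have h1 : Filter.Tendsto (fun n : ℕ => x + ((n : ℝ) + 1)⁻¹ • e) Filter.atTop
          (nhds (x + (0 : ℝ) • e)) := by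
        have := tendsto_one_div_add_atTop_nhds_zero_nat (𝕜 := ℝ)
        simp only [one_div] at this
        exact tendsto_const_nhds.add (this.smul_const e)
      rw [zero_smul, add_zero] at h1
      exact h1 hx
    obtain ⟨N, hN⟩ := Filter.eventually_atTop.1 hev
    refine measurable_of_tendsto_metrizable (f := fun (n : ℕ) ω => (((n + N : ℕ) : ℝ) + 1) *
      (f ω (x + (((n + N : ℕ) : ℝ) + 1)⁻¹ • e) - f ω x)) (fun n => ?_) ?_
    · exact ((hfm _ (hN _ (by omega))).sub (hfm x (mem_of_mem_nhds hx))).const_mul _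
    · rw [tendsto_pi_nhds]
      intro ω
      exact ((hf ω).tendsto_difference_quotient hx e).comp (Filter.tendsto_add_atTop_nat N)
  have e : (fun ω => gradientWithin (f ω) X x) = fun ω =>
      ∑ i, inner ℝ (gradientWithin (f ω) X x) (EuclideanSpace.basisFun (Fin d) ℝ i) •
        EuclideanSpace.basisFun (Fin d) ℝ i := by
    ext1 ω
    conv_lhs => rw [← (EuclideanSpace.basisFun (Fin d) ℝ).sum_repr' (gradientWithin (f ω) X x)]
    exact Finset.sum_congr rfl fun i _ => by rw [real_inner_comm]
  rw [e]
  exact Finset.measurable_sum _ fun i _ => (h _).smul_const _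

/-- Any `x` in `X` is the limit of the interior points `(1 - 1/(n+1))x`, and smoothness makes the
gradients converge. -/
lemma measurable_gradient (hX : IsDecisionSet X r) (hf : ∀ ω, IsLoss X L β (f ω))
    (hfm : ∀ x ∈ X, Measurable fun ω => f ω x) {x : E d} (hx : x ∈ X) :
    Measurable fun ω => gradientWithin (f ω) X x := by
  have hρ : ∀ n : ℕ, (0 : ℝ) ≤ 1 - 1 / ((n : ℝ) + 1) ∧ 1 - 1 / ((n : ℝ) + 1) < 1 := by
    intro n
    have h1 : 1 / ((n : ℝ) + 1) ≤ 1 := by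
      rw [div_le_one (by positivity)]
      linarith [Nat.cast_nonneg (α := ℝ) n]
    have h2 : 0 < 1 / ((n : ℝ) + 1) := by positivity
    constructor <;> linarith
  refine measurable_of_tendsto_metrizable
    (f := fun (n : ℕ) ω => gradientWithin (f ω) X ((1 - 1 / ((n : ℝ) + 1)) • x))
    (fun n => measurable_gradient_of_mem_nhds hf hfm
      (hX.smul_mem_nhds (hρ n).1 (hρ n).2 hx)) ?_
  rw [tendsto_pi_nhds]
  intro ω
  rw [tendsto_iff_norm_sub_tendsto_zero]
  have hlim : Filter.Tendsto (fun n : ℕ => β * (1 / ((n : ℝ) + 1) * ‖x‖)) Filter.atTop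
      (nhds (β * (0 * ‖x‖))) :=
    (tendsto_one_div_add_atTop_nhds_zero_nat.mul_const _).const_mul _
  rw [zero_mul, mul_zero] at hlim
  refine squeeze_zero (fun _ => norm_nonneg _) (fun n => ?_) hlim
  have h1 := (hf ω).smooth _ (mem_of_mem_nhds (hX.smul_mem_nhds (hρ n).1 (hρ n).2 hx)) x hx
  have h2 : ((1 - 1 / ((n : ℝ) + 1)) • x - x : E d) = -((1 / ((n : ℝ) + 1)) • x) := by module
  rwa [h2, norm_neg, norm_smul, Real.norm_of_nonneg (by positivity)] at h1

lemma measurable_gradient_comp (hX : IsDecisionSet X r) (hf : ∀ ω, IsLoss X L β (f ω))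
    (hfm : ∀ x ∈ X, Measurable fun ω => f ω x) {y : Ω → E d} (hy : Measurable y)
    (hyX : ∀ ω, y ω ∈ X) : Measurable fun ω => gradientWithin (f ω) X (y ω) := by
  have hmem := fun x => proj_mem hX.isClosed hX.nonempty x
  have hcont : ∀ ω, Continuous fun x => gradientWithin (f ω) X (proj X x) := by
    intro ω
    have : ContinuousOn (gradientWithin (f ω) X) X := by
      refine LipschitzOnWith.continuousOn (K := β.toNNReal) ?_
      refine LipschitzOnWith.of_dist_le_mul fun x hx y hy => ?_
      rw [dist_eq_norm, dist_eq_norm]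
      exact ((hf ω).smooth x hx y hy).trans
        (mul_le_mul_of_nonneg_right (Real.le_coe_toNNReal β) (norm_nonneg _))
    exact this.comp_continuous (continuous_proj hX.isClosed hX.convex hX.nonempty) hmem
  have h := measurable_uncurry_of_continuous_of_measurable
    (u := fun x ω => gradientWithin (f ω) X (proj X x)) hcont
    fun x => measurable_gradient hX hf hfm (hmem x)
  have h2 : Measurable fun ω => gradientWithin (f ω) X (proj X (y ω)) :=
    h.comp (hy.prodMk measurable_id)
  simpa only [proj_eq_self hX.isClosed hX.convex (hyX _)] using h2

end Losses

section RandomIndex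

variable {Ω : Type*} {mΩ : MeasurableSpace Ω}

/-- Needed because the number of experts is random. -/
lemma measurable_comp_nat {β : Type*} [MeasurableSpace β] {N : Ω → ℕ} (hN : Measurable N)
    {g : ℕ → Ω → β} (hg : ∀ n, Measurable (g n)) : Measurable fun ω => g (N ω) ω := by
  have h : Measurable fun p : ℕ × Ω => g p.1 p.2 :=
    measurable_from_prod_countable_right fun n => hg n
  exact h.comp (hN.prodMk measurable_id)

lemma measurable_sum_range {β : Type*} [AddCommMonoid β] [MeasurableSpace β] [MeasurableAdd₂ β]
    {N : Ω → ℕ} (hN : Measurable N) {g : ℕ → Ω → β} (hg : ∀ n, Measurable (g n)) :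
    Measurable fun ω => ∑ j ∈ Finset.range (N ω), g j ω :=
  measurable_comp_nat hN (g := fun n ω => ∑ j ∈ Finset.range n, g j ω)
    fun _ => Finset.measurable_sum _ fun j _ => hg j

end RandomIndex

namespace Config

variable {d : ℕ} {A : Config d} {Ω : Type*} {mΩ : MeasurableSpace Ω}

section Parameters

variable {H : Ω → ℕ} {S : Ω → ℝ}

lemma measurable_natCast (hH : Measurable H) : Measurable fun ω => (H ω : ℝ) :=
  measurable_from_top.comp hH

lemma measurable_δ (hH : Measurable H) (hS : Measurable S) :
    Measurable fun ω => A.δ (H ω) (S ω) := by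
  have := measurable_natCast hH
  unfold δ
  fun_prop

lemma measurable_Vmax (hS : Measurable S) : Measurable fun ω => A.Vmax (S ω) := by
  unfold Vmax
  fun_prop

lemma measurable_η₀ (hS : Measurable S) : Measurable fun ω => A.η₀ (S ω) := by
  have := measurable_Vmax (A := A) hS
  unfold η₀
  fun_prop

lemma measurable_η (hS : Measurable S) (i : ℕ) : Measurable fun ω => A.η (S ω) i := by
  have := measurable_η₀ (A := A) hS
  unfold η
  fun_prop

lemma measurable_numExperts (hH : Measurable H) (hS : Measurable S) :
    Measurable fun ω => A.numExperts (H ω) (S ω) := by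
  have h1 := measurable_natCast hH
  have h2 := measurable_η₀ (A := A) hS
  have h3 : Measurable fun ω => Real.logb 2 (A.D * H ω / A.η₀ (S ω)) := by
    unfold Real.logb
    fun_prop
  exact (Nat.measurable_ceil.comp h3).add_const 1

lemma measurable_ε (hH : Measurable H) (hS : Measurable S) :
    Measurable fun ω => A.ε (H ω) (S ω) := by
  have h1 := measurable_natCast (measurable_numExperts (A := A) hH hS)
  have h2 := measurable_Vmax (A := A) hS
  unfold ε
  fun_prop

lemma measurable_prior (hH : Measurable H) (hS : Measurable S) (i : ℕ) :
    Measurable fun ω => A.prior (H ω) (S ω) i :=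
  measurable_const.div (measurable_sum_range (measurable_numExperts hH hS)
    fun _ => measurable_const)

lemma measurable_proj_shrunk (hA : A.Valid) (hH : Measurable H) (hS : Measurable S) {x : Ω → E d}
    (hx : Measurable x) : Measurable fun ω => proj (A.shrunk (H ω) (S ω)) (x ω) := by
  have hX := hA.isDecisionSet
  have hδ := measurable_δ (A := A) hH hS
  have h1 := (continuous_proj hX.isClosed hX.convex hX.nonempty).measurable
  have e : (fun ω => proj (A.shrunk (H ω) (S ω)) (x ω)) = fun ω =>
      (1 - A.δ (H ω) (S ω) / A.r) • proj A.X ((1 - A.δ (H ω) (S ω) / A.r)⁻¹ • x ω) := by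
    ext1 ω
    exact proj_smul hX.isClosed hX.convex hX.nonempty
      (by linarith [δ_div_r_le hA (H ω) (S ω)]) _
  rw [e]
  have h2 : Measurable fun ω => (1 - A.δ (H ω) (S ω) / A.r)⁻¹ • x ω := by fun_prop
  have h3 := h1.comp h2
  have h4 : Measurable fun ω => 1 - A.δ (H ω) (S ω) / A.r := by fun_prop
  exact h4.smul h3

lemma measurable_hedge {N : Ω → ℕ} {ε : Ω → ℝ} {w ℓ : ℕ → Ω → ℝ} (hN : Measurable N)
    (hε : Measurable ε) (hw : ∀ i, Measurable (w i)) (hℓ : ∀ i, Measurable (ℓ i)) (i : ℕ) :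
    Measurable fun ω => hedge (N ω) (ε ω) (fun j => w j ω) (fun j => ℓ j ω) i := by
  have h : ∀ j, Measurable fun ω => w j ω * Real.exp (-ε ω * ℓ j ω) := fun j => by
    have := hw j
    have := hℓ j
    fun_prop
  exact (h i).div (measurable_sum_range hN h)

end Parameters

/-- All components of a random state are measurable. -/
structure MeasurableState {Ω : Type*} (mΩ : MeasurableSpace Ω) (s : Ω → State d) : Prop where
  H : Measurable[mΩ] fun ω => (s ω).H
  c : Measurable[mΩ] fun ω => (s ω).c
  S : Measurable[mΩ] fun ω => (s ω).S
  R : Measurable[mΩ] fun ω => (s ω).R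
  w : ∀ i, Measurable[mΩ] fun ω => (s ω).w i
  y' : ∀ i, Measurable[mΩ] fun ω => (s ω).y' i

namespace MeasurableState

variable {s s' : Ω → State d} {m g : Ω → E d}

lemma mono {m₁ m₂ : MeasurableSpace Ω} (h : m₁ ≤ m₂) (hs : MeasurableState m₁ s) :
    MeasurableState m₂ s where
  H := hs.H.mono h le_rfl
  c := hs.c.mono h le_rfl
  S := hs.S.mono h le_rfl
  R := hs.R.mono h le_rfl
  w := fun i => (hs.w i).mono h le_rfl
  y' := fun i => (hs.y' i).mono h le_rfl

lemma ite {p : Ω → Prop} [DecidablePred p] (hp : MeasurableSet {ω | p ω})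
    (hs : MeasurableState mΩ s) (hs' : MeasurableState mΩ s') :
    MeasurableState mΩ fun ω => if p ω then s ω else s' ω where
  H := by simpa only [apply_ite State.H] using Measurable.ite hp hs.H hs'.H
  c := by simpa only [apply_ite State.c] using Measurable.ite hp hs.c hs'.c
  S := by simpa only [apply_ite State.S] using Measurable.ite hp hs.S hs'.S
  R := by simpa only [apply_ite State.R] using Measurable.ite hp hs.R hs'.R
  w := fun i => by
    simpa only [apply_ite (fun q : State d => q.w i)] using Measurable.ite hp (hs.w i) (hs'.w i)
  y' := fun i => by
    simpa only [apply_ite (fun q : State d => q.y' i)] using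
      Measurable.ite hp (hs.y' i) (hs'.y' i)

lemma newEpoch (hA : A.Valid) {H c : Ω → ℕ} {S : Ω → ℝ} {z : Ω → ℕ → E d} (hH : Measurable H)
    (hc : Measurable c) (hS : Measurable S) (hz : ∀ i, Measurable fun ω => z ω i) :
    MeasurableState mΩ fun ω => A.newEpoch (H ω) (c ω) (S ω) (z ω) where
  H := hH
  c := hc
  S := hS
  R := measurable_const
  w := fun i => measurable_prior hH hS i
  y' := fun i => measurable_proj_shrunk hA hH hS (hz i)

lemma expertPoint (hA : A.Valid) (hs : MeasurableState mΩ s) (hm : Measurable m) (i : ℕ) :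
    Measurable fun ω => A.expertPoint (s ω) (m ω) i :=
  measurable_proj_shrunk hA hs.H hs.S ((hs.y' i).sub ((measurable_η hs.S i).smul hm))

lemma prob (hA : A.Valid) (hs : MeasurableState mΩ s) (hm : Measurable m) (i : ℕ) :
    Measurable fun ω => A.prob (s ω) (m ω) i :=
  measurable_hedge (measurable_numExperts hs.H hs.S) (measurable_ε hs.H hs.S) hs.w
    (fun j => hm.inner (hs.expertPoint hA hm j)) i

lemma center (hA : A.Valid) (hs : MeasurableState mΩ s) (hm : Measurable m) :
    Measurable fun ω => A.center (s ω) (m ω) :=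
  measurable_sum_range (measurable_numExperts hs.H hs.S)
    fun i => (hs.prob hA hm i).smul (hs.expertPoint hA hm i)

lemma δ (hs : MeasurableState mΩ s) : Measurable fun ω => A.δ (s ω).H (s ω).S :=
  measurable_δ hs.H hs.S

lemma query (hA : A.Valid) (hs : MeasurableState mΩ s) (hm : Measurable m) {v : Ω → E d}
    (hv : Measurable v) : Measurable fun ω => A.query (s ω) (m ω) (v ω) :=
  (hs.center hA hm).add (hs.δ.smul hv)

lemma shrinkPoint (hs : MeasurableState mΩ s) (u : E d) :
    Measurable fun ω => A.shrinkPoint (s ω) u :=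
  ((measurable_const.sub (hs.δ.div_const _))).smul_const u

lemma nextState (hA : A.Valid) (hs : MeasurableState mΩ s) (hm : Measurable m)
    (hg : Measurable g) {z : Ω → ℕ → E d} (hz : ∀ i, Measurable fun ω => z ω i) :
    MeasurableState mΩ fun ω => A.nextState (s ω) (m ω) (g ω) (z ω) := by
  have hH := hs.H
  have hc := hs.c
  have hS := hs.S
  have hR := hs.R
  have hc1 : Measurable fun ω => (s ω).c + 1 := hc.add_const 1
  have hR' : Measurable fun ω => (s ω).R + ‖g ω - m ω‖ ^ 2 :=
    hR.add ((hg.sub hm).norm.pow_const 2)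
  refine ite (measurableSet_le hH hc1)
    (newEpoch hA (hH.const_mul 2) measurable_const measurable_const hz)
    (ite (measurableSet_lt (measurable_Vmax hS) hR')
      (newEpoch hA hH hc1 (hS.const_mul 2) hz)
      { H := hH
        c := hc1
        S := hS
        R := hR'
        w := fun i => measurable_hedge (measurable_numExperts hH hS) (measurable_ε hH hS) hs.w
          (fun j => hg.inner (hs.expertPoint hA hm j)) i
        y' := fun i => measurable_proj_shrunk hA hH hS
          ((hs.y' i).sub ((measurable_η hS i).smul hg)) })

end MeasurableState

end Config

end TPVR

/-! ### The random game: adaptedness and moments. -/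

namespace TPVR

open Config

variable {d : ℕ} {A : Config d} {Ω : Type*} {mΩ : MeasurableSpace Ω} {μ : Measure Ω}
  {ℱ : Filtration ℕ mΩ} {f : ℕ → Ω → E d → ℝ} {m : ℕ → Ω → E d} {z : ℕ → Ω → ℕ → E d}
  {v : ℕ → Ω → Metric.sphere (0 : E d) 1}

/-- The interaction of the algorithm with an adaptive environment. -/
structure IsGame (A : Config d) (μ : Measure Ω) (ℱ : Filtration ℕ mΩ) (f : ℕ → Ω → E d → ℝ)
    (m : ℕ → Ω → E d) (z : ℕ → Ω → ℕ → E d) (v : ℕ → Ω → Metric.sphere (0 : E d) 1) : Prop where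
  valid : A.Valid
  isLoss : ∀ t ω, IsLoss A.X A.L A.β (f t ω)
  measurable_loss : ∀ t, ∀ x ∈ A.X, Measurable[ℱ t] (fun ω => f t ω x)
  measurable_pred : ∀ t, Measurable[ℱ t] (m t)
  norm_pred_le : ∀ t ω, ‖m t ω‖ ≤ A.L
  measurable_restart : ∀ t i, Measurable[ℱ t] (fun ω => z t ω i)
  measurable_dir : ∀ t, Measurable[ℱ (t + 1)] (v t)
  law_dir : ∀ t, μ.map (v t) = uniformSphere d
  indep_dir : ∀ t, Indep (ℱ t) (MeasurableSpace.comap (v t) inferInstance) μ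

/-- The random state at the beginning of round `t`. -/
noncomputable def randState (A : Config d) (f : ℕ → Ω → E d → ℝ) (m : ℕ → Ω → E d)
    (z : ℕ → Ω → ℕ → E d) (v : ℕ → Ω → Metric.sphere (0 : E d) 1) (t : ℕ) (ω : Ω) : State d :=
  A.state (fun t => f t ω) (fun t => m t ω) (fun t => (v t ω : E d)) (fun t => z t ω) t

lemma norm_dir (t : ℕ) (ω : Ω) : ‖(v t ω : E d)‖ = 1 := by simp

namespace IsGame

lemma inv (hG : IsGame A μ ℱ f m z v) (t : ℕ) (ω : Ω) : A.Inv t (randState A f m z v t ω) :=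
  inv_state hG.valid (fun t => hG.isLoss t ω) (fun t => hG.norm_pred_le t ω)
    (fun t => norm_dir t ω) t

lemma center_mem (hG : IsGame A μ ℱ f m z v) (t : ℕ) (ω : Ω) :
    A.center (randState A f m z v t ω) (m t ω) ∈ A.X :=
  shrunk_subset hG.valid _ _ ((hG.inv t ω).center_mem hG.valid _)

lemma query_mem (hG : IsGame A μ ℱ f m z v) (t : ℕ) (ω : Ω) :
    A.query (randState A f m z v t ω) (m t ω) (v t ω) ∈ A.X :=
  (hG.inv t ω).query_mem hG.valid _ (norm_dir t ω)

lemma query_neg_mem (hG : IsGame A μ ℱ f m z v) (t : ℕ) (ω : Ω) :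
    A.query (randState A f m z v t ω) (m t ω) (-(v t ω : E d)) ∈ A.X :=
  (hG.inv t ω).query_mem hG.valid _ (by rw [norm_neg, norm_dir])

lemma measurable_coeff (hG : IsGame A μ ℱ f m z v) {t : ℕ}
    (hs : MeasurableState (ℱ t) (randState A f m z v t)) :
    Measurable[ℱ (t + 1)] fun ω =>
      A.coeff (randState A f m z v t ω) (m t ω) (v t ω) (f t ω) := by
  have hle : ℱ t ≤ ℱ (t + 1) := ℱ.mono (Nat.le_succ t)
  have hm := (hG.measurable_pred t).mono hle le_rfl
  have hs' := hs.mono hle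
  have hv : Measurable[ℱ (t + 1)] fun ω => (v t ω : E d) :=
    measurable_subtype_coe.comp (hG.measurable_dir t)
  have hfm : ∀ x ∈ A.X, Measurable[ℱ (t + 1)] fun ω => f t ω x :=
    fun x hx => (hG.measurable_loss t x hx).mono hle le_rfl
  have h1 := measurable_loss_comp (mΩ := ℱ (t + 1)) hG.valid.isDecisionSet (hG.isLoss t) hfm
    (hs'.query hG.valid hm hv) (hG.query_mem t)
  have h2 := measurable_loss_comp (mΩ := ℱ (t + 1)) hG.valid.isDecisionSet (hG.isLoss t) hfm
    (hs'.query hG.valid hm hv.neg) (hG.query_neg_mem t)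
  have hδ := hs'.δ (A := A)
  exact (measurable_const.div (hδ.const_mul 2)).mul
    ((h1.sub h2).sub ((hδ.const_mul 2).mul (hm.inner hv)))

lemma measurable_gradEst (hG : IsGame A μ ℱ f m z v) {t : ℕ}
    (hs : MeasurableState (ℱ t) (randState A f m z v t)) :
    Measurable[ℱ (t + 1)] fun ω =>
      A.gradEst (randState A f m z v t ω) (m t ω) (v t ω) (f t ω) := by
  have hle : ℱ t ≤ ℱ (t + 1) := ℱ.mono (Nat.le_succ t)
  have hv : Measurable[ℱ (t + 1)] fun ω => (v t ω : E d) :=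
    measurable_subtype_coe.comp (hG.measurable_dir t)
  exact ((hG.measurable_pred t).mono hle le_rfl).add ((hG.measurable_coeff hs).smul hv)

/-- The state of round `t` is known before the direction of round `t` is drawn, hence independent of
it; all moment computations rest on this. -/
lemma measurableState (hG : IsGame A μ ℱ f m z v) (t : ℕ) :
    MeasurableState (ℱ t) (randState A f m z v t) := by
  induction t with
  | zero =>
    exact MeasurableState.newEpoch (mΩ := ℱ 0) hG.valid measurable_const measurable_const
      measurable_const (hG.measurable_restart 0)
  | succ t ih =>
    have hle : ℱ t ≤ ℱ (t + 1) := ℱ.mono (Nat.le_succ t)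
    exact (ih.mono hle).nextState (mΩ := ℱ (t + 1)) hG.valid
      ((hG.measurable_pred t).mono hle le_rfl) (hG.measurable_gradEst ih)
      (hG.measurable_restart (t + 1))

lemma measurable_center (hG : IsGame A μ ℱ f m z v) (t : ℕ) :
    Measurable[ℱ t] fun ω => A.center (randState A f m z v t ω) (m t ω) :=
  (hG.measurableState t).center (mΩ := ℱ t) hG.valid (hG.measurable_pred t)

lemma measurable_gradient_center (hG : IsGame A μ ℱ f m z v) (t : ℕ) :
    Measurable[ℱ t] fun ω =>
      gradientWithin (f t ω) A.X (A.center (randState A f m z v t ω) (m t ω)) :=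
  measurable_gradient_comp (mΩ := ℱ t) hG.valid.isDecisionSet (hG.isLoss t)
    (hG.measurable_loss t) (hG.measurable_center t) (hG.center_mem t)

lemma measurable_gradGap (hG : IsGame A μ ℱ f m z v) (t : ℕ) :
    Measurable[ℱ t] fun ω => A.gradGap (randState A f m z v t ω) (m t ω) (f t ω) :=
  (hG.measurable_gradient_center t).sub (hG.measurable_pred t)

lemma norm_gradient_le (hG : IsGame A μ ℱ f m z v) (t : ℕ) (ω : Ω) {x : E d} (hx : x ∈ A.X) :
    ‖gradientWithin (f t ω) A.X x‖ ≤ A.L + A.β * A.D :=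
  IsLoss.norm_gradient_le hG.valid.isDecisionSet (hG.isLoss t ω) hG.valid.L_nonneg
    hG.valid.β_pos.le hx

lemma norm_gradient_sub_le (hG : IsGame A μ ℱ f m z v) (t : ℕ) (ω : Ω) {x : E d}
    (hx : x ∈ A.X) : ‖gradientWithin (f t ω) A.X x - m t ω‖ ≤ A.L + A.β * A.D + A.L :=
  (norm_sub_le _ _).trans (add_le_add (hG.norm_gradient_le t ω hx) (hG.norm_pred_le t ω))

lemma norm_gradGap_le (hG : IsGame A μ ℱ f m z v) (t : ℕ) (ω : Ω) :
    ‖A.gradGap (randState A f m z v t ω) (m t ω) (f t ω)‖ ≤ A.L + A.β * A.D + A.L :=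
  hG.norm_gradient_sub_le t ω (hG.center_mem t ω)

lemma measurable_play (hG : IsGame A μ ℱ f m z v) (t : ℕ) : Measurable fun ω =>
    A.query (randState A f m z v t ω) (m t ω) (v t ω) := by
  have hv : Measurable fun ω => (v t ω : E d) :=
    measurable_subtype_coe.comp ((hG.measurable_dir t).mono (ℱ.le _) le_rfl)
  exact ((hG.measurableState t).mono (ℱ.le t)).query hG.valid
    ((hG.measurable_pred t).mono (ℱ.le t) le_rfl) hv

variable [IsProbabilityMeasure μ]

lemma integrable_sq_norm_gradient_sub (hG : IsGame A μ ℱ f m z v) (t : ℕ) :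
    Integrable (fun ω => ‖gradientWithin (f t ω) A.X
      (A.query (randState A f m z v t ω) (m t ω) (v t ω)) - m t ω‖ ^ 2) μ := by
  have hm := (hG.measurable_pred t).mono (ℱ.le t) le_rfl
  have h1 := measurable_gradient_comp hG.valid.isDecisionSet (hG.isLoss t)
    (fun x hx => (hG.measurable_loss t x hx).mono (ℱ.le t) le_rfl) (hG.measurable_play t)
    (hG.query_mem t)
  refine Integrable.of_bound (C := (A.L + A.β * A.D + A.L) ^ 2)
    ((h1.sub hm).norm.pow_const 2).aestronglyMeasurable (Filter.Eventually.of_forall fun ω => ?_)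
  rw [norm_pow, norm_norm]
  exact pow_le_pow_left₀ (norm_nonneg _) (hG.norm_gradient_sub_le t ω (hG.query_mem t ω)) 2

lemma integrable_loss_sub (hG : IsGame A μ ℱ f m z v) (t : ℕ) {u : E d} (hu : u ∈ A.X) :
    Integrable (fun ω => f t ω (A.query (randState A f m z v t ω) (m t ω) (v t ω)) - f t ω u)
      μ := by
  have hfm := fun x hx => (hG.measurable_loss t x hx).mono (ℱ.le t) le_rfl
  have h1 := measurable_loss_comp hG.valid.isDecisionSet (hG.isLoss t) hfm (hG.measurable_play t)
    (hG.query_mem t)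
  refine Integrable.of_bound (C := A.L * A.D) (h1.sub (hfm u hu)).aestronglyMeasurable
    (Filter.Eventually.of_forall fun ω => ?_)
  exact ((hG.isLoss t ω).lipschitz _ (hG.query_mem t ω) _ hu).trans (mul_le_mul_of_nonneg_left
    (hG.valid.isDecisionSet.norm_sub_le (hG.query_mem t ω) hu) hG.valid.L_nonneg)

lemma integrable_inner_mul_inner {a b : Ω → E d} {w : Ω → Metric.sphere (0 : E d) 1}
    (ha : Measurable a) (hb : Measurable b) (hw : Measurable w) {Ca Cb : ℝ}
    (hCa : ∀ ω, ‖a ω‖ ≤ Ca) (hCb : ∀ ω, ‖b ω‖ ≤ Cb) :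
    Integrable (fun ω => inner ℝ (a ω) (w ω : E d) * inner ℝ (b ω) (w ω : E d)) μ := by
  have hw' : Measurable fun ω => (w ω : E d) := measurable_subtype_coe.comp hw
  refine Integrable.of_bound (C := Ca * Cb)
    ((ha.inner hw').mul (hb.inner hw')).aestronglyMeasurable
    (Filter.Eventually.of_forall fun ω => ?_)
  rw [norm_mul]
  exact mul_le_mul ((abs_inner_sphere_le _ _).trans (hCa ω))
    ((abs_inner_sphere_le _ _).trans (hCb ω)) (abs_nonneg _) ((norm_nonneg _).trans (hCa ω))

lemma integral_inner_mul_inner (hG : IsGame A μ ℱ f m z v) (t : ℕ) {a b : Ω → E d}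
    (ha : Measurable[ℱ t] a) (hb : Measurable[ℱ t] b) {Ca Cb : ℝ}
    (hCa : ∀ ω, ‖a ω‖ ≤ Ca) (hCb : ∀ ω, ‖b ω‖ ≤ Cb) :
    ∫ ω, inner ℝ (a ω) (v t ω : E d) * inner ℝ (b ω) (v t ω : E d) ∂μ =
      ∫ ω, inner ℝ (a ω) (b ω) / d ∂μ := by
  have hd := hG.valid.one_le_dim
  have hv := (hG.measurable_dir t).mono (ℱ.le _) le_rfl
  have h := integral_eq_integral_integral_of_indep (ℱ.le t) hd hv (hG.law_dir t) (hG.indep_dir t)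
    (ha.prodMk hb)
    (F := fun p => inner ℝ p.1.1 (p.2 : E d) * inner ℝ p.1.2 (p.2 : E d)) (by fun_prop)
    (integrable_inner_mul_inner (ha.mono (ℱ.le t) le_rfl) (hb.mono (ℱ.le t) le_rfl) hv hCa hCb)
  simpa only [integral_inner_mul_inner_sphere hd] using h

lemma integrable_inner_dir (hG : IsGame A μ ℱ f m z v) (t : ℕ) {a : Ω → E d}
    (ha : Measurable[ℱ t] a) {Ca : ℝ} (hCa : ∀ ω, ‖a ω‖ ≤ Ca) :
    Integrable (fun ω => inner ℝ (a ω) (v t ω : E d)) μ := by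
  have hv : Measurable fun ω => (v t ω : E d) :=
    measurable_subtype_coe.comp ((hG.measurable_dir t).mono (ℱ.le _) le_rfl)
  exact Integrable.of_bound (C := Ca) ((ha.mono (ℱ.le t) le_rfl).inner hv).aestronglyMeasurable
    (Filter.Eventually.of_forall fun ω => (abs_inner_sphere_le _ _).trans (hCa ω))

lemma integral_inner_dir (hG : IsGame A μ ℱ f m z v) (t : ℕ) {a : Ω → E d}
    (ha : Measurable[ℱ t] a) {Ca : ℝ} (hCa : ∀ ω, ‖a ω‖ ≤ Ca) :
    ∫ ω, inner ℝ (a ω) (v t ω : E d) ∂μ = 0 := by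
  have h := integral_eq_integral_integral_of_indep (ℱ.le t) hG.valid.one_le_dim
    ((hG.measurable_dir t).mono (ℱ.le _) le_rfl) (hG.law_dir t) (hG.indep_dir t) ha
    (F := fun p => inner ℝ p.1 (p.2 : E d)) (by fun_prop) (hG.integrable_inner_dir t ha hCa)
  simpa only [integral_inner_sphere, integral_zero] using h

/-- The linear part vanishes by the symmetry of the sphere; in the bilinear part the factor `d`
compensates the `1/d` of isotropy. The comparator is deterministic, so its shrunken version is known
before the direction is drawn. -/
lemma integrable_noise_and_integral_eq_zero (hG : IsGame A μ ℱ f m z v) (t : ℕ) {u : E d}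
    (hu : u ∈ A.X) :
    Integrable (fun ω => A.noise (randState A f m z v t ω) (m t ω) (v t ω) u (f t ω)) μ ∧
      ∫ ω, A.noise (randState A f m z v t ω) (m t ω) (v t ω) u (f t ω) ∂μ = 0 := by
  have hA := hG.valid
  have hd : (d : ℝ) ≠ 0 := by linarith [hA.one_le_cast]
  have hv := (hG.measurable_dir t).mono (ℱ.le _) le_rfl
  have ha := hG.measurable_gradGap t
  have hb : Measurable[ℱ t] fun ω => A.δ (randState A f m z v t ω).H (randState A f m z v t ω).S •
      gradientWithin (f t ω) A.X (A.center (randState A f m z v t ω) (m t ω)) :=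
    ((hG.measurableState t).δ (mΩ := ℱ t)).smul (hG.measurable_gradient_center t)
  have hw : Measurable[ℱ t] fun ω => A.center (randState A f m z v t ω) (m t ω) -
      A.shrinkPoint (randState A f m z v t ω) u :=
    (hG.measurable_center t).sub ((hG.measurableState t).shrinkPoint (mΩ := ℱ t) u)
  have hCb : ∀ ω, ‖A.δ (randState A f m z v t ω).H (randState A f m z v t ω).S •
      gradientWithin (f t ω) A.X (A.center (randState A f m z v t ω) (m t ω))‖ ≤
      A.r / 2 * (A.L + A.β * A.D) := by
    intro ω
    rw [norm_smul, Real.norm_of_nonneg (δ_nonneg hA _ _)]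
    exact mul_le_mul (δ_le_half_r _ _) (hG.norm_gradient_le t ω (hG.center_mem t ω))
      (norm_nonneg _) (by linarith [hA.r_pos])
  have hCw : ∀ ω, ‖A.center (randState A f m z v t ω) (m t ω) -
      A.shrinkPoint (randState A f m z v t ω) u‖ ≤ A.D := fun ω =>
    norm_sub_le_of_mem_shrunk hA ((hG.inv t ω).center_mem hA _) (shrinkPoint_mem hu)
  have i1 := hG.integrable_inner_dir t hb hCb
  have i2 := integrable_inner_mul_inner (μ := μ) (ha.mono (ℱ.le t) le_rfl)
    (hw.mono (ℱ.le t) le_rfl) hv (hG.norm_gradGap_le t) hCw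
  have i3 : Integrable (fun ω => inner ℝ (A.gradGap (randState A f m z v t ω) (m t ω) (f t ω))
      (A.center (randState A f m z v t ω) (m t ω) -
        A.shrinkPoint (randState A f m z v t ω) u)) μ := by
    refine Integrable.of_bound (C := (A.L + A.β * A.D + A.L) * A.D)
      ((ha.mono (ℱ.le t) le_rfl).inner (hw.mono (ℱ.le t) le_rfl)).aestronglyMeasurable
      (Filter.Eventually.of_forall fun ω => ?_)
    exact (abs_real_inner_le_norm _ _).trans (mul_le_mul (hG.norm_gradGap_le t ω) (hCw ω)
      (norm_nonneg _) ((norm_nonneg _).trans (hG.norm_gradGap_le t ω)))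
  have e1 := hG.integral_inner_dir t hb hCb
  have e2 := hG.integral_inner_mul_inner t ha hw (hG.norm_gradGap_le t) hCw
  have i4 := i3.sub (i2.const_mul (d : ℝ))
  refine ⟨i1.add i4, ?_⟩
  have e3 : ∫ ω, (inner ℝ (A.gradGap (randState A f m z v t ω) (m t ω) (f t ω))
      (A.center (randState A f m z v t ω) (m t ω) -
        A.shrinkPoint (randState A f m z v t ω) u) -
      d * (inner ℝ (A.gradGap (randState A f m z v t ω) (m t ω) (f t ω)) (v t ω : E d) *
        inner ℝ (A.center (randState A f m z v t ω) (m t ω) -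
          A.shrinkPoint (randState A f m z v t ω) u) (v t ω : E d))) ∂μ = 0 := by
    rw [integral_sub i3 (i2.const_mul _), integral_const_mul, e2, integral_div]
    field_simp
    ring
  refine (integral_add i1 i4).trans ?_
  rw [e1, zero_add]
  exact e3

lemma integrable_residual_term (hG : IsGame A μ ℱ f m z v) (t : ℕ) :
    Integrable (fun ω =>
      ‖A.gradEst (randState A f m z v t ω) (m t ω) (v t ω) (f t ω) - m t ω‖ ^ 2) μ := by
  have hg := (hG.measurable_gradEst (hG.measurableState t)).mono (ℱ.le _) le_rfl
  have hm := (hG.measurable_pred t).mono (ℱ.le t) le_rfl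
  refine Integrable.of_bound (C := 4 * d ^ 2 * A.L ^ 2)
    ((hg.sub hm).norm.pow_const 2).aestronglyMeasurable (Filter.Eventually.of_forall fun ω => ?_)
  rw [norm_pow, norm_norm]
  exact sq_norm_gradEst_sub_le hG.valid (hG.inv t ω) (hG.isLoss t ω) (hG.norm_pred_le t ω)
    (norm_dir t ω)

/-- The variance of the gradient estimate is controlled by the prediction error. -/
lemma integral_residual_term_le (hG : IsGame A μ ℱ f m z v) (t : ℕ) :
    ∫ ω, ‖A.gradEst (randState A f m z v t ω) (m t ω) (v t ω) (f t ω) - m t ω‖ ^ 2 ∂μ ≤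
      4 * d * ∫ ω, ‖gradientWithin (f t ω) A.X
        (A.query (randState A f m z v t ω) (m t ω) (v t ω)) - m t ω‖ ^ 2 ∂μ +
      9 * d * A.Smin * ((t : ℝ) + 1)⁻¹ := by
  have hA := hG.valid
  have hd := hA.one_le_cast
  have hv := (hG.measurable_dir t).mono (ℱ.le _) le_rfl
  have ha := hG.measurable_gradGap t
  have ha' := ha.mono (ℱ.le t) le_rfl
  have i1 := hG.integrable_residual_term t
  have i2 := integrable_inner_mul_inner (μ := μ) ha' ha' hv (hG.norm_gradGap_le t)
    (hG.norm_gradGap_le t)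
  have e2 := hG.integral_inner_mul_inner t ha ha (hG.norm_gradGap_le t) (hG.norm_gradGap_le t)
  have i3 := hG.integrable_sq_norm_gradient_sub t
  have i4 : Integrable (fun ω =>
      ‖A.gradGap (randState A f m z v t ω) (m t ω) (f t ω)‖ ^ 2) μ := by
    refine Integrable.of_bound (C := (A.L + A.β * A.D + A.L) ^ 2)
      (ha'.norm.pow_const 2).aestronglyMeasurable (Filter.Eventually.of_forall fun ω => ?_)
    rw [norm_pow, norm_norm]
    exact pow_le_pow_left₀ (norm_nonneg _) (hG.norm_gradGap_le t ω) 2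
  simp only [real_inner_self_eq_norm_sq] at e2
  rw [integral_div] at e2
  -- A term of mean zero, added to the right-hand side so that the remaining inequality holds
  -- pointwise. It exchanges `2d²⟨gap, v⟩²` for `2d‖gap‖²`, saving a factor `d`.
  have i5 : Integrable (fun ω => 2 * (d : ℝ) ^ 2 *
      (inner ℝ (A.gradGap (randState A f m z v t ω) (m t ω) (f t ω)) (v t ω : E d) *
        inner ℝ (A.gradGap (randState A f m z v t ω) (m t ω) (f t ω)) (v t ω : E d)) -
      2 * d * ‖A.gradGap (randState A f m z v t ω) (m t ω) (f t ω)‖ ^ 2) μ :=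
    (i2.const_mul _).sub (i4.const_mul _)
  have e5 : ∫ ω, (2 * (d : ℝ) ^ 2 *
      (inner ℝ (A.gradGap (randState A f m z v t ω) (m t ω) (f t ω)) (v t ω : E d) *
        inner ℝ (A.gradGap (randState A f m z v t ω) (m t ω) (f t ω)) (v t ω : E d)) -
      2 * d * ‖A.gradGap (randState A f m z v t ω) (m t ω) (f t ω)‖ ^ 2) ∂μ = 0 := by
    rw [integral_sub (i2.const_mul _) (i4.const_mul _), integral_const_mul, integral_const_mul, e2]
    field_simp
    ring
  have i6 : Integrable (fun ω => 4 * d * ‖gradientWithin (f t ω) A.X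
      (A.query (randState A f m z v t ω) (m t ω) (v t ω)) - m t ω‖ ^ 2 +
      9 * d * A.Smin * ((t : ℝ) + 1)⁻¹) μ := (i3.const_mul _).add (integrable_const _)
  have e6 : ∫ ω, (4 * d * ‖gradientWithin (f t ω) A.X
      (A.query (randState A f m z v t ω) (m t ω) (v t ω)) - m t ω‖ ^ 2 +
      9 * d * A.Smin * ((t : ℝ) + 1)⁻¹) ∂μ = 4 * d * ∫ ω, ‖gradientWithin (f t ω) A.X
        (A.query (randState A f m z v t ω) (m t ω) (v t ω)) - m t ω‖ ^ 2 ∂μ +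
      9 * d * A.Smin * ((t : ℝ) + 1)⁻¹ := by
    rw [integral_add (i3.const_mul _) (integrable_const _), integral_const_mul, integral_const]
    simp
  have e7 := integral_add i5 i6
  rw [e5, zero_add, e6] at e7
  rw [← e7]
  refine integral_mono i1 (i5.add i6) fun ω => ?_
  have h1 := sq_norm_gradEst_sub_le' (m := m t ω) hA (hG.inv t ω) (hG.isLoss t ω)
    (norm_dir (v := v) t ω)
  have h2 := sq_norm_gradGap_le (m := m t ω) hA (hG.inv t ω) (hG.isLoss t ω)
    (norm_dir (v := v) t ω)
  have h3 := residual_error_le hA (hG.inv t ω)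
  have h4 := mul_le_mul_of_nonneg_left h2 (by positivity : (0 : ℝ) ≤ 2 * d)
  simp only
  linarith

end IsGame

end TPVR

/-! ### Logarithmic factors. -/

namespace TPVR

section Logarithms

lemma natLog_two_le {n : ℕ} (hn : n ≠ 0) : (Nat.log 2 n : ℝ) ≤ 3 / 2 * Real.log n := by
  have h1 : ((2 : ℝ) ^ Nat.log 2 n) ≤ n := by exact_mod_cast Nat.pow_log_le_self 2 hn
  have h2 := Real.log_le_log (by positivity) h1
  rw [Real.log_pow] at h2
  have h3 := Real.log_two_gt_d9
  have h4 : (0 : ℝ) ≤ Nat.log 2 n := Nat.cast_nonneg _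
  nlinarith

lemma sum_inv_succ_le (T : ℕ) :
    ∑ t ∈ Finset.range T, ((t : ℝ) + 1)⁻¹ ≤ 1 + Real.log T := by
  have h := harmonic_le_one_add_log T
  rw [harmonic] at h
  push_cast at h
  exact h

namespace Config

variable {d : ℕ} {A : Config d} {T : ℕ}

lemma log_le_log_mul_max (hT : 1 ≤ T) : Real.log T ≤ Real.log (T * max 1 A.L) := by
  have h : (1 : ℝ) ≤ T := by exact_mod_cast hT
  apply Real.log_le_log (by linarith)
  exact le_mul_of_one_le_right (by linarith) (le_max_left _ _)

lemma log_mul_max_nonneg (hT : 1 ≤ T) : 0 ≤ Real.log (T * max 1 A.L) :=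
  (Real.log_natCast_nonneg T).trans (log_le_log_mul_max hT)

lemma numExperts_le (hA : A.Valid) (hdT : d ≤ T ^ 2) {t : ℕ} (ht : t < T)
    {s : State d} (h : A.Inv t s) :
    (A.numExperts s.H s.S : ℝ) ≤ 6 * (1 + Real.log (T * max 1 A.L)) := by
  have hd := hA.one_le_cast
  have hdT' : (d : ℝ) ≤ T ^ 2 := by exact_mod_cast hdT
  have hT : (1 : ℝ) ≤ T := by exact_mod_cast (by omega : 1 ≤ T)
  have hH : (s.H : ℝ) ≤ T := by
    have := h.time
    have := h.c_lt
    exact_mod_cast (by omega : s.H ≤ T)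
  have hH1 : (1 : ℝ) ≤ s.H := by exact_mod_cast h.one_le_H
  set M := max 1 A.L with hM
  have hM1 : 1 ≤ M := le_max_left _ _
  have hSM : A.Smin ≤ M ^ 2 := by
    refine max_le (one_le_pow₀ hM1) ?_
    exact pow_le_pow_left₀ hA.L_nonneg (le_max_right _ _) 2
  have hS0 : 0 < s.S := by linarith [h.one_le_S]
  have hdS : d * s.S ≤ (T ^ 3 * M) ^ 2 := by
    have hSm := one_le_Smin (A := A)
    calc d * s.S ≤ T ^ 2 * (M ^ 2 * (T ^ 2 * T)) := by
          refine mul_le_mul hdT' (h.S_le.trans ?_) hS0.le (by positivity)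
          gcongr
      _ ≤ T ^ 2 * (M ^ 2 * (T ^ 2 * T)) * T := le_mul_of_one_le_right (by positivity) hT
      _ = _ := by ring
  have hsq : √(d * s.S) ≤ T ^ 3 * M := Real.sqrt_le_iff.2 ⟨by positivity, hdS⟩
  have harg : 4 * (s.H : ℝ) * √(d * s.S) ≤ 2 ^ 2 * (T * M) ^ 4 := by
    calc 4 * (s.H : ℝ) * √(d * s.S) ≤ 4 * T * (T ^ 3 * M) := by gcongr
      _ = 4 * (T ^ 4 * M) := by ring
      _ ≤ 4 * (T ^ 4 * M ^ 4) := by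
          have : M ≤ M ^ 4 := le_self_pow₀ hM1 (by norm_num)
          gcongr
      _ = _ := by ring
  have hpos : 0 < 4 * (s.H : ℝ) * √(d * s.S) := by
    have := one_le_sqrt_mul hA h.one_le_S
    positivity
  set Λ := Real.log (T * M) with hΛ
  have hΛ0 : 0 ≤ Λ := Real.log_nonneg (one_le_mul_of_one_le_of_one_le hT hM1)
  -- The argument is at most `4(TM)⁴`, and `4 / log 2 ≤ 6`.
  have hlog : Real.logb 2 (4 * s.H * √(d * s.S)) ≤ 2 + 6 * Λ := by
    have h1 := Real.log_le_log hpos harg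
    rw [Real.log_mul (x := 2 ^ 2) (by positivity) (by positivity), Real.log_pow,
      Real.log_pow] at h1
    have h2 := Real.log_two_gt_d9
    rw [Real.logb, div_le_iff₀ (by linarith)]
    push_cast at h1
    nlinarith
  have hlog0 : 0 ≤ Real.logb 2 (4 * s.H * √(d * s.S)) := by
    apply Real.logb_nonneg (by norm_num)
    have := one_le_sqrt_mul hA h.one_le_S
    nlinarith
  have hceil := Nat.ceil_lt_add_one hlog0
  rw [numExperts, D_mul_div_η₀ hA]
  push_cast
  linarith

/-- The bound `√(log N) ≤ N` is wasteful but harmless, since `N` is already logarithmic. -/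
lemma sqrt_log_numExperts_le (hA : A.Valid) (hdT : d ≤ T ^ 2) {t : ℕ} (ht : t < T)
    {s : State d} (h : A.Inv t s) :
    √(Real.log (A.numExperts s.H s.S)) ≤ 6 * (1 + Real.log (T * max 1 A.L)) := by
  refine le_trans ?_ (numExperts_le hA hdT ht h)
  have h3 : (3 : ℝ) ≤ A.numExperts s.H s.S := by
    exact_mod_cast three_le_numExperts hA h.one_le_H h.one_le_S
  rw [Real.sqrt_le_iff]
  have := Real.log_le_sub_one_of_pos (by linarith : (0 : ℝ) < A.numExperts s.H s.S)
  constructor <;> nlinarith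

lemma numEpochs_le (hA : A.Valid) (hT : 1 ≤ T) (hdT : d ≤ T ^ 2) :
    (((Nat.log 2 T + 1) * (Nat.log 2 (d * T) + 1) : ℕ) : ℝ) ≤
      7 * (1 + Real.log (T * max 1 A.L)) ^ 2 := by
  have hT' : (1 : ℝ) ≤ T := by exact_mod_cast hT
  have hd := hA.one_le_dim
  have hdT' : (d : ℝ) ≤ T ^ 2 := by exact_mod_cast hdT
  have hd' := hA.one_le_cast
  have h1 := natLog_two_le (by omega : T ≠ 0)
  have h2 := natLog_two_le (Nat.mul_ne_zero (by omega) (by omega) : d * T ≠ 0)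
  have h3 : Real.log ((d * T : ℕ) : ℝ) ≤ 3 * Real.log T := by
    rw [← Nat.cast_ofNat (n := 3), ← Real.log_pow]
    apply Real.log_le_log
    · push_cast
      positivity
    · push_cast
      calc (d : ℝ) * T ≤ T ^ 2 * T := by gcongr
        _ = T ^ 3 := by ring
  have h4 := log_le_log_mul_max (A := A) hT
  have h5 := log_mul_max_nonneg (A := A) hT
  push_cast
  set Λ := Real.log (T * max 1 A.L)
  calc ((Nat.log 2 T : ℝ) + 1) * ((Nat.log 2 (d * T) : ℝ) + 1)
      ≤ (3 / 2 * (1 + Λ)) * (9 / 2 * (1 + Λ)) := by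
        apply mul_le_mul <;> first | positivity | linarith
    _ ≤ 7 * (1 + Λ) ^ 2 := by nlinarith [sq_nonneg (1 + Λ)]

end Config

end Logarithms

/-! ### Integrating the pathwise bound. -/

open Config

namespace IsGame

variable {d : ℕ} {A : Config d} {Ω : Type*} {mΩ : MeasurableSpace Ω} {μ : Measure Ω}
  {ℱ : Filtration ℕ mΩ} {f : ℕ → Ω → E d → ℝ} {m : ℕ → Ω → E d} {z : ℕ → Ω → ℕ → E d}
  {v : ℕ → Ω → Metric.sphere (0 : E d) 1}

/-- The dynamic regret as a random variable. -/
noncomputable def regret (A : Config d) (f : ℕ → Ω → E d → ℝ) (m : ℕ → Ω → E d)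
    (z : ℕ → Ω → ℕ → E d) (v : ℕ → Ω → Metric.sphere (0 : E d) 1) (u : ℕ → E d) (T : ℕ) (ω : Ω) :
    ℝ :=
  A.dynRegret (fun t => f t ω) (fun t => m t ω) (fun t => (v t ω : E d)) (fun t => z t ω) u T

/-- The cumulative prediction error as a random variable. -/
noncomputable def sensitivity (A : Config d) (f : ℕ → Ω → E d → ℝ) (m : ℕ → Ω → E d)
    (z : ℕ → Ω → ℕ → E d) (v : ℕ → Ω → Metric.sphere (0 : E d) 1) (T : ℕ) (ω : Ω) : ℝ :=
  A.predError (fun t => f t ω) (fun t => m t ω) (fun t => (v t ω : E d)) (fun t => z t ω) T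

/-- The observed residual as a random variable. -/
noncomputable def randResidual (A : Config d) (f : ℕ → Ω → E d → ℝ) (m : ℕ → Ω → E d)
    (z : ℕ → Ω → ℕ → E d) (v : ℕ → Ω → Metric.sphere (0 : E d) 1) (T : ℕ) (ω : Ω) : ℝ :=
  A.residual (fun t => f t ω) (fun t => m t ω) (fun t => (v t ω : E d)) (fun t => z t ω) T

variable [IsProbabilityMeasure μ]

lemma integrable_regret (hG : IsGame A μ ℱ f m z v) {T : ℕ} {u : ℕ → E d}
    (hu : ∀ t < T, u t ∈ A.X) : Integrable (regret A f m z v u T) μ :=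
  integrable_finsetSum (Finset.range T) fun t ht => hG.integrable_loss_sub t (hu t (Finset.mem_range.1 ht))

lemma integrable_sensitivity (hG : IsGame A μ ℱ f m z v) (T : ℕ) :
    Integrable (sensitivity A f m z v T) μ :=
  integrable_finsetSum (Finset.range T) fun t _ => hG.integrable_sq_norm_gradient_sub t

lemma integrable_randResidual (hG : IsGame A μ ℱ f m z v) (T : ℕ) :
    Integrable (randResidual A f m z v T) μ :=
  integrable_finsetSum (Finset.range T) fun t _ => hG.integrable_residual_term t

lemma sensitivity_nonneg (T : ℕ) (ω : Ω) : 0 ≤ sensitivity A f m z v T ω := by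
  rw [sensitivity, predError]
  exact Finset.sum_nonneg fun _ _ => by positivity

lemma randResidual_nonneg (T : ℕ) (ω : Ω) : 0 ≤ randResidual A f m z v T ω := by
  rw [randResidual, Config.residual]
  exact Finset.sum_nonneg fun _ _ => by positivity

/-- The error terms of the rounds form a harmonic sum, whence the logarithm. -/
lemma integral_randResidual_le (hG : IsGame A μ ℱ f m z v) (T : ℕ) :
    ∫ ω, randResidual A f m z v T ω ∂μ ≤
      4 * d * ∫ ω, sensitivity A f m z v T ω ∂μ + 9 * d * A.Smin * (1 + Real.log T) := by
  have hd := hG.valid.one_le_cast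
  have h1 : ∫ ω, randResidual A f m z v T ω ∂μ = ∑ t ∈ Finset.range T, ∫ ω,
      ‖A.gradEst (randState A f m z v t ω) (m t ω) (v t ω) (f t ω) - m t ω‖ ^ 2 ∂μ :=
    integral_finsetSum (Finset.range T) fun t _ => hG.integrable_residual_term t
  have h2 : ∫ ω, sensitivity A f m z v T ω ∂μ = ∑ t ∈ Finset.range T, ∫ ω,
      ‖gradientWithin (f t ω) A.X
        (A.query (randState A f m z v t ω) (m t ω) (v t ω)) - m t ω‖ ^ 2 ∂μ :=
    integral_finsetSum (Finset.range T) fun t _ => hG.integrable_sq_norm_gradient_sub t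
  rw [h1, h2]
  refine (Finset.sum_le_sum fun t _ => hG.integral_residual_term_le t).trans ?_
  rw [Finset.sum_add_distrib, ← Finset.mul_sum, ← Finset.mul_sum]
  have h3 := sum_inv_succ_le T
  have h4 := one_le_Smin (A := A)
  gcongr

lemma integrable_sqrt_randResidual (hG : IsGame A μ ℱ f m z v) (T : ℕ) :
    Integrable (fun ω => √(A.Smin + randResidual A f m z v T ω / (4 * d))) μ := by
  have h1 : Integrable (fun ω => A.Smin + randResidual A f m z v T ω / (4 * d)) μ :=
    (integrable_const _).add ((hG.integrable_randResidual T).div_const _)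
  refine h1.mono' (Real.continuous_sqrt.comp_aestronglyMeasurable h1.aestronglyMeasurable)
    (Filter.Eventually.of_forall fun ω => ?_)
  have h2 : 0 ≤ randResidual A f m z v T ω / (4 * d) :=
    div_nonneg (randResidual_nonneg T ω) (by positivity)
  have h3 := one_le_Smin (A := A)
  rw [Real.norm_of_nonneg (Real.sqrt_nonneg _), Real.sqrt_le_iff]
  constructor <;> nlinarith

/-- Jensen for the concave square root. The pathwise bound depends on the residual only through this
root, so its expectation is all that is needed. -/
lemma integral_sqrt_randResidual_le (hG : IsGame A μ ℱ f m z v) {T : ℕ} (hT : 1 ≤ T) :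
    ∫ ω, √(A.Smin + randResidual A f m z v T ω / (4 * d)) ∂μ ≤
      2 * (1 + Real.log (T * max 1 A.L)) * √(∫ ω, sensitivity A f m z v T ω ∂μ + A.Smin) := by
  have hd := hG.valid.one_le_cast
  have h1 : Integrable (fun ω => A.Smin + randResidual A f m z v T ω / (4 * d)) μ :=
    (integrable_const _).add ((hG.integrable_randResidual T).div_const _)
  have h2 := Real.strictConcaveOn_sqrt.concaveOn.le_map_integral (μ := μ)
    Real.continuous_sqrt.continuousOn isClosed_Ici (Filter.Eventually.of_forall fun ω => by
      have h2 : 0 ≤ randResidual A f m z v T ω / (4 * d) :=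
        div_nonneg (randResidual_nonneg T ω) (by positivity)
      have h3 := one_le_Smin (A := A)
      simp only [Set.mem_Ici]
      linarith) h1 (hG.integrable_sqrt_randResidual T)
  refine h2.trans ?_
  rw [integral_add (integrable_const _) ((hG.integrable_randResidual T).div_const _),
    integral_const, integral_div]
  have h3 := hG.integral_randResidual_le T
  have h4 : 0 ≤ ∫ ω, sensitivity A f m z v T ω ∂μ := integral_nonneg (sensitivity_nonneg T)
  have h5 := log_le_log_mul_max (A := A) hT
  have h6 := log_mul_max_nonneg (A := A) hT
  have h7 := one_le_Smin (A := A)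
  set Λ := Real.log (T * max 1 A.L)
  set Sb := ∫ ω, sensitivity A f m z v T ω ∂μ
  have h8 : (∫ ω, randResidual A f m z v T ω ∂μ) / (4 * d) ≤
      Sb + 9 / 4 * A.Smin * (1 + Real.log T) := by
    rw [div_le_iff₀ (by positivity)]
    linarith
  have h9 : 9 / 4 * A.Smin * (1 + Real.log T) ≤ 9 / 4 * A.Smin * (1 + Λ) := by gcongr
  calc _ ≤ √((2 * (1 + Λ)) ^ 2 * (Sb + A.Smin)) := by
        apply Real.sqrt_le_sqrt
        simp only [probReal_univ, one_smul]
        nlinarith [mul_nonneg h6 h4, mul_nonneg h6 (by linarith : 0 ≤ A.Smin),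
          mul_nonneg (mul_nonneg h6 h6) (by linarith : 0 ≤ Sb + A.Smin)]
    _ = _ := by rw [Real.sqrt_mul (by positivity), Real.sqrt_sq (by linarith)]

/-- The dynamic regret when the horizon is not too short. -/
lemma integral_regret_le_of_le (hG : IsGame A μ ℱ f m z v) {T : ℕ} (hT : 1 ≤ T)
    (hdT : d ≤ T ^ 2) {u : ℕ → E d} (hu : ∀ t < T, u t ∈ A.X) :
    ∫ ω, regret A f m z v u T ω ∂μ ≤
      2100 * (1 + Real.log (T * max 1 A.L)) ^ 4 *
        ((√(d * (A.D ^ 2 + A.D * pathLength u T)) + A.L * A.D / A.r / (d * A.β)) *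
          √(∫ ω, sensitivity A f m z v T ω ∂μ + A.Smin)) := by
  have hA := hG.valid
  have hd := hA.one_le_cast
  have hL := hA.L_nonneg
  have hD := hA.D_pos
  have hr := hA.r_pos
  have hβ := hA.β_pos
  have hΛ := log_mul_max_nonneg (A := A) hT
  set Λ := Real.log (T * max 1 A.L) with hΛd
  set K : ℝ := (((Nat.log 2 T + 1) * (Nat.log 2 (d * T) + 1) : ℕ) : ℝ) with hK
  set G := √(d * (A.D ^ 2 + A.D * pathLength u T)) + A.L * A.D / A.r / (d * A.β) with hGd
  have hG0 : 0 ≤ G := by positivity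
  have hKle : K ≤ 7 * (1 + Λ) ^ 2 := numEpochs_le hA hT hdT
  have hsq := hG.integrable_sqrt_randResidual T
  have hnoise : Integrable (fun ω => ∑ t ∈ Finset.range T,
      A.noise (randState A f m z v t ω) (m t ω) (v t ω) (u t) (f t ω)) μ :=
    integrable_finsetSum (Finset.range T) fun t ht =>
      (hG.integrable_noise_and_integral_eq_zero t (hu t (Finset.mem_range.1 ht))).1
  have hnoise0 : ∫ ω, ∑ t ∈ Finset.range T,
      A.noise (randState A f m z v t ω) (m t ω) (v t ω) (u t) (f t ω) ∂μ = 0 := by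
    rw [integral_finsetSum (Finset.range T) fun t ht =>
      (hG.integrable_noise_and_integral_eq_zero t (hu t (Finset.mem_range.1 ht))).1]
    exact Finset.sum_eq_zero fun t ht =>
      (hG.integrable_noise_and_integral_eq_zero t (hu t (Finset.mem_range.1 ht))).2
  have hpath : ∀ ω, regret A f m z v u T ω ≤
      K * (25 * (6 * (1 + Λ)) * G) * √(A.Smin + randResidual A f m z v T ω / (4 * d)) +
      ∑ t ∈ Finset.range T,
        A.noise (randState A f m z v t ω) (m t ω) (v t ω) (u t) (f t ω) := by
    intro ω
    have h := dynRegret_le (z := fun t => z t ω) hA (fun t => hG.isLoss t ω)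
      (fun t => hG.norm_pred_le t ω) (fun t => norm_dir t ω) hT hu
      (ν := 6 * (1 + Λ)) (by linarith)
      (fun t ht => sqrt_log_numExperts_le hA hdT ht (hG.inv t ω))
    refine h.trans_eq ?_
    rw [IsRun.epochBound, ← hK, ← hGd]
    simp only [mul_assoc]
    rfl
  have hint := (hsq.const_mul (K * (25 * (6 * (1 + Λ)) * G))).add hnoise
  calc ∫ ω, regret A f m z v u T ω ∂μ ≤ _ := integral_mono (hG.integrable_regret hu) hint hpath
    _ = K * (25 * (6 * (1 + Λ)) * G) *
          ∫ ω, √(A.Smin + randResidual A f m z v T ω / (4 * d)) ∂μ := by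
        refine (integral_add (hsq.const_mul _) hnoise).trans ?_
        rw [hnoise0, add_zero, integral_const_mul]
    -- Two logarithms come from the number of epochs, one from the experts and one from the
    -- residual; `2100 = 7 · 25 · 6 · 2`.
    _ ≤ 7 * (1 + Λ) ^ 2 * (25 * (6 * (1 + Λ)) * G) *
          (2 * (1 + Λ) * √(∫ ω, sensitivity A f m z v T ω ∂μ + A.Smin)) := by
        refine mul_le_mul ?_ (hG.integral_sqrt_randResidual_le hT)
          (integral_nonneg fun ω => Real.sqrt_nonneg _) (by positivity)
        gcongr
    _ = _ := by ring

/-- The dynamic regret when the dimension is large compared with the horizon. -/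
lemma integral_regret_le_of_ge (hG : IsGame A μ ℱ f m z v) {T : ℕ} (hdT : T ^ 2 ≤ d)
    {u : ℕ → E d} (hu : ∀ t < T, u t ∈ A.X) :
    ∫ ω, regret A f m z v u T ω ∂μ ≤
      √(d * (A.D ^ 2 + A.D * pathLength u T)) *
          √(∫ ω, sensitivity A f m z v T ω ∂μ + A.Smin) := by
  have hA := hG.valid
  have hD := hA.D_pos
  have hL := hA.L_nonneg
  have h1 : ∀ ω, regret A f m z v u T ω ≤ T * (A.L * A.D) := by
    intro ω
    calc regret A f m z v u T ω ≤ ∑ t ∈ Finset.range T, A.L * A.D := by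
          rw [regret, dynRegret]
          refine Finset.sum_le_sum fun t ht => ?_
          have hu' := hu t (Finset.mem_range.1 ht)
          exact (le_abs_self _).trans (((hG.isLoss t ω).lipschitz _ (hG.query_mem t ω) _ hu').trans
            (mul_le_mul_of_nonneg_left (hA.isDecisionSet.norm_sub_le (hG.query_mem t ω) hu') hL))
      _ = _ := by simp
  have h2 : ∫ ω, regret A f m z v u T ω ∂μ ≤ T * (A.L * A.D) := by
    refine (integral_mono (hG.integrable_regret hu) (integrable_const _) h1).trans_eq ?_
    simp
  have h3 : 0 ≤ ∫ ω, sensitivity A f m z v T ω ∂μ := integral_nonneg (sensitivity_nonneg T)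
  have hdT' : (T : ℝ) ^ 2 ≤ d := by exact_mod_cast hdT
  -- Here `√d ≥ T` makes the trivial bound on the regret sufficient.
  have h4 : T * A.D ≤ √(d * (A.D ^ 2 + A.D * pathLength u T)) := by
    apply Real.le_sqrt_of_sq_le
    have := mul_nonneg hD.le (pathLength_nonneg u T)
    rw [mul_pow]
    exact mul_le_mul hdT' (by linarith) (by positivity) (by positivity)
  have h5 : A.L ≤ √(∫ ω, sensitivity A f m z v T ω ∂μ + A.Smin) := by
    apply Real.le_sqrt_of_sq_le
    linarith [sq_L_le_Smin (A := A)]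
  calc _ ≤ T * (A.L * A.D) := h2
    _ = T * A.D * A.L := by ring
    _ ≤ _ := mul_le_mul h4 h5 hL (Real.sqrt_nonneg _)

/-- The case distinction at `d = T²` is what keeps the dimension out of the logarithm. -/
lemma integral_regret_le (hG : IsGame A μ ℱ f m z v) {T : ℕ} (hT : 1 ≤ T) {u : ℕ → E d}
    (hu : ∀ t < T, u t ∈ A.X) :
    ∫ ω, regret A f m z v u T ω ∂μ ≤
      2100 * (1 + Real.log (T * max 1 A.L)) ^ 4 *
        (√(d * (∫ ω, sensitivity A f m z v T ω ∂μ + A.Smin) *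
            (A.D ^ 2 + A.D * pathLength u T)) +
          (A.L + A.L * A.D / A.r) / (d * A.β) *
            √(∫ ω, sensitivity A f m z v T ω ∂μ + A.Smin)) := by
  have hA := hG.valid
  have hd := hA.one_le_cast
  have hL := hA.L_nonneg
  have hD := hA.D_pos
  have hr := hA.r_pos
  have hβ := hA.β_pos
  have hP := pathLength_nonneg u T
  have hΛ := log_mul_max_nonneg (A := A) hT
  have hS := one_le_Smin (A := A)
  have h3 : 0 ≤ ∫ ω, sensitivity A f m z v T ω ∂μ := integral_nonneg (sensitivity_nonneg T)
  set Sb := ∫ ω, sensitivity A f m z v T ω ∂μ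
  have e1 : √(d * (Sb + A.Smin) * (A.D ^ 2 + A.D * pathLength u T)) =
      √(d * (A.D ^ 2 + A.D * pathLength u T)) * √(Sb + A.Smin) := by
    rw [← Real.sqrt_mul (by positivity)]
    congr 1
    ring
  have h4 : A.L * A.D / A.r / (d * A.β) ≤ (A.L + A.L * A.D / A.r) / (d * A.β) := by
    gcongr
    linarith
  rw [e1, ← add_mul]
  rcases le_total d (T ^ 2) with h | h
  · refine (hG.integral_regret_le_of_le hT h hu).trans ?_
    gcongr
  · refine (hG.integral_regret_le_of_ge h hu).trans ?_
    have h5 : (1 : ℝ) ≤ 2100 * (1 + Real.log (T * max 1 A.L)) ^ 4 := by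
      have : (1 : ℝ) ≤ (1 + Real.log (T * max 1 A.L)) ^ 4 := one_le_pow₀ (by linarith)
      linarith
    refine le_trans ?_ (le_mul_of_one_le_left (by positivity) h5)
    gcongr
    have : 0 ≤ (A.L + A.L * A.D / A.r) / (d * A.β) := by positivity
    linarith

end IsGame

end TPVR

theorem mainTheorem6 :
    ∃ (C : ℝ) (k : ℕ), 0 < C ∧
      ∀ (d : ℕ) (_hd : 1 ≤ d) (A : TPVR.Config d)
        (_hX : TPVR.IsDecisionSet A.X A.r) (_hL : 0 ≤ A.L) (_hβ : 0 < A.β)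
        (Ω : Type*) (mΩ : MeasurableSpace Ω) (μ : Measure Ω) (_hμ : IsProbabilityMeasure μ)
        -- `ℱ t` is the information available before the direction of round `t` is drawn
        (ℱ : Filtration ℕ mΩ)
        -- losses, chosen by a possibly adaptive environment
        (f : ℕ → Ω → TPVR.E d → ℝ)
        (_hf : ∀ t ω, TPVR.IsLoss A.X A.L A.β (f t ω))
        (_hfm : ∀ t, ∀ x ∈ A.X, Measurable[ℱ t] (fun ω => f t ω x))
        -- clipped predictions
        (m : ℕ → Ω → TPVR.E d)
        (_hm : ∀ t, Measurable[ℱ t] (m t)) (_hmL : ∀ t ω, ‖m t ω‖ ≤ A.L)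
        -- restart points of the experts
        (z : ℕ → Ω → ℕ → TPVR.E d)
        (_hz : ∀ t i, Measurable[ℱ t] (fun ω => z t ω i))
        -- fresh uniform directions
        (v : ℕ → Ω → Metric.sphere (0 : TPVR.E d) 1)
        (_hv : ∀ t, Measurable[ℱ (t + 1)] (v t))
        (_hvlaw : ∀ t, μ.map (v t) = TPVR.uniformSphere d)
        (_hvindep : ∀ t, Indep (ℱ t) (MeasurableSpace.comap (v t) inferInstance) μ)
        -- horizon and comparators
        (T : ℕ) (_hT : 1 ≤ T) (u : ℕ → TPVR.E d) (_hu : ∀ t < T, u t ∈ A.X),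
        let regret : Ω → ℝ := fun ω =>
          A.dynRegret (fun t => f t ω) (fun t => m t ω) (fun t => (v t ω : TPVR.E d))
            (fun t => z t ω) u T
        let S : Ω → ℝ := fun ω =>
          A.predError (fun t => f t ω) (fun t => m t ω) (fun t => (v t ω : TPVR.E d))
            (fun t => z t ω) T
        Integrable regret μ ∧ Integrable S μ ∧
          ∫ ω, regret ω ∂μ ≤
            C * (1 + Real.log (T * max 1 A.L)) ^ k *
              (√(d * ((∫ ω, S ω ∂μ) + max 1 (A.L ^ 2)) *
                  (A.D ^ 2 + A.D * TPVR.pathLength u T)) +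
                (A.L + A.L * A.D / A.r) / (d * A.β) *
                  √((∫ ω, S ω ∂μ) + max 1 (A.L ^ 2))) := by
  refine ⟨2100, 4, by norm_num, ?_⟩
  intro d hd A hX hL hβ Ω mΩ μ hμ ℱ f hf hfm m hm hmL z hz v hv hvlaw hvindep T hT u hu
  have hG : TPVR.IsGame A μ ℱ f m z v :=
    { valid := ⟨hd, hX, hL, hβ⟩
      isLoss := hf
      measurable_loss := hfm
      measurable_pred := hm
      norm_pred_le := hmL
      measurable_restart := hz
      measurable_dir := hv
      law_dir := hvlaw
      indep_dir := hvindep }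
  exact ⟨hG.integrable_regret hu, hG.integrable_sensitivity T, hG.integral_regret_le hT hu⟩
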